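/- Let $c\in\mathbb C\setminus\{0\}$, let $m+n=3$ with $(m,n)=(2,1)$ or $(1,2)$, and put $[i]=0$ for $i\le m$, $[i]=1$ for $i>m$. The super-Yangian $Y(m|n)$ is the unital associative $\mathbb C$-algebra generated by $T_{ij}^{(p)}$ ($1\le i,j\le 3$, $p\ge 0$), with $T_{ij}(u)=\delta_{ij}+\sum_{p\ge0}T^{(p)}_{ij}(c/u)^{p+1}$ of parity $[i]+[j]$, subject to the $RTT$ relation with $R_{12}(u,v)=\mathbb I+g(u,v)P_{12}$, that is, $$T_{ij}(z)T_{kl}(w)-(-1)^{([i]+[j])([k]+[l])}T_{kl}(w)T_{ij}(z)=(-1)^{[l]([i]+[j])+[i][j]}\,g(z,w)\big(T_{il}(z)T_{kj}(w)-T_{il}(w)T_{kj}(z)\big).$$ Here $g(u,v)=\frac{c}{u-v}$, $f(u,v)=1+g(u,v)$, $h(u,v)=\frac{u-v+c}{c}$, and $P=\sum_{i,j}(-1)^{[j]}E_{ij}\otimes E_{ji}$ is the graded permutation; tensor products are graded and $\mathrm{str}\,E_{ij}=(-1)^{[j]}\delta_{ij}$. Let $\psi$ be the antimorphism of $Y(m|n)$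 with $\psi(T_{ij}(u))=(-1)^{[i][j]+[i]}T_{ji}(u)$ and $\psi(AB)=(-1)^{[A][B]}\psi(B)\psi(A)$ for homogeneous $A,B$. Let $\Omega$ be a singular vector of a representation: $T_{ii}(u)\Omega=\lambda_i(u)\Omega$ with $\lambda_i(u)=1+\sum_{p\ge 0}\lambda_i^{(p)}(c/u)^{p+1}$, and $T_{ij}(u)\Omega=0$ for $i>j$. Let $\psi(y\,\Omega)=\Omega^\dagger\psi(y)$, $\Omega^\dagger=\psi(\Omega)$, be its image in a space on which $Y(m|n)$ acts from the right. For ordered sets $\bar u=\{u_1,\dots,u_a\}$, $\bar v=\{v_1,\dots,v_b\}$ of parameters, all distinct, define the Bethe vectors $$\Phi_{ab}(\bar u,\bar v)=N\;\mathrm{str}_{1\cdots a+b}\Big[T_1(u_1)\cdots T_a(u_a)T_{a+1}(v_1)\cdots T_{a+b}(v_b)\,\mathbb R\,E_{21}^{(1)}\cdots E_{21}^{(a)}E_{32}^{(a+1)}\cdots E_{32}^{(a+b)}\Big]\Omega,$$ $$\mathbb R=(R_{a+1,a}\cdots R_{a+1,1})\cdots(R_{a+b,a}\cdots R_{a+b,1}),\qquad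 R_{a+j,k}=R_{a+j,k}(v_j,u_k),$$ where $N=(-1)^b/H(\bar v)$ for $Y(2|1)$ and $N=(-1)^a/H(\bar u)$ for $Y(1|2)$, with $H(\bar w)=\prod_{k<j}h(w_j,w_k)$. The dual Bethe vectors are $\Psi_{ab}(\bar u,\bar v)=\psi(\Phi_{ab}(\bar u^*,\bar v^*))$, where $\bar w^*$ is $\bar w$ in reversed order. The parameters are formal: identities hold between series in the inverse parameters with vector coefficients, the rational functions $g,f,h^{-1}$ being expanded in any region in which the moduli of the parameters are strongly ordered. Objects for $Y(1|2)$ carry a tilde. Write $\bar w_j=\bar w\setminus\{w_j\}$, and let $F(\bar w,z)$, $F(z,\bar w)$ denote products over $\bar w$. Then the dual Bethe vectors of $Y(2|1)$ satisfy, for $a\ge1$, $$\Psi_{ab}(\bar u,\bar v)=\Psi_{a-1,b}(\bar u_a,\bar v)\,T_{21}(u_a)+(-1)^{b-1}\sum_{j=1}^b\lambda_2(v_j)\,g(v_j,u_a)\,f(v_j,\bar u_a)\,g(\bar v_j,v_j)\,\Psi_{a-1,b-1}(\bar u_a,\bar v_j)\,T_{31}(u_a),$$ and, for $b\ge1$,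 $$\Psi_{ab}(\bar u,\bar v)=\frac{(-1)^{b-1}}{h(\bar v_b,v_b)}\Big(\Psi_{a,b-1}(\bar u,\bar v_b)\,T_{32}(v_b)+\sum_{j=1}^a\lambda_2(u_j)\,g(v_b,u_j)\,f(\bar v_b,u_j)\,f(u_j,\bar u_j)\,\Psi_{a-1,b-1}(\bar u_j,\bar v_b)\,T_{31}(v_b)\Big).$$ The dual Bethe vectors of $Y(1|2)$ satisfy, for $a\ge1$, $$\tilde\Psi_{ab}(\bar u,\bar v)=\frac{(-1)^{a-1}}{h(\bar u_a,u_a)}\Big(\tilde\Psi_{a-1,b}(\bar u_a,\bar v)\,\tilde T_{21}(u_a)-\sum_{j=1}^b\tilde\lambda_2(v_j)\,g(u_a,v_j)\,f(\bar u_a,v_j)\,f(v_j,\bar v_j)\,\tilde\Psi_{a-1,b-1}(\bar u_a,\bar v_j)\,\tilde T_{31}(u_a)\Big),$$ and, for $b\ge1$, $$\tilde\Psi_{ab}(\bar u,\bar v)=-\tilde\Psi_{a,b-1}(\bar u,\bar v_b)\,\tilde T_{32}(v_b)-(-1)^{a-1}\sum_{j=1}^a\tilde\lambda_2(u_j)\,g(u_j,v_b)\,f(u_j,\bar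 v_b)\,g(\bar u_j,u_j)\,\tilde\Psi_{a-1,b-1}(\bar u_j,\bar v_b)\,\tilde T_{31}(v_b).$$ -/

import Mathlib

open scoped BigOperators

noncomputable section

namespace SuperBethe

/-! ## The super-Yangian -/

/-- The sign `(-1)^x` of a parity `x`. -/
def sgn (x : ZMod 2) : ℤ := if x = 0 then 1 else -1

/-- The distinguished gradation on `{1, …, N}` (here `{0, …, N-1}`): the first `m` indices are
even, all the others are odd. -/
def grading (m : ℕ) {N : ℕ} (i : Fin N) : ZMod 2 := if (i : ℕ) < m then 0 else 1

section Yangian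

variable {ι : Type} [DecidableEq ι]

/-- The coefficient of `(c/u)^r` in `T_ij(u)`, as an element of the free algebra on the modes
`T_ij^(p)`: it is `δ_ij` for `r = 0` and `T_ij^(p)` for `r = p + 1`. -/
def freeMode (i j : ι) : ℕ → FreeAlgebra ℂ (ι × ι × ℕ)
  | 0 => if i = j then 1 else 0
  | p + 1 => FreeAlgebra.ι ℂ (i, j, p)

/-- The graded commutator of the coefficients of `(c/z)^r` in `T_ij(z)` and of `(c/w)^s` in
`T_kl(w)`. -/
def freeComm (par : ι → ZMod 2) (i j k l : ι) (r s : ℕ) : FreeAlgebra ℂ (ι × ι × ℕ) :=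
  freeMode i j r * freeMode k l s
    - sgn ((par i + par j) * (par k + par l)) • (freeMode k l s * freeMode i j r)

/-- The defining relations of the super-Yangian: the coefficient of `(c/z)^r (c/w)^s` in
`((z - w)/c) [T_ij(z), T_kl(w)} =
  (-1)^([l]([i]+[j])+[i][j]) (T_il(z) T_kj(w) - T_il(w) T_kj(z))`,
which is the component form of the `RTT` relation. -/
inductive YRel (par : ι → ZMod 2) :
    FreeAlgebra ℂ (ι × ι × ℕ) → FreeAlgebra ℂ (ι × ι × ℕ) → Prop
  | rtt (i j k l : ι) (r s : ℕ) :
      YRel par (freeComm par i j k l (r + 1) s - freeComm par i j k l r (s + 1))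
        (sgn (par l * (par i + par j) + par i * par j) •
          (freeMode i l r * freeMode k j s - freeMode i l s * freeMode k j r))

/-- The super-Yangian attached to an index set `ι` with parity `par`; `Y(m|n)` is the case
`ι = Fin (m + n)`, `par = grading m`. -/
def Yangian (par : ι → ZMod 2) : Type := RingQuot (YRel par)

instance (par : ι → ZMod 2) : Ring (Yangian par) := inferInstanceAs (Ring (RingQuot (YRel par)))

instance (par : ι → ZMod 2) : Algebra ℂ (Yangian par) :=
  inferInstanceAs (Algebra ℂ (RingQuot (YRel par)))

/-- The quotient map from the free algebra. -/
def Yangian.mk (par : ι → ZMod 2) : FreeAlgebra ℂ (ι × ι × ℕ) →ₐ[ℂ] Yangian par :=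
  RingQuot.mkAlgHom ℂ (YRel par)

/-- The coefficient of `(c/u)^r` in `T_ij(u)`. -/
def mode (par : ι → ZMod 2) (i j : ι) (r : ℕ) : Yangian par := Yangian.mk par (freeMode i j r)

/-- The generator `T_ij^(p)`. -/
def gen (par : ι → ZMod 2) (i j : ι) (p : ℕ) : Yangian par := mode par i j (p + 1)

theorem sgn_cases (x : ZMod 2) : (x = 0 ∧ sgn x = 1) ∨ (x = 1 ∧ sgn x = -1) := by
  revert x; decide

/-- The underlying map of `gr` on the free algebra. -/
def grFree (par : ι → ZMod 2) : FreeAlgebra ℂ (ι × ι × ℕ) →ₐ[ℂ] Yangian par :=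
  FreeAlgebra.lift ℂ fun x => sgn (par x.1 + par x.2.1) • gen par x.1 x.2.1 x.2.2

theorem grFree_mode (par : ι → ZMod 2) (i j : ι) (r : ℕ) :
    grFree par (freeMode i j r) = sgn (par i + par j) • mode par i j r := by
  cases r with
  | zero =>
    by_cases h : i = j
    · subst h
      have : par i + par i = 0 := CharTwo.add_self_eq_zero _
      simp [freeMode, mode, this, sgn]
    · simp [freeMode, mode, h]
  | succ p => simp [freeMode, grFree, gen]

theorem mode_rel (par : ι → ZMod 2) (i j k l : ι) (r s : ℕ) :
    (mode par i j (r + 1) * mode par k l s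
        - sgn ((par i + par j) * (par k + par l)) • (mode par k l s * mode par i j (r + 1)))
      - (mode par i j r * mode par k l (s + 1)
        - sgn ((par i + par j) * (par k + par l)) • (mode par k l (s + 1) * mode par i j r))
      = sgn (par l * (par i + par j) + par i * par j) •
          (mode par i l r * mode par k j s - mode par i l s * mode par k j r) := by
  have h := RingQuot.mkAlgHom_rel ℂ (YRel.rtt (par := par) i j k l r s)
  change Yangian.mk par _ = Yangian.mk par _ at h
  simpa [freeComm, mode] using h

theorem grFree_rel (par : ι → ZMod 2) ⦃x y⦄ (h : YRel par x y) : grFree par x = grFree par y := by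
  obtain ⟨i, j, k, l, r, s⟩ := h
  have h := mode_rel par i j k l r s
  simp only [freeComm, map_sub, map_mul, map_zsmul, grFree_mode]
  rcases sgn_cases (par i) with ⟨a, -⟩ | ⟨a, -⟩ <;> rcases sgn_cases (par j) with ⟨b, -⟩ | ⟨b, -⟩ <;>
  rcases sgn_cases (par k) with ⟨d, -⟩ | ⟨d, -⟩ <;> rcases sgn_cases (par l) with ⟨e, -⟩ | ⟨e, -⟩ <;>
  simp [a, b, d, e, sgn, CharTwo.add_self_eq_zero] at h ⊢ <;>
  first
  | exact h
  | (rw [← neg_inj] at h; simp only [neg_sub] at h ⊢; rw [← sub_eq_zero] at h ⊢; rw [← h]; abel)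

/-- The parity automorphism of the super-Yangian, `T_ij(u) ↦ (-1)^([i]+[j]) T_ij(u)`: it is the
identity on even elements and minus the identity on odd elements. -/
def gr (par : ι → ZMod 2) : Yangian par →ₐ[ℂ] Yangian par :=
  RingQuot.liftAlgHom ℂ ⟨grFree par, grFree_rel par⟩

/-- The factor `1` in even parity and `-√-1` in odd parity. -/
def twist (x : ZMod 2) : ℂ := if x = 0 then 1 else -Complex.I

/-- The underlying map of `anti` on the free algebra. -/
def antiFree (par : ι → ZMod 2) : FreeAlgebra ℂ (ι × ι × ℕ) →ₐ[ℂ] (Yangian par)ᵐᵒᵖ :=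
  FreeAlgebra.lift ℂ fun x => MulOpposite.op (twist (par x.1 + par x.2.1) •
    sgn (par x.1 * par x.2.1 + par x.1) • gen par x.2.1 x.1 x.2.2)

theorem antiFree_mode (par : ι → ZMod 2) (i j : ι) (r : ℕ) :
    antiFree par (freeMode i j r) = MulOpposite.op (twist (par i + par j) •
      sgn (par i * par j + par i) • mode par j i r) := by
  cases r with
  | zero =>
    by_cases h : i = j
    · subst h
      have h1 : par i + par i = 0 := CharTwo.add_self_eq_zero _
      have h2 : par i * par i + par i = 0 := by
        generalize par i = x; revert x; decide
      simp [freeMode, mode, h1, h2, sgn, twist]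
    · simp [freeMode, mode, h, Ne.symm h]
  | succ p => simp [freeMode, antiFree, gen]

theorem antiFree_rel (par : ι → ZMod 2) ⦃x y⦄ (h : YRel par x y) :
    antiFree par x = antiFree par y := by
  obtain ⟨i, j, k, l, r, s⟩ := h
  have h := mode_rel par j i l k r s
  simp only [freeComm, map_sub, map_mul, map_zsmul, antiFree_mode]
  apply MulOpposite.unop_injective
  rcases sgn_cases (par i) with ⟨a, -⟩ | ⟨a, -⟩ <;> rcases sgn_cases (par j) with ⟨b, -⟩ | ⟨b, -⟩ <;>
  rcases sgn_cases (par k) with ⟨d, -⟩ | ⟨d, -⟩ <;> rcases sgn_cases (par l) with ⟨e, -⟩ | ⟨e, -⟩ <;>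
  simp [a, b, d, e, sgn, twist, CharTwo.add_self_eq_zero, smul_smul] at h ⊢ <;>
  first
  | exact h
  | linear_combination (norm := module) (1 : ℂ) • h
  | linear_combination (norm := module) (-1 : ℂ) • h
  | linear_combination (norm := module) Complex.I • h
  | linear_combination (norm := module) (-Complex.I) • h

/-- An antimorphism of the underlying (ungraded) algebra; the graded antimorphism `psi` is
obtained from it by multiplying the odd part by `√-1`. -/
def anti (par : ι → ZMod 2) : Yangian par →ₐ[ℂ] (Yangian par)ᵐᵒᵖ :=
  RingQuot.liftAlgHom ℂ ⟨antiFree par, antiFree_rel par⟩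

theorem gr_mode (par : ι → ZMod 2) (i j : ι) (r : ℕ) :
    gr par (mode par i j r) = sgn (par i + par j) • mode par i j r := by
  rw [← grFree_mode]
  exact RingQuot.liftAlgHom_mkAlgHom_apply ℂ _ _ _

theorem anti_mode (par : ι → ZMod 2) (i j : ι) (r : ℕ) :
    (anti par (mode par i j r)).unop = twist (par i + par j) •
      sgn (par i * par j + par i) • mode par j i r := by
  rw [← MulOpposite.unop_op (twist (par i + par j) • _), ← antiFree_mode]
  exact congrArg _ (RingQuot.liftAlgHom_mkAlgHom_apply ℂ _ _ _)

theorem anti_gr (par : ι → ZMod 2) (x : Yangian par) :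
    (anti par (gr par x)).unop = gr par (anti par x).unop := by
  have : (anti par).comp (gr par) = ((gr par).op).comp (anti par) := by
    apply RingQuot.ringQuot_ext'
    apply FreeAlgebra.hom_ext
    funext ⟨i, j, p⟩
    change anti par (gr par (mode par i j (p + 1)))
      = MulOpposite.op (gr par (anti par (mode par i j (p + 1))).unop)
    apply MulOpposite.unop_injective
    rw [gr_mode, map_zsmul, MulOpposite.unop_smul, anti_mode, MulOpposite.unop_op, map_smul,
      map_zsmul, gr_mode, add_comm (par j), smul_comm (sgn (par i + par j)),
      smul_comm (sgn (par i + par j)) (sgn _)]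
  exact congrArg MulOpposite.unop (DFunLike.congr_fun this x)

/-- The transposition map `ψ`: the graded antimorphism of the super-Yangian with
`ψ(T_ij(u)) = (-1)^([i][j]+[i]) T_ji(u)` (see `psi_mode`, `psi_one` and `psi_mul`). The odd part
of `anti` is multiplied by `√-1`. -/
def psi (par : ι → ZMod 2) : Yangian par →ₗ[ℂ] Yangian par where
  toFun x := (1 / 2 : ℂ) • ((anti par x).unop + gr par (anti par x).unop)
    + (Complex.I / 2) • ((anti par x).unop - gr par (anti par x).unop)
  map_add' x y := by simp only [map_add, MulOpposite.unop_add]; module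
  map_smul' a x := by simp only [map_smul, MulOpposite.unop_smul, RingHom.id_apply]; module

theorem psi_mode (par : ι → ZMod 2) (i j : ι) (r : ℕ) :
    psi par (mode par i j r) = sgn (par i * par j + par i) • mode par j i r := by
  simp only [psi, LinearMap.coe_mk, AddHom.coe_mk, anti_mode, map_smul, map_zsmul, gr_mode]
  rw [add_comm (par j) (par i)]
  rcases sgn_cases (par i + par j) with ⟨h, h'⟩ | ⟨h, h'⟩ <;> rw [h', h]
  · simp only [twist, one_smul, if_true]; module
  · simp only [twist, one_ne_zero, if_false, neg_smul, one_smul, smul_neg]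
    generalize sgn (par i * par j + par i) • mode par j i r = X
    match_scalars
    linear_combination -Complex.I_mul_I

theorem psi_one (par : ι → ZMod 2) : psi par 1 = 1 := by
  simp only [psi, LinearMap.coe_mk, AddHom.coe_mk, map_one, MulOpposite.unop_one]; module

theorem psi_mul (par : ι → ZMod 2) (a b : ZMod 2) (x y : Yangian par)
    (hx : gr par x = sgn a • x) (hy : gr par y = sgn b • y) :
    psi par (x * y) = sgn (a * b) • (psi par y * psi par x) := by
  have hx' := anti_gr par x
  have hy' := anti_gr par y
  rw [hx, map_zsmul, MulOpposite.unop_smul] at hx'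
  rw [hy, map_zsmul, MulOpposite.unop_smul] at hy'
  simp only [psi, LinearMap.coe_mk, AddHom.coe_mk, map_mul, MulOpposite.unop_mul, ← hx', ← hy']
  generalize (anti par x).unop = X
  generalize (anti par y).unop = Y
  have hI : Complex.I * Complex.I = -1 := Complex.I_mul_I
  rcases sgn_cases a with ⟨rfl, h1⟩ | ⟨rfl, h1⟩ <;> rcases sgn_cases b with ⟨rfl, h2⟩ | ⟨rfl, h2⟩ <;>
  simp [sgn, smul_smul, ← two_smul ℂ]

end Yangian

/-! ## Graded tensor products of auxiliary spaces and the super-trace formula -/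

section Aux

variable {A : Type*} [Ring A]

/-- Elements of the graded tensor product `End(ℂ^{m|n})^{⊗ N} ⊗ A`, with `m + n = 3`: the entry at
`(k, l)` is the coefficient `x` in
`∑ E_{k_1 l_1} ⊗ ⋯ ⊗ E_{k_N l_N} ⊗ x`. -/
abbrev Aux (N : ℕ) (A : Type*) : Type _ := (Fin N → Fin 3) → (Fin N → Fin 3) → A

variable (par : Fin 3 → ZMod 2) (γ : A → A)

/-- The product of the graded tensor product, where `γ` is the parity automorphism of `A`.
Moving the factors `E_{l_p m_p}` of the second element to the left, past `x` and past the factors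
`E_{k_q l_q}` with `p < q` of the first element, produces the signs. -/
def Aux.mul {N : ℕ} (X Y : Aux N A) : Aux N A := fun k m =>
  ∑ l : Fin N → Fin 3,
    sgn (∑ p : Fin N, ∑ q ∈ Finset.Ioi p, (par (l p) + par (m p)) * (par (k q) + par (l q))) •
      ((if ∑ p : Fin N, (par (l p) + par (m p)) = 0 then X k l else γ (X k l)) * Y l m)

/-- The unit `𝕀 ⊗ ⋯ ⊗ 𝕀 ⊗ 1`. -/
def Aux.one (N : ℕ) : Aux N A := fun k l => if k = l then 1 else 0

/-- Ordered product of a list of elements. -/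
def Aux.prod {N : ℕ} (L : List (Aux N A)) : Aux N A := L.foldr (Aux.mul par γ) (Aux.one N)

/-- `∑_{ij} E_ij^{(p)} ⊗ t_ij`: the matrix `t` with entries in `A`, placed in the `p`-th auxiliary
space. -/
def Aux.place {N : ℕ} (p : Fin N) (t : Fin 3 → Fin 3 → A) : Aux N A := fun k l =>
  if ∀ q, q ≠ p → k q = l q then t (k p) (l p) else 0

/-- The elementary matrix `E_ij^{(p)}` in the `p`-th auxiliary space. -/
def Aux.E {N : ℕ} (p : Fin N) (i j : Fin 3) : Aux N A :=
  Aux.place p fun i' j' => if i' = i ∧ j' = j then 1 else 0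

/-- The graded permutation `P_{pq} = ∑_{ij} (-1)^[j] E_ij^{(p)} E_ji^{(q)}`. -/
def Aux.perm {N : ℕ} (p q : Fin N) : Aux N A :=
  ∑ i : Fin 3, ∑ j : Fin 3, sgn (par j) • Aux.mul par γ (Aux.E p i j) (Aux.E q j i)

/-- The `R`-matrix `R_{pq} = 𝕀 + g P_{pq}`, for a (central) coefficient `g`. -/
def Aux.R {N : ℕ} (p q : Fin N) (g : A) : Aux N A :=
  Aux.one N + fun k l => g * Aux.perm par γ p q k l

/-- The super-trace over all auxiliary spaces. -/
def Aux.str {N : ℕ} (X : Aux N A) : A :=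
  ∑ k : Fin N → Fin 3, sgn (∑ p : Fin N, par (k p)) • X k k

/-- The super-trace
`str_{1…a+b} [T_1(u_1) ⋯ T_a(u_a) T_{a+1}(v_1) ⋯ T_{a+b}(v_b) 𝐑 E_21^{(1)} ⋯ E_21^{(a)}
  E_32^{(a+1)} ⋯ E_32^{(a+b)}]`, where
`𝐑 = (R_{a+1,a} ⋯ R_{a+1,1}) (R_{a+2,a} ⋯ R_{a+2,1}) ⋯ (R_{a+b,a} ⋯ R_{a+b,1})` and
`R_{a+j,k} = R_{a+j,k}(v_j, u_k)`. -/
def superTrace {W : Type*} (g : W → W → A) (T : W → Fin 3 → Fin 3 → A) (us vs : List W) : A :=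
  Aux.str par <| Aux.prod par γ (N := us.length + vs.length) <|
    ((List.finRange us.length).map fun p => Aux.place (Fin.castAdd vs.length p) (T (us.get p))) ++
    ((List.finRange vs.length).map fun q => Aux.place (Fin.natAdd us.length q) (T (vs.get q))) ++
    ((List.finRange vs.length).flatMap fun q => (List.finRange us.length).reverse.map fun p =>
      Aux.R par γ (Fin.natAdd us.length q) (Fin.castAdd vs.length p) (g (vs.get q) (us.get p))) ++
    ((List.finRange us.length).map fun p => Aux.E (Fin.castAdd vs.length p) 1 0) ++
    ((List.finRange vs.length).map fun q => Aux.E (Fin.natAdd us.length q) 2 1)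

end Aux

/-! ## Series in the spectral parameters -/

section Series

variable {W : Type*} [LinearOrder W]

/-- Hahn series with coefficients in `R` in the inverses `1/w` of the spectral parameters `w : W`,
ordered lexicographically. `Ser W ℂ` is a field that contains the rational functions of the
parameters, and `Ser W R` contains the formal power series in the `1/w` with coefficients
in `R`. -/
abbrev Ser (W : Type*) [LinearOrder W] [Finite W] (R : Type*) [Zero R] : Type _ :=
  HahnSeries (Lex (W → ℤ)) R

/-- The exponent of the monomial `(1/w)^n`. -/
def expo (w : W) : ℕ →+ Lex (W → ℤ) where
  toFun n := toLex (Pi.single w (n : ℤ))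
  map_zero' := by simp
  map_add' m n := by rw [Nat.cast_add, Pi.single_add]; rfl

theorem expo_strictMono (w : W) : StrictMono (expo w) := by
  intro m n h
  refine ⟨w, fun j hj => ?_, ?_⟩
  · simp [expo, hj.ne]
  · simpa [expo] using h

variable [Finite W] {R : Type*} [Semiring R]

/-- Substitution of `1/w` for the variable of a formal power series. -/
def atInv (w : W) : PowerSeries R →+* Ser W R :=
  (HahnSeries.embDomainRingHom (expo w) (expo_strictMono w).injective
    fun _ _ => (expo_strictMono w).le_iff_le).comp
    (HahnSeries.toPowerSeries (R := R)).symm.toRingHom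

/-- The spectral parameter `w` itself, as a monomial. -/
def param (w : W) : Ser W ℂ := HahnSeries.single (toLex (Pi.single w (-1))) 1

/-- `g(u, v) = c / (u - v)`. -/
def g (c : ℂ) (u v : W) : Ser W ℂ := HahnSeries.C c / (param u - param v)

/-- `f(u, v) = 1 + g(u, v)`. -/
def f (c : ℂ) (u v : W) : Ser W ℂ := 1 + g c u v

/-- `h(u, v) = f(u, v) / g(u, v) = (u - v + c) / c`. -/
def h (c : ℂ) (u v : W) : Ser W ℂ := (param u - param v + HahnSeries.C c) / HahnSeries.C c

/-- `H(v̄) = ∏_{k < j} h(v_j, v_k)`. -/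
def H (c : ℂ) : List W → Ser W ℂ
  | [] => 1
  | v :: vs => (vs.map fun v' => h c v' v).prod * H c vs

/-- The product of `F(x)` over the elements `x` of an ordered set `l`, as in `f(v, ū)`. -/
def prodOver (l : List W) (F : W → Ser W ℂ) : Ser W ℂ := (l.map F).prod

end Series

/-! ## Bethe vectors and dual Bethe vectors -/

section Bethe

variable {W : Type*} [LinearOrder W] [Finite W]

/-- A scalar series as a (central) series with coefficients in the super-Yangian. -/
def scalar (par : Fin 3 → ZMod 2) (k : Ser W ℂ) : Ser W (Yangian par) :=
  k.map (Algebra.linearMap ℂ (Yangian par))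

/-- The series `T_ij(w) = δ_ij + ∑_p T_ij^(p) (c/w)^(p+1)`. -/
def T (par : Fin 3 → ZMod 2) (c : ℂ) (w : W) (i j : Fin 3) : Ser W (Yangian par) :=
  atInv w (PowerSeries.mk fun r => c ^ r • mode par i j r)

/-- The super-trace of the Bethe vectors, in the super-Yangian. -/
def yangianTrace (par : Fin 3 → ZMod 2) (c : ℂ) (us vs : List W) : Ser W (Yangian par) :=
  superTrace par (fun x => x.map (gr par)) (fun v u => scalar par (g c v u)) (T par c) us vs

/-- The gradation `[1] = [2] = 0`, `[3] = 1` of `Y(2|1)`. -/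
abbrev par21 : Fin 3 → ZMod 2 := grading 2

/-- The gradation `[1] = 0`, `[2] = [3] = 1` of `Y(1|2)`. -/
abbrev par12 : Fin 3 → ZMod 2 := grading 1

/-- The super-Yangian `Y(2|1)`. -/
abbrev Y21 : Type := Yangian par21

/-- The super-Yangian `Y(1|2)`. -/
abbrev Y12 : Type := Yangian par12

/-- The element of `Y(2|1)` that creates the Bethe vector from the singular vector. -/
def bethe21 (c : ℂ) (us vs : List W) : Ser W Y21 :=
  scalar par21 ((-1) ^ vs.length / H c vs) * yangianTrace par21 c us vs

/-- The element of `Y(1|2)` that creates the Bethe vector from the singular vector. -/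
def bethe12 (c : ℂ) (us vs : List W) : Ser W Y12 :=
  scalar par12 ((-1) ^ us.length / H c us) * yangianTrace par12 c us vs

/-- A representation `V` of the super-Yangian with a singular vector `Ω`, and its image under
the transposition map: a space `Vd` on which the super-Yangian acts from the right, with the map
`ψ : V → Vd` given by `ψ(y Ω) = Ω† ψ(y)`, `Ω† = ψ(Ω)`. The weights are
`λ_i(u) = 1 + ∑_p λ_i^(p) (c/u)^(p+1)`. -/
structure SingularRep (par : Fin 3 → ZMod 2) (V Vd : Type*)
    [AddCommGroup V] [Module ℂ V] [Module (Yangian par) V] [IsScalarTower ℂ (Yangian par) V]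
    [AddCommGroup Vd] [Module ℂ Vd] [Module (Yangian par)ᵐᵒᵖ Vd]
    [IsScalarTower ℂ (Yangian par)ᵐᵒᵖ Vd] where
  Ω : V
  weight : Fin 3 → ℕ → ℂ
  diag (i : Fin 3) (p : ℕ) : gen par i i p • Ω = weight i p • Ω
  lower (i j : Fin 3) (p : ℕ) : j < i → gen par i j p • Ω = 0
  transp : V →ₗ[ℂ] Vd
  transp_smul (y : Yangian par) : transp (y • Ω) = MulOpposite.op (psi par y) • transp Ω

section Action

variable {Vd : Type*} [AddCommGroup Vd] [Module ℂ Vd]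

/-- Multiplication of a vector-valued series by a scalar series. -/
def scale (k : Ser W ℂ) (x : Ser W Vd) : Ser W Vd :=
  (HahnModule.of ℂ).symm (k • HahnModule.of ℂ x)

/-- The right action of series with coefficients in the super-Yangian on vector-valued series. -/
def rightAct (par : Fin 3 → ZMod 2) [Module (Yangian par)ᵐᵒᵖ Vd]
    (x : Ser W Vd) (y : Ser W (Yangian par)) : Ser W Vd :=
  (HahnModule.of (Yangian par)ᵐᵒᵖ).symm
    (y.map (MulOpposite.opAddEquiv : Yangian par ≃+ (Yangian par)ᵐᵒᵖ) •
      HahnModule.of (Yangian par)ᵐᵒᵖ x)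

end Action

namespace SingularRep

variable {par : Fin 3 → ZMod 2} {V Vd : Type*}
  [AddCommGroup V] [Module ℂ V] [Module (Yangian par) V] [IsScalarTower ℂ (Yangian par) V]
  [AddCommGroup Vd] [Module ℂ Vd] [Module (Yangian par)ᵐᵒᵖ Vd]
  [IsScalarTower ℂ (Yangian par)ᵐᵒᵖ Vd]

/-- The weight `λ_i(w)`. -/
def lam (M : SingularRep par V Vd) (c : ℂ) (i : Fin 3) (w : W) : Ser W ℂ :=
  atInv w (1 + PowerSeries.X * PowerSeries.mk fun p => c ^ (p + 1) * M.weight i p)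

/-- The vector `B Ω`, for a series `B` with coefficients in the super-Yangian. -/
def apply (M : SingularRep par V Vd) (B : Ser W (Yangian par)) : Ser W V :=
  B.map (LinearMap.toSpanSingleton (Yangian par) V M.Ω)

end SingularRep

section Vectors

variable {V Vd : Type*}

section
variable [AddCommGroup V] [Module ℂ V] [Module Y21 V] [IsScalarTower ℂ Y21 V]
  [AddCommGroup Vd] [Module ℂ Vd] [Module Y21ᵐᵒᵖ Vd] [IsScalarTower ℂ Y21ᵐᵒᵖ Vd]

/-- The Bethe vectors `Φ_{ab}(ū, v̄)` of `Y(2|1)`. -/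
def Phi21 (M : SingularRep par21 V Vd) (c : ℂ) (us vs : List W) : Ser W V :=
  M.apply (bethe21 c us vs)

/-- The dual Bethe vectors `Ψ_{ab}(ū, v̄) = ψ(Φ_{ab}(ū*, v̄*))` of `Y(2|1)`, where `*` reverses the
order of a set. -/
def Psi21 (M : SingularRep par21 V Vd) (c : ℂ) (us vs : List W) : Ser W Vd :=
  (Phi21 M c us.reverse vs.reverse).map M.transp

end

section
variable [AddCommGroup V] [Module ℂ V] [Module Y12 V] [IsScalarTower ℂ Y12 V]
  [AddCommGroup Vd] [Module ℂ Vd] [Module Y12ᵐᵒᵖ Vd] [IsScalarTower ℂ Y12ᵐᵒᵖ Vd]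

/-- The Bethe vectors `Φ̃_{ab}(ū, v̄)` of `Y(1|2)`. -/
def Phi12 (M : SingularRep par12 V Vd) (c : ℂ) (us vs : List W) : Ser W V :=
  M.apply (bethe12 c us vs)

/-- The dual Bethe vectors `Ψ̃_{ab}(ū, v̄) = ψ̃(Φ̃_{ab}(ū*, v̄*))` of `Y(1|2)`. -/
def Psi12 (M : SingularRep par12 V Vd) (c : ℂ) (us vs : List W) : Ser W Vd :=
  (Phi12 M c us.reverse vs.reverse).map M.transp

end

end Vectors

end Bethe

end SuperBethe

end

namespace SuperBethe

/-! ## Words and exchange relations -/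

/-! In the code the indices 1, 2, 3 are 0, 1, 2, and a word in the letters `false`, `true` stands
for a word in the indices 2, 3. Applied to the singular vector, the super-trace collapses to a
nested vector (`superTrace_smul`): the operators T_12 and T_13 at the parameters ū are contracted
with the components of a vector made by the off-diagonal entries, at the parameters v̄, of a
monodromy matrix. This matrix starts from the row T_22, T_23 and has one two-state site for each u.
The nested vector is called `offShell`.

Recursion in ū: the first site is split off. It is either unflipped, which gives T_12(u) on a
smaller vector, or flipped, which gives T_13(u). The flipped component is, up to the operator B, the
collection of unwanted terms in the action of the diagonal entry (`Exch.diag_chain`), so the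
exchange relations and one three-term identity for g determine it (`Exch.flipped_eq`). The exchange
relations survive the addition of a site (`Exch.cop`), so this holds with any number of sites left;
the result is `nested_cons`.

Recursion in v̄: by the RTT relation between T(u) and T(v), the same vector is also a nested vector
with sites v̄ and a chain of entries T_12 (`nested_swap`). Splitting off the first site there gives
the second recursion.

Duality: ψ turns left multiplication by T_1j or T_23 into a right action of T_j1 or T_32, with a
sign that depends on the parity of the remaining vector, and nested vectors have a definite parity
(`Transposition.offShell_mem`). The reversal of both sets turns the first parameter into the last
one.

Normalization: one set of parameters is fermionic, v̄ for Y(2|1) and ū for Y(1|2). A sum over this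
set carries factors -1 + g and 1 + g, which equal products of g and h; their h-factors cancel
against H (`IsRatio.prod_div_pairProd`) and only the product of g remains. When a fermionic
parameter is itself split off, H loses the factors containing it, whence the prefactor 1/h. -/

section Exchange

variable {W K M N : Type*} [Field K] [AddCommGroup M] [Module K M] [AddCommGroup N] [Module K N]

/-- The function on words that is `x` behind the letter `false` and `y` behind `true`. -/
def glue (x y : List Bool → M) : List Bool → M
  | [] => 0
  | false :: ns => x ns
  | true :: ns => y ns

@[simp] theorem glue_nil (x y : List Bool → M) : glue x y [] = 0 := rfl
@[simp] theorem glue_false (x y : List Bool → M) (ns : List Bool) :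
    glue x y (false :: ns) = x ns := rfl
@[simp] theorem glue_true (x y : List Bool → M) (ns : List Bool) :
    glue x y (true :: ns) = y ns := rfl

variable (K) in
/-- The part of a function on words behind the letter `b`. -/
def slice (b : Bool) : (List Bool → M) →ₗ[K] (List Bool → M) := LinearMap.funLeft K M (List.cons b)

@[simp] theorem slice_apply (b : Bool) (q : List Bool → M) (ns : List Bool) :
    slice K b q ns = q (b :: ns) := rfl

@[simp] theorem slice_glue_false (x y : List Bool → M) : slice K false (glue x y) = x := rfl
@[simp] theorem slice_glue_true (x y : List Bool → M) : slice K true (glue x y) = y := rfl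

/-- `glue` for linear maps. -/
def glueLin (X Y : N →ₗ[K] (List Bool → M)) : N →ₗ[K] (List Bool → M) where
  toFun n := glue (X n) (Y n)
  map_add' a b := by
    funext ns; rcases ns with _ | ⟨_ | _, ns⟩ <;> simp
  map_smul' a b := by
    funext ns; rcases ns with _ | ⟨_ | _, ns⟩ <;> simp

@[simp] theorem glueLin_apply (X Y : N →ₗ[K] (List Bool → M)) (n : N) :
    glueLin X Y n = glue (X n) (Y n) := rfl

/-- A kernel that behaves like `κ / (z - w)`. -/
structure IsKernel (g : W → W → K) : Prop where
  antisymm (z w : W) : g w z = - g z w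
  three_term {z w u : W} : z ≠ w → z ≠ u → w ≠ u →
    g z u * g w u + g z u * g z w - g z w * g w u = 0

theorem IsKernel.smul {g : W → W → K} (hg : IsKernel g) (a : K) :
    IsKernel fun z w => a * g z w where
  antisymm z w := by rw [hg.antisymm z w]; ring
  three_term h1 h2 h3 := by linear_combination a ^ 2 * hg.three_term h1 h2 h3

/-- The relations between the diagonal entry `D` and the off-diagonal entry `B` of a row of a
monodromy matrix, for parameters in `P`. -/
structure Exch (g : W → W → K) (η : K) (D B : W → Module.End K M) (P : W → Prop) : Prop where
  db {z w : W} : P z → P w → z ≠ w → ∀ x,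
    D z (B w x) = (1 - g z w) • B w (D z x) + g z w • B z (D w x)
  bb {z w : W} : P z → P w → z ≠ w → ∀ x,
    (1 + g z w) • B z (B w x) = (η + g z w) • B w (B z x)
  dd {z w : W} : P z → P w → z ≠ w → ∀ x, D z (D w x) = D w (D z x)

theorem Exch.mono {g : W → W → K} {η : K} {D B : W → Module.End K M} {P Q : W → Prop}
    (h : Exch g η D B P) (hPQ : ∀ w, Q w → P w) : Exch g η D B Q where
  db hz hw := h.db (hPQ _ hz) (hPQ _ hw)
  bb hz hw := h.bb (hPQ _ hz) (hPQ _ hw)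
  dd hz hw := h.dd (hPQ _ hz) (hPQ _ hw)

/-- `B(v_1) ⋯ B(v_b) x`. -/
def chain (B : W → Module.End K M) (vs : List W) (x : M) : M := vs.foldr (fun v y => B v y) x

@[simp] theorem chain_nil (B : W → Module.End K M) (x : M) : chain B [] x = x := rfl
@[simp] theorem chain_cons (B : W → Module.End K M) (v : W) (vs : List W) (x : M) :
    chain B (v :: vs) x = B v (chain B vs x) := rfl

/-- The sum of `F p v s` over all decompositions `p ++ v :: s` of a list. -/
def splitSum : List W → (List W → W → List W → M) → M
  | [], _ => 0
  | v :: vs, F => F [] v vs + splitSum vs fun p w s => F (v :: p) w s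

theorem splitSum_congr (vs : List W) {F G : List W → W → List W → M}
    (h : ∀ p w s, vs = p ++ w :: s → F p w s = G p w s) : splitSum vs F = splitSum vs G := by
  induction vs generalizing F G with
  | nil => rfl
  | cons v vs ih =>
    simp only [splitSum]
    rw [h [] v vs rfl, ih fun p w s e => h (v :: p) w s (by rw [e]; rfl)]

theorem map_splitSum {E : Type*} [FunLike E M N] [AddMonoidHomClass E M N] (φ : E) (vs : List W)
    (F : List W → W → List W → M) :
    φ (splitSum vs F) = splitSum vs fun p w s => φ (F p w s) := by
  induction vs generalizing F with
  | nil => exact map_zero φ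
  | cons v vs ih => simp only [splitSum, map_add, ih]

theorem splitSum_add (vs : List W) (F G : List W → W → List W → M) :
    splitSum vs (fun p w s => F p w s + G p w s) = splitSum vs F + splitSum vs G := by
  induction vs generalizing F G with
  | nil => simp [splitSum]
  | cons v vs ih => simp only [splitSum, ih]; abel

/-- The component of `B(v_1) ⋯ B(v_b)` in which one site of parameter `x` is flipped. -/
def flipped (g : W → W → K) (η : K) (D B : W → Module.End K M) (ω : M) (x : W) : List W → M
  | [] => 0
  | v :: vs => g v x • D v (chain B vs ω) + (η + g v x) • B v (flipped g η D B ω x vs)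

section Relations

variable {g : W → W → K} {η : K} {D B : W → Module.End K M} {P : W → Prop} {ω : M} {Λ : W → K}

/-- Moving `D z` to the right through the chain gives the eigenvalue term and unwanted terms in
which `B z` replaces a factor of the chain. The recursion of `flipped` at `x = z` reproduces the
unwanted terms with the opposite sign, once `bb` has interchanged `B v` and `B z`. -/
theorem Exch.diag_chain (hg : IsKernel g) (h : Exch g η D B P)
    (hΛ : ∀ z, P z → D z ω = Λ z • ω) {z : W} (hz : P z) (vs : List W) (hvs : ∀ v ∈ vs, P v)
    (hzv : z ∉ vs) :
    D z (chain B vs ω) + B z (flipped g η D B ω z vs)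
      = (Λ z * (vs.map fun v => 1 + g v z).prod) • chain B vs ω := by
  induction vs with
  | nil => simp [flipped, hΛ z hz]
  | cons v vs ih =>
    have hv : P v := hvs v (by simp)
    have hne : z ≠ v := fun e => hzv (by simp [e])
    have ih := ih (fun w hw => hvs w (by simp [hw])) (fun hw => hzv (by simp [hw]))
    simp only [chain_cons, flipped, map_add, map_smul, List.map_cons, List.prod_cons]
    have h1 := h.db hz hv hne (chain B vs ω)
    have h2 := h.bb hv hz hne.symm (flipped g η D B ω z vs)
    have h3 := congrArg (B v) ih
    rw [map_add, map_smul] at h3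
    rw [h1, ← h2, hg.antisymm v z]
    linear_combination (norm := module) (1 + g v z) • h3

/-- By `Exch.diag_chain`, the `D v` in the recursion is an eigenvalue term minus `B v` applied to
the flipped component at `v`. The induction hypothesis at `x` and at `v` then gives two sums over
the same decompositions, which combine term by term. -/
theorem Exch.flipped_eq (hg : IsKernel g) (h : Exch g η D B P)
    (hΛ : ∀ z, P z → D z ω = Λ z • ω) (x : W) (vs : List W) (hvs : ∀ v ∈ vs, P v)
    (hnd : vs.Nodup) (hx : x ∉ vs) :
    flipped g η D B ω x vs = splitSum vs fun p w s =>
      (Λ w * g w x * (p.map fun i => η + g i w).prod * (s.map fun i => 1 + g i w).prod) •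
        chain B (p ++ s) ω := by
  induction vs generalizing x with
  | nil => rfl
  | cons v vs ih =>
    have hv : P v := hvs v (by simp)
    have hvs' : ∀ w ∈ vs, P w := fun w hw => hvs w (by simp [hw])
    have hnd' := List.nodup_cons.1 hnd
    have hxv : v ≠ x := fun e => hx (by simp [e])
    have hx' : x ∉ vs := fun hw => hx (by simp [hw])
    have e1 := h.diag_chain hg hΛ hv vs hvs' hnd'.1
    rw [← eq_sub_iff_add_eq] at e1
    rw [flipped, e1, smul_sub, smul_smul, sub_add, ← map_smul, ← map_smul, ← map_sub,
      ih v hvs' hnd'.2 hnd'.1, ih x hvs' hnd'.2 hx', splitSum, sub_eq_add_neg]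
    congr 1
    · simp only [List.map_nil, List.prod_nil, List.nil_append, mul_one]
      congr 1; ring
    · rw [← map_neg]
      have key : ∀ a b : K, ∀ F G : List W → W → List W → M,
          b • splitSum vs G - a • splitSum vs F
            = splitSum vs fun p w s => b • G p w s - a • F p w s := by
        intro a b F G
        have h1 := map_splitSum (b • LinearMap.id : M →ₗ[K] M) vs G
        have h2 := map_splitSum (-(a • LinearMap.id) : M →ₗ[K] M) vs F
        simp only [LinearMap.smul_apply, LinearMap.id_apply, LinearMap.neg_apply] at h1 h2
        simp only [sub_eq_add_neg]
        rw [splitSum_add, ← h1, ← h2]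
      rw [neg_sub, key, map_splitSum]
      apply splitSum_congr
      rintro p w s rfl
      have hw : w ≠ x := fun e => hx' (by simp [e])
      have hwv : v ≠ w := fun e => hnd'.1 (by simp [e])
      simp only [List.map_cons, List.prod_cons, List.cons_append, chain_cons, smul_smul,
        ← sub_smul, map_smul]
      congr 1
      -- The identity needed is (η + g(v,x)) g(w,x) - g(v,x) g(w,v) = (η + g(v,w)) g(w,x): `v`
      -- stands before `w` and contributes its factor to the product over `p`.
      have := hg.three_term hwv hxv hw
      rw [hg.antisymm v w]
      linear_combination (Λ w * (p.map fun i => η + g i w).prod *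
        (s.map fun i => 1 + g i w).prod) * this

end Relations

section Coproduct

/-- The diagonal entry of the monodromy matrix with one more site. -/
def copD (g : W → W → K) (D B : W → Module.End K (List Bool → M)) (u v : W) :
    Module.End K (List Bool → M) :=
  glueLin ((1 + g v u) • D v ∘ₗ slice K false + g v u • B v ∘ₗ slice K true) (D v ∘ₗ slice K true)

/-- The off-diagonal entry of the monodromy matrix with one more site. -/
def copB (g : W → W → K) (η : K) (D B : W → Module.End K (List Bool → M)) (u v : W) :
    Module.End K (List Bool → M) :=
  glueLin (B v ∘ₗ slice K false) (g v u • D v ∘ₗ slice K false + (η + g v u) • B v ∘ₗ slice K true)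

variable {g : W → W → K} {η : K} {D B : W → Module.End K (List Bool → M)} {P : W → Prop}

theorem copD_apply (u v : W) (q : List Bool → M) : copD g D B u v q =
    glue ((1 + g v u) • D v (slice K false q) + g v u • B v (slice K true q))
      (D v (slice K true q)) := rfl

theorem copB_apply (u v : W) (q : List Bool → M) : copB g η D B u v q =
    glue (B v (slice K false q))
      (g v u • D v (slice K false q) + (η + g v u) • B v (slice K true q)) := rfl

theorem glue_add (x y x' y' : List Bool → M) : glue x y + glue x' y' = glue (x + x') (y + y') := by
  funext ns; rcases ns with _ | ⟨_ | _, ns⟩ <;> simp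

theorem smul_glue (a : K) (x y : List Bool → M) : a • glue x y = glue (a • x) (a • y) := by
  funext ns; rcases ns with _ | ⟨_ | _, ns⟩ <;> simp

/-- A new site multiplies the monodromy matrix by an R-matrix, and this preserves the exchange
relations. In components it is the three-term identity for `z`, `w`, `u`, which is why `u` is
removed from the admissible parameters; η² = 1 enters only in `bb`. -/
theorem Exch.cop (hg : IsKernel g) (hη : η * η = 1) (h : Exch g η D B P) (u : W) :
    Exch g η (copD g D B u) (copB g η D B u) (fun w => P w ∧ w ≠ u) where
  db {z w} hz hw hzw q := by
    have h3 := hg.three_term hzw hz.2 hw.2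
    simp only [copD_apply, copB_apply, slice_glue_false, slice_glue_true, glue_add, smul_glue,
      map_add, map_smul]
    generalize slice K false q = x
    generalize slice K true q = y
    have b2 := h.bb hw.1 hz.1 hzw.symm y
    rw [hg.antisymm z w] at b2
    congr 1
    · rw [h.db hz.1 hw.1 hzw x]
      linear_combination (norm := skip) (-(g z u)) • b2
      match_scalars
      · ring
      · linear_combination h3
      · linear_combination h3
      · ring
    · rw [h.dd hz.1 hw.1 hzw x, h.db hz.1 hw.1 hzw y, h.db hw.1 hz.1 hzw.symm y, hg.antisymm z w]
      match_scalars
      · linear_combination -h3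
      · ring
      · linear_combination -h3
  bb {z w} hz hw hzw q := by
    have h3 := hg.three_term hzw hz.2 hw.2
    simp only [copB_apply, slice_glue_false, slice_glue_true, smul_glue, map_add, map_smul]
    generalize slice K false q = x
    generalize slice K true q = y
    have b1 := h.bb hz.1 hw.1 hzw y
    congr 1
    · exact h.bb hz.1 hw.1 hzw x
    · rw [h.db hz.1 hw.1 hzw x, h.db hw.1 hz.1 hzw.symm x, hg.antisymm z w]
      linear_combination (norm := skip) ((η + g z u) * (η + g w u)) • b1
      match_scalars
      · linear_combination -(η + g z w) * h3 - g z u * hη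
      · linear_combination (1 + g z w) * h3
      · ring
      · ring
  dd {z w} hz hw hzw q := by
    have h3 := hg.three_term hzw hz.2 hw.2
    simp only [copD_apply, slice_glue_false, slice_glue_true, map_add, map_smul]
    generalize slice K false q = x
    generalize slice K true q = y
    congr 1
    · rw [h.dd hz.1 hw.1 hzw x, h.db hz.1 hw.1 hzw y, h.db hw.1 hz.1 hzw.symm y, hg.antisymm z w]
      match_scalars
      · ring
      · linear_combination h3
      · linear_combination -h3
    · exact h.dd hz.1 hw.1 hzw y

end Coproduct

end Exchange


/-! ## Nested vectors -/

section Nested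

variable {W K M N : Type*} [Field K] [AddCommGroup M] [Module K M] [AddCommGroup N] [Module K N]

/-- The entries `D` (for `false`) and `B` (for `true`) of a row of the monodromy matrix with
sites `us`. -/
def monodromy (g : W → W → K) (η : K) (D B : W → Module.End K M) :
    List W → Bool → W → Module.End K (List Bool → M)
  | [], false => fun v => (D v).compLeft (List Bool)
  | [], true => fun v => (B v).compLeft (List Bool)
  | u :: us, false => copD g (monodromy g η D B us false) (monodromy g η D B us true) u
  | u :: us, true => copB g η (monodromy g η D B us false) (monodromy g η D B us true) u

variable (K) in
/-- `∑ t_{n_1}(u_1) ⋯ t_{n_a}(u_a) q(n)`, where `t` is `a` for the letter `false` and `b` for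
`true`. -/
def contract (a b : W → Module.End K M) : List W → (List Bool → M) →ₗ[K] M
  | [] => LinearMap.proj []
  | u :: us => a u ∘ₗ contract a b us ∘ₗ slice K false + b u ∘ₗ contract a b us ∘ₗ slice K true

/-- The vector `ω` in the state in which all sites are `false`. -/
def vac (ω : M) : List W → (List Bool → M)
  | [] => fun _ => ω
  | _ :: us => glue (vac ω us) 0

/-- The nested vector with sites `us` and rapidities `vs`. -/
def nested (a b D B : W → Module.End K M) (g : W → W → K) (η : K) (ω : M) (us vs : List W) : M :=
  contract K a b us (chain (monodromy g η D B us true) vs (vac ω us))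

variable {a b D B : W → Module.End K M} {g : W → W → K} {η : K} {P : W → Prop} {ω : M} {Λ : W → K}

theorem Exch.monodromy (hg : IsKernel g) (hη : η * η = 1) (h : Exch g η D B P) (us : List W) :
    Exch g η (monodromy g η D B us false) (monodromy g η D B us true) (fun w => P w ∧ w ∉ us) := by
  induction us with
  | nil =>
    constructor
    · intro z w hz hw hzw x; funext ns; exact h.db hz.1 hw.1 hzw (x ns)
    · intro z w hz hw hzw x; funext ns; exact h.bb hz.1 hw.1 hzw (x ns)
    · intro z w hz hw hzw x; funext ns; exact h.dd hz.1 hw.1 hzw (x ns)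
  | cons u us ih =>
    refine (ih.cop hg hη u).mono ?_
    intro w hw
    simp only [List.mem_cons, not_or] at hw
    exact ⟨⟨hw.1, hw.2.2⟩, hw.2.1⟩

/-- On the word without flips each site only contributes the factor in front of `D` in `copD`. -/
theorem monodromy_vac (hΛ : ∀ z, P z → D z ω = Λ z • ω) (us : List W) {z : W} (hz : P z) :
    monodromy g η D B us false z (vac ω us)
      = (Λ z * (us.map fun u => 1 + g z u).prod) • vac ω us := by
  induction us with
  | nil => funext ns; simpa [monodromy, vac] using hΛ z hz
  | cons u us ih =>
    simp only [monodromy, vac, copD_apply, slice_glue_false, slice_glue_true, map_zero, smul_zero,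
      add_zero, ih, smul_glue, List.map_cons, List.prod_cons, smul_smul]
    congr 2; ring

/-- The origin of the recursion defining `flipped`: the unflipped component evolves by `B` alone,
and the flipped one is fed by the `D` term of `copB`. -/
theorem chain_copB_glue (D B : W → Module.End K (List Bool → M)) (u : W) (vs : List W)
    (x : List Bool → M) :
    chain (copB g η D B u) vs (glue x 0) = glue (chain B vs x) (flipped g η D B x u vs) := by
  induction vs with
  | nil => rfl
  | cons v vs ih => rw [chain_cons, ih, copB_apply]; rfl

/-- The recursion that splits off the first site. -/
theorem nested_cons (hg : IsKernel g) (hη : η * η = 1) (h : Exch g η D B P)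
    (hΛ : ∀ z, P z → D z ω = Λ z • ω) (u : W) (us vs : List W) (hvs : ∀ v ∈ vs, P v ∧ v ∉ us)
    (hnd : vs.Nodup) (hu : u ∉ vs) :
    nested a b D B g η ω (u :: us) vs = a u (nested a b D B g η ω us vs)
      + b u (splitSum vs fun p w s =>
        (Λ w * (us.map fun x => 1 + g w x).prod * g w u * (p.map fun i => η + g i w).prod
          * (s.map fun i => 1 + g i w).prod) • nested a b D B g η ω us (p ++ s)) := by
  -- The weight here is the eigenvalue of the diagonal entry for the remaining sites; it accounts
  -- for the product over `us` in the coefficient.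
  have h1 := (h.monodromy hg hη us).flipped_eq hg
    (fun z hz => monodromy_vac (η := η) (B := B) hΛ us hz.1) u vs hvs hnd hu
  simp only [nested, monodromy, vac, contract, chain_copB_glue, LinearMap.add_apply,
    LinearMap.comp_apply, slice_glue_false, slice_glue_true, h1, map_splitSum, map_smul]

theorem nested_nil (vs : List W) : nested a b D B g η ω [] vs = chain B vs ω := by
  have : ∀ vs, chain (monodromy g η D B [] true) vs (vac ω ([] : List W))
      = fun _ => chain B vs ω := by
    intro vs
    induction vs with
    | nil => rfl
    | cons v vs ih => rw [chain_cons, ih]; rfl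
  rw [nested, this]; rfl

end Nested

/-! ## Equality of the two nestings -/

section Duality

variable {W K M N : Type*} [Field K] [AddCommGroup M] [Module K M] [AddCommGroup N] [Module K N]

/-- The vectors `t_{k_1}(u_1) ⋯ t_{k_a}(u_a) p`, for words `k`. -/
def wordVec (t : Bool → W → Module.End K M) : List W → M → (List Bool → M)
  | [], p => fun _ => p
  | u :: us, p => glue (fun ks => t false u (wordVec t us p ks)) fun ks =>
      t true u (wordVec t us p ks)

/-- Contraction of the sites `us` with free row indices. -/
def contractRow (t : Bool → Bool → W → Module.End K M) :
    List W → (List Bool → M) →ₗ[K] (List Bool → M)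
  | [] => LinearMap.id
  | u :: us => glueLin
      ((t false false u).compLeft _ ∘ₗ contractRow t us ∘ₗ slice K false
        + (t false true u).compLeft _ ∘ₗ contractRow t us ∘ₗ slice K true)
      ((t true false u).compLeft _ ∘ₗ contractRow t us ∘ₗ slice K false
        + (t true true u).compLeft _ ∘ₗ contractRow t us ∘ₗ slice K true)

variable (M) in
/-- The action on row indices of the entries in the row `true` of the monodromy matrix with
sites `us`. -/
def rowOp (g : W → W → K) (η : K) (v : W) : List W → Bool → Module.End K (List Bool → M)
  | [], true => LinearMap.id
  | [], false => 0
  | u :: us, true => glueLin (rowOp g η v us true ∘ₗ slice K false)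
      ((1 + g u v) • rowOp g η v us true ∘ₗ slice K true
        + g u v • rowOp g η v us false ∘ₗ slice K false)
  | u :: us, false => glueLin (g u v • rowOp g η v us true ∘ₗ slice K true
        + (η + g u v) • rowOp g η v us false ∘ₗ slice K false)
      (rowOp g η v us false ∘ₗ slice K true)

/-- `rowOp` recombines values at different words with scalar coefficients, hence commutes with any
linear map applied to all values. -/
theorem rowOp_comp (g : W → W → K) (η : K) (v : W) (us : List W) (b : Bool) (φ : M →ₗ[K] N)
    (q : List Bool → M) (ks : List Bool) :
    rowOp N g η v us b (fun ks => φ (q ks)) ks = φ (rowOp M g η v us b q ks) := by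
  induction us generalizing b q ks with
  | nil => cases b <;> simp [rowOp]
  | cons u us ih =>
    have h (x b ks) : rowOp N g η v us b (slice K x fun ks => φ (q ks)) ks
        = φ (rowOp M g η v us b (slice K x q) ks) := ih b (slice K x q) ks
    rcases b with _ | _ <;> rcases ks with _ | ⟨_ | _, ks⟩ <;> simp [rowOp, h]

/-- The `RTT` relation between the sites `u` and `v`, for the rows `0, 1` and the columns `1, 2`
(the letters `false, true`). -/
def RowCol (g : W → W → K) (η : K) (t : Bool → Bool → W → Module.End K M) (u v : W) : Prop :=
  ∀ (k i x j : Bool) (q : M),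
    (if x = j then ((if x then -η else 1) + g u v) • t k x u (t i j v q)
      else t k x u (t i j v q) + g u v • t k j u (t i x v q))
    = if k = i then ((if k then 1 else η) + g u v) • t i j v (t k x u q)
      else t i j v (t k x u q) + g u v • t k j v (t i x u q)

variable {g : W → W → K} {η : K} {t : Bool → Bool → W → Module.End K M}

theorem contractRow_cons (u : W) (us : List W) (q : List Bool → M) :
    contractRow t (u :: us) q = glue
      (fun ks => t false false u (contractRow t us (slice K false q) ks)
        + t false true u (contractRow t us (slice K true q) ks))
      (fun ks => t true false u (contractRow t us (slice K false q) ks)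
        + t true true u (contractRow t us (slice K true q) ks)) := rfl

/-- The RTT relation is applied once at each site `u`: it carries the entry at `v` to the left of
all the operators at `us`, and the R-matrices that acted on column letters then act on row letters.
-/
theorem contractRow_monodromy (us : List W) (v : W) (h : ∀ u ∈ us, RowCol g η t u v) (j : Bool)
    (q : List Bool → M) (ks : List Bool) :
    contractRow t us (monodromy (fun z w => g w z) (-η) (t true false) (t true true) us j v q) ks
      = t true j v (rowOp M g η v us true (contractRow t us q) ks)
        + t false j v (rowOp M g η v us false (contractRow t us q) ks) := by
  induction us generalizing j q ks with
  | nil => cases j <;> simp [contractRow, rowOp, monodromy]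
  | cons u us ih =>
    have ih := fun j q ks => ih (fun w hw => h w (by simp [hw])) j q ks
    have hR := h u (by simp)
    have e1 (φ : Module.End K M) (b : Bool) (q ks) :
        rowOp M g η v us b (fun ks => φ (q ks)) ks = φ (rowOp M g η v us b q ks) :=
      rowOp_comp g η v us b φ q ks
    have e2 (b : Bool) (p q : List Bool → M) (ks) : rowOp M g η v us b (fun ks => p ks + q ks) ks
        = rowOp M g η v us b p ks + rowOp M g η v us b q ks := by
      change rowOp M g η v us b (p + q) ks = _
      rw [map_add]; rfl
    generalize hX : contractRow t us (slice K false q) = X at *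
    generalize hY : contractRow t us (slice K true q) = Y at *
    rcases ks with _ | ⟨k, ks⟩
    · cases j <;> simp [contractRow_cons, rowOp]
    -- One RTT relation for each pair of a row of the operator at `v` and a column letter of the
    -- site `u`.
    have a1 := hR k true false j (rowOp M g η v us true X ks)
    have a2 := hR k true true j (rowOp M g η v us true Y ks)
    have a3 := hR k false false j (rowOp M g η v us false X ks)
    have a4 := hR k false true j (rowOp M g η v us false Y ks)
    cases k <;> cases j <;>
    · simp only [contractRow_cons, monodromy, copD_apply, copB_apply, slice_glue_false,
        slice_glue_true, map_add, map_smul, glue_false, glue_true, Pi.add_apply, Pi.smul_apply, ih,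
        rowOp, glueLin_apply, LinearMap.add_apply, LinearMap.smul_apply, LinearMap.comp_apply, e1,
        e2, hX, hY] at a1 a2 a3 a4 ⊢
      simp at a1 a2 a3 a4
      linear_combination (norm := module) a1 + a2 + a3 + a4

/-- The action on row letters found in `contractRow_monodromy` is what an additional site `v` does
in the other nesting: the two entries of `rowOp` are the unflipped and the flipped state of that
site. -/
theorem wordVec_copB (D B : W → Module.End K (List Bool → M)) (v : W) (us : List W)
    (p : List Bool → M) (ks : List Bool) :
    wordVec (fun b => if b then copD g D B v else copB g η D B v) us (glue p 0) ks
      = glue (rowOp _ g η v us true (wordVec (fun b => if b then D else B) us p) ks)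
          (rowOp _ g η v us false (wordVec (fun b => if b then D else B) us p) ks) := by
  induction us generalizing ks with
  | nil => simp [wordVec, rowOp]
  | cons u us ih =>
    have e1 (φ : Module.End K (List Bool → M)) (b : Bool) (q ks) :
        rowOp _ g η v us b (fun ks => φ (q ks)) ks = φ (rowOp _ g η v us b q ks) :=
      rowOp_comp g η v us b φ q ks
    rcases ks with _ | ⟨_ | _, ks⟩
    · funext ns; rcases ns with _ | ⟨_ | _, ns⟩ <;> simp [wordVec, rowOp]
    · simp only [wordVec, glue_false, ih, Bool.false_eq_true, if_false, copB_apply,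
        slice_glue_false, slice_glue_true, rowOp, glueLin_apply, LinearMap.add_apply,
        LinearMap.smul_apply, LinearMap.comp_apply, e1, Pi.add_apply, Pi.smul_apply, if_true]
    · simp only [wordVec, glue_true, ih, Bool.false_eq_true, if_false, copD_apply,
        slice_glue_false, slice_glue_true, rowOp, glueLin_apply, LinearMap.add_apply,
        LinearMap.smul_apply, LinearMap.comp_apply, e1, Pi.add_apply, Pi.smul_apply, if_true]

theorem contract_eq_contractRow (us : List W) (q : List Bool → M) :
    contract K (t false false) (t false true) us q
      = contractRow t us q (List.replicate us.length false) := by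
  induction us generalizing q with
  | nil => rfl
  | cons u us ih =>
    simp [contract, contractRow_cons, ih, List.replicate_succ]

theorem chain_eq_wordVec (t : Bool → W → Module.End K M) (us : List W) (p : M) :
    chain (t false) us p = wordVec t us p (List.replicate us.length false) := by
  induction us with
  | nil => rfl
  | cons u us ih => simp [wordVec, ih, List.replicate_succ]

/-- Induction on `vs`: `contractRow_monodromy` pulls the outermost entry out, and `wordVec_copB`
recognizes the rest as a new site. The row word `ks` must stay free, since `rowOp` changes it; only
afterwards is it set to the constant word `false`. -/
theorem contractRow_chain (ω : M) (us vs : List W) (h : ∀ u ∈ us, ∀ v ∈ vs, RowCol g η t u v)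
    (ks : List Bool) :
    contractRow t us (chain (monodromy (fun z w => g w z) (-η) (t true false) (t true true) us true)
        vs (vac ω us)) ks
      = contract K (t true true) (t false true) vs
          (wordVec (fun b => if b then monodromy g η (t true false) (t false false) vs false
            else monodromy g η (t true false) (t false false) vs true) us (vac ω vs) ks) := by
  induction vs generalizing ks with
  | nil =>
    simp only [chain_nil, contract, LinearMap.proj_apply]
    induction us generalizing ks with
    | nil => rfl
    | cons u us ih =>
      have ih := fun ks => ih (by simp) ks
      rcases ks with _ | ⟨_ | _, ks⟩
      · rfl
      · simp [contractRow_cons, vac, wordVec, ih]; rfl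
      · simp [contractRow_cons, vac, wordVec, ih]; rfl
  | cons v vs ih =>
    have ih := ih fun u hu w hw => h u hu w (by simp [hw])
    rw [chain_cons, contractRow_monodromy us v fun u hu => h u hu v (by simp)]
    have := funext ih
    rw [this, rowOp_comp, rowOp_comp]
    have key := wordVec_copB (g := g) (η := η)
      (monodromy g η (t true false) (t false false) vs false)
      (monodromy g η (t true false) (t false false) vs true) v us (vac ω vs) ks
    simp only [monodromy, vac, key, contract, LinearMap.add_apply, LinearMap.comp_apply,
      slice_glue_false, slice_glue_true]

/-- The nesting over the sites `us` agrees with the nesting over the sites `vs`. -/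
theorem nested_swap (ω : M) (us vs : List W) (h : ∀ u ∈ us, ∀ v ∈ vs, RowCol g η t u v) :
    nested (t false false) (t false true) (t true false) (t true true) (fun z w => g w z) (-η)
        ω us vs
      = nested (t true true) (t false true) (t true false) (t false false) g η ω vs us := by
  rw [nested, contract_eq_contractRow, contractRow_chain ω us vs h, nested]
  congr 1
  exact (chain_eq_wordVec (fun b => if b then monodromy g η (t true false) (t false false) vs false
    else monodromy g η (t true false) (t false false) vs true) us _).symm

end Duality


/-! ## Evaluation of the super-trace -/

theorem sgn_add (x y : ZMod 2) : sgn (x + y) = sgn x * sgn y := by revert x y; decide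

theorem sgn_mul_self (x : ZMod 2) : sgn x * sgn x = 1 := by revert x; decide

section Hat

variable {N : ℕ} {A S : Type*} [Ring A] [AddCommGroup S] [Module A S]
variable (par : Fin 3 → ZMod 2) (γ : A → A)

/-- The column `m` of `Y`, applied to `ω`, with the sign that makes the product of the graded
tensor product an action that does not depend on `m`. -/
def column (ω : S) (m : Fin N → Fin 3) (Y : Aux N A) : (Fin N → Fin 3) → S := fun k =>
  sgn (∑ p, ∑ q ∈ Finset.Ioi p, par (m p) * par (k q)) • (Y k m • ω)

/-- The twist in `column` absorbs every term of the sign that pairs the column index with another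
index. The column index survives only through its total parity, in the condition that decides about
`γ`. -/
theorem column_mul (ω : S) (m : Fin N → Fin 3) (X Y : Aux N A) (k : Fin N → Fin 3) :
    column par ω m (Aux.mul par γ X Y) k
      = ∑ l : Fin N → Fin 3, sgn (∑ p, ∑ q ∈ Finset.Ioi p, par (l p) * (par (k q) + par (l q))) •
        ((if ∑ p, (par (l p) + par (m p)) = 0 then X k l else γ (X k l)) •
          column par ω m Y l) := by
  simp only [column, Aux.mul, Finset.sum_smul, Finset.smul_sum]
  refine Finset.sum_congr rfl fun l _ => ?_
  generalize (if ∑ p, (par (l p) + par (m p)) = 0 then X k l else γ (X k l)) = x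
  rw [smul_assoc, smul_comm x (sgn _), smul_smul, smul_smul, smul_smul, ← sgn_add, ← sgn_add,
    ← Finset.sum_add_distrib, ← Finset.sum_add_distrib]
  congr 2
  refine Finset.sum_congr rfl fun p _ => ?_
  rw [← Finset.sum_add_distrib, ← Finset.sum_add_distrib]
  refine Finset.sum_congr rfl fun q _ => ?_
  generalize par (m p) = a; generalize par (k q) = b; generalize par (l p) = c
  generalize par (l q) = d
  revert a b c d; decide

theorem sum_update {R : Type*} [AddCommMonoid R] (k : Fin N → Fin 3) (p : Fin N)
    (F : (Fin N → Fin 3) → R) (hF : ∀ l, (¬ ∀ q, q ≠ p → k q = l q) → F l = 0) :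
    ∑ l, F l = ∑ j, F (Function.update k p j) := by
  symm
  refine Fintype.sum_of_injective (Function.update k p) (Function.update_injective k p) _ _ ?_
    fun _ => rfl
  intro l hl
  apply hF
  intro h
  refine hl ⟨l p, ?_⟩
  funext q
  by_cases hq : q = p
  · subst hq; simp
  · simp [hq, h q hq]

theorem sum_sum_Ioi_update (k : Fin N → Fin 3) (p : Fin N) (j : Fin 3) (F : Fin N → ZMod 2) :
    ∑ p', ∑ q ∈ Finset.Ioi p', F p' * (par (k q) + par (Function.update k p j q))
      = (par (k p) + par j) * ∑ p' ∈ Finset.Iio p, F p' := by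
  have h (p' q : Fin N) : F p' * (par (k q) + par (Function.update k p j q))
      = if q = p then F p' * (par (k p) + par j) else 0 := by
    by_cases hq : q = p
    · subst hq; simp
    · simp [hq, CharTwo.add_self_eq_zero]
  simp only [h, Finset.sum_ite_eq', Finset.mem_Ioi]
  rw [← Finset.sum_filter, Finset.mul_sum]
  refine Finset.sum_congr (by ext; simp) fun _ _ => mul_comm _ _

theorem mul_place (p : Fin N) (t : Fin 3 → Fin 3 → A) (h0 : γ 0 = 0) (Y : Aux N A)
    (k m : Fin N → Fin 3) :
    Aux.mul par γ (Aux.place p t) Y k m = ∑ j, sgn ((par (k p) + par j) *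
      ∑ r ∈ Finset.Iio p, (par (k r) + par (m r))) •
        ((if ∑ q, (par (Function.update k p j q) + par (m q)) = 0 then t (k p) j
          else γ (t (k p) j)) * Y (Function.update k p j) m) := by
  rw [Aux.mul, sum_update k p]
  · refine Finset.sum_congr rfl fun j _ => ?_
    rw [sum_sum_Ioi_update par k p j fun p' => par (Function.update k p j p') + par (m p')]
    have h1 : Aux.place p t k (Function.update k p j) = t (k p) j := by
      rw [Aux.place, if_pos (by intro q hq; simp [hq])]; simp
    rw [h1]
    congr 3
    refine Finset.sum_congr rfl fun r hr => ?_
    rw [Function.update_of_ne (Finset.mem_Iio.1 hr).ne]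
  · intro l hl
    rw [Aux.place, if_neg hl]
    simp [h0]

theorem column_place (ω : S) (m : Fin N → Fin 3) (p : Fin N) (t : Fin 3 → Fin 3 → A)
    (h0 : γ 0 = 0) (Y : Aux N A) (k : Fin N → Fin 3) :
    column par ω m (Aux.mul par γ (Aux.place p t) Y) k = ∑ j,
      sgn ((par (k p) + par j) * ∑ r ∈ Finset.Iio p, par (k r)) •
        ((if ∑ q, (par (Function.update k p j q) + par (m q)) = 0 then t (k p) j
          else γ (t (k p) j)) • column par ω m Y (Function.update k p j)) := by
  rw [column_mul, sum_update k p]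
  · refine Finset.sum_congr rfl fun j _ => ?_
    rw [sum_sum_Ioi_update par k p j fun p' => par (Function.update k p j p')]
    have h1 : Aux.place p t k (Function.update k p j) = t (k p) j := by
      rw [Aux.place, if_pos (by intro q hq; simp [hq])]; simp
    rw [h1]
    congr 3
    refine Finset.sum_congr rfl fun r hr => ?_
    rw [Function.update_of_ne (Finset.mem_Iio.1 hr).ne]
  · intro l hl
    rw [Aux.place, if_neg hl]
    simp [h0]

/-- The action on columns of a matrix in the `p`-th auxiliary space whose `ij` entry has parity
`[i] + [j]`; `μ` is the parity of the column index. -/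
def siteOp (μ : ZMod 2) (p : Fin N) (t : Fin 3 → Fin 3 → A) (ψ : (Fin N → Fin 3) → S) :
    (Fin N → Fin 3) → S := fun k => ∑ j,
  sgn ((par (k p) + par j) * (par j + ∑ r ∈ Finset.Ioi p, par (k r) + μ)) •
    (t (k p) j • ψ (Function.update k p j))

theorem sum_split (p : Fin N) (F : Fin N → ZMod 2) :
    ∑ q, F q = ∑ r ∈ Finset.Iio p, F r + F p + ∑ r ∈ Finset.Ioi p, F r := by
  rw [← Finset.sum_filter_add_sum_filter_not Finset.univ (fun q => q ≤ p)]
  congr 1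
  · rw [add_comm, ← Finset.sum_insert (by simp)]
    refine Finset.sum_congr ?_ fun _ _ => rfl
    ext q; simp [le_iff_lt_or_eq, or_comm]
  · exact Finset.sum_congr (by ext; simp) fun _ _ => rfl

/-- Homogeneity turns `γ` into a sign governed by the total parity of all sites. Its part from the
sites left of `p` cancels the sign of `column_place`, so only the sites right of `p` and the column
parity remain. -/
theorem column_place_even (ω : S) (m : Fin N → Fin 3) (p : Fin N) (t : Fin 3 → Fin 3 → A)
    (h0 : γ 0 = 0) (ht : ∀ i j, γ (t i j) = sgn (par i + par j) • t i j) (Y : Aux N A) :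
    column par ω m (Aux.mul par γ (Aux.place p t) Y)
      = siteOp par (∑ q, par (m q)) p t (column par ω m Y) := by
  funext k
  rw [column_place par γ ω m p t h0 Y k, siteOp]
  refine Finset.sum_congr rfl fun j _ => ?_
  have h1 : ∑ q, (par (Function.update k p j q) + par (m q))
      = ∑ r ∈ Finset.Iio p, par (k r) + par j + ∑ r ∈ Finset.Ioi p, par (k r)
        + ∑ q, par (m q) := by
    rw [Finset.sum_add_distrib, sum_split p]
    congr 2
    · congr 1
      · refine Finset.sum_congr rfl fun r hr => ?_
        rw [Function.update_of_ne (Finset.mem_Iio.1 hr).ne]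
      · simp
    · refine Finset.sum_congr rfl fun r hr => ?_
      rw [Function.update_of_ne (Finset.mem_Ioi.1 hr).ne']
  have h2 (d x : ZMod 2) (y : A) (hy : γ y = sgn x • y) :
      (if d = 0 then y else γ y) = sgn (x * d) • y := by
    rcases sgn_cases d with ⟨rfl, -⟩ | ⟨rfl, -⟩
    · simp [sgn]
    · simp [hy]
  rw [h2 _ _ _ (ht (k p) j), h1, smul_assoc, smul_smul, ← sgn_add]
  congr 2
  generalize ∑ r ∈ Finset.Iio p, par (k r) = a
  generalize ∑ r ∈ Finset.Ioi p, par (k r) = b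
  generalize ∑ q, par (m q) = d
  generalize par (k p) = x
  generalize par j = y
  revert a b d x y; decide

/-- The entries are the scalars 0 and 1, which `γ` fixes, so in contrast to `column_place_even` the
sign from the sites on the left stays. -/
theorem column_E (ω : S) (m : Fin N → Fin 3) (p : Fin N) (i j : Fin 3)
    (h0 : γ 0 = 0) (h1 : γ 1 = 1) (Y : Aux N A) (k : Fin N → Fin 3) :
    column par ω m (Aux.mul par γ (Aux.E p i j) Y) k = if k p = i then
      sgn ((par i + par j) * ∑ r ∈ Finset.Iio p, par (k r)) •
        column par ω m Y (Function.update k p j) else 0 := by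
  rw [Aux.E, column_place par γ ω m p _ h0 Y k]
  split_ifs with h
  · rw [Finset.sum_eq_single j]
    · simp [h, h1]
    · intro j' _ hj'
      simp [hj', h0]
    · simp
  · simp [h, h0]

/-- Exchange of the letters at two sites. -/
def exchange (p q : Fin N) (k : Fin N → Fin 3) : Fin N → Fin 3 :=
  Function.update (Function.update k q (k p)) p (k q)

/-- The factors stand against the order of the tensor product; interchanging two factors of parity
[i] + [j] gives the sign. -/
theorem mul_E_E {p q : Fin N} (hpq : p < q) (i j : Fin 3) (h0 : γ 0 = 0) (h1 : γ 1 = 1)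
    (k m : Fin N → Fin 3) :
    Aux.mul par γ (Aux.E q i j) (Aux.E p j i : Aux N A) k m
      = if k q = i ∧ k p = j ∧ m = exchange p q k then ((sgn (par i + par j) : ℤ) : A) else 0 := by
  rw [Aux.E, mul_place par γ q _ h0]
  by_cases hi : k q = i
  swap
  · simp [hi, h0]
  rw [Finset.sum_eq_single j]
  rotate_left
  · intro j' _ hj'
    simp [hj', h0]
  · simp
  subst hi
  have hE : (Aux.E p j (k q) : Aux N A) (Function.update k q j) m
      = if k p = j ∧ m = Function.update (Function.update k q j) p (k q) then 1 else 0 := by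
    have hp : Function.update k q j p = k p := Function.update_of_ne hpq.ne _ _
    rw [Aux.E, Aux.place, hp]
    by_cases hj : k p = j
    · by_cases hm : m = Function.update (Function.update k q j) p (k q)
      · rw [if_pos fun r hr => by simp [hm, hr], if_pos ⟨hj, by simp [hm]⟩, if_pos ⟨hj, hm⟩]
      · rw [if_neg (c := k p = j ∧ _) fun h => hm h.2]
        refine ite_eq_right_iff.2 fun h2 => if_neg fun h3 => hm ?_
        funext r
        by_cases hr : r = p
        · subst hr; simp [h3.2]
        · simp [hr, ← h2 r hr]
    · simp [hj]
  rw [hE]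
  by_cases hj : k p = j
  swap
  · simp [hj]
  subst hj
  change _ • (_ * (if k p = k p ∧ m = exchange p q k then 1 else 0)) = _
  by_cases hm : m = exchange p q k
  swap
  · rw [if_neg (c := k p = k p ∧ _) fun h => hm h.2, mul_zero, smul_zero,
      if_neg fun h => hm h.2.2]
  have hs : ∑ r ∈ Finset.Iio q, (par (k r) + par (m r)) = par (k q) + par (k p) := by
    rw [Finset.sum_eq_single p]
    · rw [hm, exchange, Function.update_self, add_comm]
    · intro r hr hrp
      rw [hm, exchange, Function.update_of_ne hrp,
        Function.update_of_ne (Finset.mem_Iio.1 hr).ne, CharTwo.add_self_eq_zero]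
    · intro h; exact absurd (Finset.mem_Iio.2 hpq) h
  rw [if_pos (c := k p = k p ∧ _) ⟨rfl, hm⟩, hs]
  have : (par (k q) + par (k p)) * (par (k q) + par (k p)) = par (k q) + par (k p) := by
    generalize par (k q) + par (k p) = x
    revert x; decide
  simp [this, h1, hm]

theorem perm_apply {p q : Fin N} (hpq : p < q) (h0 : γ 0 = 0) (h1 : γ 1 = 1)
    (k m : Fin N → Fin 3) : (Aux.perm par γ q p : Aux N A) k m
      = if m = exchange p q k then ((sgn (par (k q)) : ℤ) : A) else 0 := by
  simp only [Aux.perm, Finset.sum_apply, Pi.smul_apply, mul_E_E par γ hpq _ _ h0 h1]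
  rw [Finset.sum_eq_single (k q), Finset.sum_eq_single (k p)]
  · split_ifs with h2 h3 h3
    · rw [zsmul_eq_mul, ← Int.cast_mul, ← sgn_add]
      congr 2
      generalize par (k q) = x
      generalize par (k p) = y
      revert x y; decide
    · exact absurd h2.2.2 h3
    · exact absurd ⟨rfl, rfl, h3⟩ h2
    · simp
  · intro j _ hj
    rw [if_neg fun h => hj h.2.1.symm, smul_zero]
  · simp
  · intro i _ hi
    refine Finset.sum_eq_zero fun j _ => ?_
    rw [if_neg fun h => hi h.1.symm, smul_zero]
  · simp

variable {K : Type*} [Field K] [Algebra K A] [Module K S] [IsScalarTower K A S]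

/-- The action on columns of the `R`-matrix `R_{qp} = 𝕀 + c P_{qp}`, for `p < q`. -/
def rOp (p q : Fin N) (c : K) (ψ : (Fin N → Fin 3) → S) : (Fin N → Fin 3) → S := fun k =>
  ψ k + (c * (sgn (par (k p) * par (k q)
    + (par (k p) + par (k q)) * ∑ r ∈ Finset.Ioo p q, par (k r)) : ℤ)) • ψ (exchange p q k)

/-- An exchange changes the word at two sites, and `sum_sum_Ioi_update` treats each. The sums over
the sites left of `p` occur twice and cancel modulo 2; what is left starts at `p` and ends before
`q`. -/
theorem sum_exchange {p q : Fin N} (hpq : p < q) (k : Fin N → Fin 3) :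
    ∑ p', ∑ q' ∈ Finset.Ioi p', par (exchange p q k p') * (par (k q') + par (exchange p q k q'))
      = (par (k p) + par (k q)) * (par (k q) + ∑ r ∈ Finset.Ioo p q, par (k r)) := by
  set F : Fin N → ZMod 2 := fun p' => par (exchange p q k p') with hF
  have h (p' q' : Fin N) : F p' * (par (k q') + par (exchange p q k q'))
      = F p' * (par (k q') + par (Function.update k p (k q) q'))
        + F p' * (par (k q') + par (Function.update k q (k p) q')) := by
    rw [← mul_add]
    congr 1
    simp only [exchange]
    by_cases h1 : q' = p
    · subst h1; simp [hpq.ne, CharTwo.add_self_eq_zero]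
    · by_cases h2 : q' = q
      · subst h2; simp [h1, CharTwo.add_self_eq_zero]
      · simp [h1, h2, CharTwo.add_self_eq_zero]
  change ∑ p', ∑ q' ∈ Finset.Ioi p', F p' * _ = _
  simp only [h, Finset.sum_add_distrib, sum_sum_Ioi_update]
  rw [add_comm (par (k q)) (par (k p)), ← mul_add]
  congr 1
  have h3 : ∑ r ∈ Finset.Iio q, F r = ∑ r ∈ Finset.Iio p, F r
      + (par (k q) + ∑ r ∈ Finset.Ioo p q, par (k r)) := by
    have e : Finset.Iio q = Finset.Iio p ∪ (insert p (Finset.Ioo p q)) := by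
      ext r; simp only [Finset.mem_Iio, Finset.mem_union, Finset.mem_insert, Finset.mem_Ioo]
      omega
    rw [e, Finset.sum_union, Finset.sum_insert (by simp)]
    · congr 2
      · simp [hF, exchange]
      · refine Finset.sum_congr rfl fun r hr => ?_
        rw [Finset.mem_Ioo] at hr
        simp [hF, exchange, hr.1.ne', hr.2.ne]
    · rw [Finset.disjoint_left]
      intro r; simp only [Finset.mem_Iio, Finset.mem_insert, Finset.mem_Ioo]; omega
  rw [h3, ← add_assoc, CharTwo.add_self_eq_zero, zero_add]

theorem column_R (ω : S) (m : Fin N → Fin 3) {p q : Fin N} (hpq : p < q) (c : K)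
    (hγ : ∀ x : K, γ (algebraMap K A x) = algebraMap K A x) (Y : Aux N A) :
    column par ω m (Aux.mul par γ (Aux.R par γ q p (algebraMap K A c)) Y)
      = rOp par p q c (column par ω m Y) := by
  have h0 : γ 0 = 0 := by simpa using hγ 0
  have h1 : γ 1 = 1 := by simpa using hγ 1
  funext k
  have hX (l : Fin N → Fin 3) : Aux.R par γ q p (algebraMap K A c) k l
      = algebraMap K A ((if k = l then 1 else 0)
        + if l = exchange p q k then c * (sgn (par (k q)) : ℤ) else 0) := by
    simp only [Aux.R, Pi.add_apply, perm_apply par γ hpq h0 h1, Aux.one, map_add]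
    congr 1
    · split_ifs <;> simp
    · split_ifs <;> simp
  rw [column_mul, rOp]
  simp only [hX, hγ, ite_self, algebraMap_smul, add_smul, ite_smul, one_smul, zero_smul, smul_add,
    smul_ite, smul_zero, Finset.sum_add_distrib, Finset.sum_ite_eq, Finset.sum_ite_eq',
    Finset.mem_univ, if_true]
  congr 1
  · simp [CharTwo.add_self_eq_zero, sgn]
  · rw [sum_exchange par hpq, ← Int.cast_smul_eq_zsmul K, smul_smul]
    congr 1
    rw [mul_left_comm, ← Int.cast_mul, ← sgn_add]
    congr 3
    generalize ∑ r ∈ Finset.Ioo p q, par (k r) = a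
    generalize par (k p) = x
    generalize par (k q) = y
    revert a x y; decide

end Hat


/-! ### Words as multi-indices of the auxiliary spaces -/

section Words

variable {N : ℕ}

/-- A word as an index of the `N` auxiliary spaces. -/
def letters (N : ℕ) (w : List (Fin 3)) : Fin N → Fin 3 := fun i => w.getD i 0

theorem letters_apply {p : Fin N} {n₁ n₂ : List (Fin 3)} (hp : (p : ℕ) = n₁.length) (x : Fin 3) :
    letters N (n₁ ++ x :: n₂) p = x := by
  simp [letters, hp]

theorem getD_append_cons_of_ne (n₁ n₂ : List (Fin 3)) (x j : Fin 3) {i : ℕ}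
    (hi : i ≠ n₁.length) : (n₁ ++ x :: n₂).getD i 0 = (n₁ ++ j :: n₂).getD i 0 := by
  rcases lt_or_gt_of_ne hi with h | h
  · rw [List.getD_append _ _ _ _ h, List.getD_append _ _ _ _ h]
  · rw [List.getD_append_right _ _ _ _ h.le, List.getD_append_right _ _ _ _ h.le]
    obtain ⟨d, hd⟩ : ∃ d, i - n₁.length = d + 1 := ⟨i - n₁.length - 1, by omega⟩
    rw [hd]; rfl

theorem update_letters {p : Fin N} {n₁ n₂ : List (Fin 3)} (hp : (p : ℕ) = n₁.length)
    (x j : Fin 3) :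
    Function.update (letters N (n₁ ++ x :: n₂)) p j = letters N (n₁ ++ j :: n₂) := by
  funext i
  by_cases hi : i = p
  · subst hi; rw [Function.update_self, letters_apply hp]
  · rw [Function.update_of_ne hi]
    exact getD_append_cons_of_ne n₁ n₂ x j fun h => hi (Fin.ext (h.trans hp.symm))

theorem exchange_letters {p q : Fin N} {n₁ n₂ n₃ : List (Fin 3)} (hp : (p : ℕ) = n₁.length)
    (hq : (q : ℕ) = n₁.length + 1 + n₂.length) (x y : Fin 3) :
    exchange p q (letters N (n₁ ++ x :: (n₂ ++ y :: n₃)))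
      = letters N (n₁ ++ y :: (n₂ ++ x :: n₃)) := by
  have hq' (z : Fin 3) : (q : ℕ) = (n₁ ++ z :: n₂).length := by simp; omega
  have e (z y : Fin 3) : n₁ ++ z :: (n₂ ++ y :: n₃) = (n₁ ++ z :: n₂) ++ y :: n₃ := by simp
  rw [exchange, letters_apply hp, e, letters_apply (hq' x), update_letters (hq' x), ← e,
    update_letters hp]

theorem sum_letters (F : Fin 3 → ZMod 2) (n₁ n₂ n₃ : List (Fin 3)) (s : Finset (Fin N))
    (hs : ∀ r : Fin N, r ∈ s ↔ n₁.length ≤ r ∧ (r : ℕ) < n₁.length + n₂.length)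
    (hN : n₁.length + n₂.length ≤ N) :
    ∑ r ∈ s, F (letters N (n₁ ++ (n₂ ++ n₃)) r) = (n₂.map F).sum := by
  rw [← Fin.sum_univ_fun_getElem]
  symm
  refine Finset.sum_bij (fun i _ => (⟨n₁.length + i, by omega⟩ : Fin N)) ?_ ?_ ?_ ?_
  · intro i _; rw [hs]; simp
  · intro i _ j _ h; simpa [Fin.ext_iff] using h
  · intro r hr
    rw [hs] at hr
    exact ⟨⟨r - n₁.length, by omega⟩, Finset.mem_univ _, Fin.ext (by simp; omega)⟩
  · intro i _
    simp [letters, List.getElem?_append]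

theorem sum_Ioi_letters (F : Fin 3 → ZMod 2) {p : Fin N} {n₁ n₂ : List (Fin 3)}
    (hp : (p : ℕ) = n₁.length) (hN : n₁.length + 1 + n₂.length = N) (x : Fin 3) :
    ∑ r ∈ Finset.Ioi p, F (letters N (n₁ ++ x :: n₂) r) = (n₂.map F).sum := by
  have := sum_letters (N := N) F (n₁ ++ [x]) n₂ [] (Finset.Ioi p)
    (by intro r; simp [Fin.lt_def, hp]; omega) (by simp; omega)
  simpa using this

theorem sum_Ioo_letters (F : Fin 3 → ZMod 2) {p q : Fin N} {n₁ n₂ n₃ : List (Fin 3)}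
    (hp : (p : ℕ) = n₁.length) (hq : (q : ℕ) = n₁.length + 1 + n₂.length) (x : Fin 3) :
    ∑ r ∈ Finset.Ioo p q, F (letters N (n₁ ++ x :: (n₂ ++ n₃)) r) = (n₂.map F).sum := by
  have := sum_letters (N := N) F (n₁ ++ [x]) n₂ n₃ (Finset.Ioo p q)
    (by intro r; simp [Fin.lt_def, hp, hq]) (by simp; omega)
  simpa using this

end Words

/-! ### Operators at consecutive sites, acting on words -/

section Sites

variable {N : ℕ} {W A S K : Type*} [Ring A] [AddCommGroup S] [Module A S]
  [Field K] [Algebra K A] [Module K S] [IsScalarTower K A S]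
variable (par : Fin 3 → ZMod 2)

/-- The sites of a list are `t, t + 1, …`. -/
def Consecutive (t : ℕ) (ps : List (Fin N × W)) : Prop :=
  ps.map (fun p => (p.1 : ℕ)) = List.range' t ps.length

theorem consecutive_cons {t : ℕ} {p : Fin N × W} {ps : List (Fin N × W)} :
    Consecutive t (p :: ps) ↔ (p.1 : ℕ) = t ∧ Consecutive (t + 1) ps := by
  simp [Consecutive, List.range'_succ]

theorem Consecutive.le {t : ℕ} {ps : List (Fin N × W)} (h : Consecutive t ps) {p : Fin N × W}
    (hp : p ∈ ps) : t ≤ p.1 ∧ (p.1 : ℕ) < t + ps.length := by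
  have : (p.1 : ℕ) ∈ ps.map (fun p => (p.1 : ℕ)) := List.mem_map_of_mem hp
  rw [h, List.mem_range'_1] at this
  exact this

/-- The auxiliary index of a letter. -/
def idx (b : Bool) : Fin 3 := if b then 2 else 1

/-- A word in the letters `1, 2`. -/
def bits (N : ℕ) (w : List Bool) : Fin N → Fin 3 := letters N (w.map idx)

/-- Together with the next lemma this excludes the letter 0 from the inner summations, so that
indices in `Fin 3` may be replaced by Booleans. -/
theorem siteOp_support {s p : Fin N} (hsp : s ≠ p) (μ : ZMod 2) (t : Fin 3 → Fin 3 → A)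
    {ψ : (Fin N → Fin 3) → S} (hψ : ∀ k, k s = 0 → ψ k = 0) (k : Fin N → Fin 3) (hk : k s = 0) :
    siteOp par μ p t ψ k = 0 := by
  refine Finset.sum_eq_zero fun j _ => ?_
  rw [hψ _ (by rwa [Function.update_of_ne hsp]), smul_zero, smul_zero]

theorem foldr_siteOp_support {s : Fin N} (μ : ZMod 2) (T : W → Fin 3 → Fin 3 → A)
    (ps : List (Fin N × W)) (hs : ∀ p ∈ ps, s ≠ p.1)
    {ψ : (Fin N → Fin 3) → S} (hψ : ∀ k, k s = 0 → ψ k = 0) (k : Fin N → Fin 3) (hk : k s = 0) :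
    ps.foldr (fun p ψ => siteOp par μ p.1 (T p.2) ψ) ψ k = 0 := by
  induction ps generalizing k with
  | nil => exact hψ k hk
  | cons p ps ih =>
    exact siteOp_support par (hs p (by simp)) μ _ (fun k hk => ih (fun p hp => hs p (by simp [hp])) k hk) k hk

variable (S K) in
/-- The operators `±T_kj(w)`, with the sign `(-1)^([j]([k]+[j]))`. -/
def signedT (T : W → Fin 3 → Fin 3 → A) (k j : Fin 3) (w : W) : Module.End K S :=
  ((sgn ((par k + par j) * par j) : ℤ) : K) • Algebra.lsmul K K S (T w k j)

/-- The hypothesis `hr` makes the sites to the right and the column parity drop out of the sign; its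
`c` stands for the number of sites still to come, all with letter `r`. What survives is the sign
built into `signedT`. -/
theorem foldr_siteOp (T : W → Fin 3 → Fin 3 → A) (μ : ZMod 2) (r : Fin 3) (n₃ : List (Fin 3))
    (hr : ∀ (c : ZMod 2) (j : Fin 3), j ≠ 0 →
      (par r + par j) * (par r * c + ((n₃.map par).sum + μ)) = 0)
    (ψ : (Fin N → Fin 3) → S) (n₁ : List (Fin 3)) (ps : List (Fin N × W))
    (hps : Consecutive n₁.length ps) (hN : n₁.length + ps.length + n₃.length = N)
    (hψ : ∀ p ∈ ps, ∀ k, k p.1 = 0 → ψ k = 0) :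
    ps.foldr (fun p ψ => siteOp par μ p.1 (T p.2) ψ) ψ
        (letters N (n₁ ++ (List.replicate ps.length r ++ n₃)))
      = contract K (signedT S K par T r 1) (signedT S K par T r 2) (ps.map Prod.snd)
          (fun ns => ψ (letters N (n₁ ++ (ns.map idx ++ n₃)))) := by
  induction ps generalizing n₁ with
  | nil => rfl
  | cons p ps ih =>
    obtain ⟨hp, hps⟩ := consecutive_cons.1 hps
    have hψ' := fun p hp => hψ p (List.mem_cons_of_mem _ hp)
    rw [List.foldr_cons, List.length_cons, List.replicate_succ, List.cons_append]
    simp only [List.length_cons] at hN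
    have h0 (j : Fin 3) (n : List (Fin 3)) := update_letters (N := N) (n₂ := n) hp r j
    have hz : ps.foldr (fun p ψ => siteOp par μ p.1 (T p.2) ψ) ψ
        (letters N (n₁ ++ 0 :: (List.replicate ps.length r ++ n₃))) = 0 := by
      refine foldr_siteOp_support (s := p.1) par μ T ps (fun p' hp' e => ?_) (hψ p (by simp)) _
        (letters_apply hp 0)
      have := (hps.le hp').1
      rw [← e, hp] at this
      omega
    have hI (j : Fin 3) := ih (n₁ ++ [j]) (by simpa using hps) (by simp; omega) hψ'
    simp only [List.append_assoc, List.cons_append, List.nil_append] at hI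
    have hsum : (((List.replicate ps.length r ++ n₃).map par)).sum
        = par r * ps.length + (n₃.map par).sum := by
      simp [mul_comm]
    have hs (j : Fin 3) (hj : j ≠ 0) : (par r + par j) *
        (par j + ((List.replicate ps.length r ++ n₃).map par).sum + μ)
          = (par r + par j) * par j := by
      rw [hsum]
      linear_combination hr ps.length j hj
    rw [siteOp, Fin.sum_univ_three]
    simp only [h0, letters_apply hp,
      sum_Ioi_letters par hp (show n₁.length + 1 + (List.replicate ps.length r ++ n₃).length = N by
        simp; omega)]
    rw [hz, smul_zero, smul_zero, zero_add, hs 1 (by decide), hs 2 (by decide), hI, hI]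
    simp only [List.map_cons, contract, LinearMap.add_apply, LinearMap.comp_apply, signedT,
      LinearMap.smul_apply, Algebra.lsmul_coe, Int.cast_smul_eq_zsmul]
    rfl

theorem rOp_letters {p q : Fin N} {n₁ n₂ n₃ : List (Fin 3)} (hp : (p : ℕ) = n₁.length)
    (hq : (q : ℕ) = n₁.length + 1 + n₂.length) (c : K) (ψ : (Fin N → Fin 3) → S) (x y : Fin 3) :
    rOp par p q c ψ (letters N (n₁ ++ x :: (n₂ ++ y :: n₃)))
      = ψ (letters N (n₁ ++ x :: (n₂ ++ y :: n₃)))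
        + (c * (sgn (par x * par y + (par x + par y) * (n₂.map par).sum) : ℤ)) •
          ψ (letters N (n₁ ++ y :: (n₂ ++ x :: n₃))) := by
  have hq' : (q : ℕ) = (n₁ ++ x :: n₂).length := by simp; omega
  have e : n₁ ++ x :: (n₂ ++ y :: n₃) = (n₁ ++ x :: n₂) ++ y :: n₃ := by simp
  have h2 : letters N (n₁ ++ x :: (n₂ ++ y :: n₃)) q = y := by rw [e, letters_apply hq']
  rw [rOp, exchange_letters hp hq, letters_apply hp, h2, sum_Ioo_letters par hp hq]

/-- The sign of a word in which every letter `true` counts `η`. -/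
def wordSign (η : K) (w : List Bool) : K := (w.map fun b => if b then η else 1).prod

@[simp] theorem wordSign_nil (η : K) : wordSign η [] = 1 := rfl
@[simp] theorem wordSign_cons (η : K) (b : Bool) (w : List Bool) :
    wordSign η (b :: w) = (if b then η else 1) * wordSign η w := by simp [wordSign]
theorem wordSign_append (η : K) (w w' : List Bool) :
    wordSign η (w ++ w') = wordSign η w * wordSign η w' := by simp [wordSign]
theorem wordSign_mul_self {η : K} (hη : η * η = 1) (w : List Bool) :
    wordSign η w * wordSign η w = 1 := by
  induction w with
  | nil => simp
  | cons b w ih => cases b <;> simp [ih, mul_mul_mul_comm, hη]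

/-- The cost of carrying a pair of different letters across the word `w`. If index 2 is odd the pair
is even and crosses freely; if index 2 is even every letter `true` gives -1. -/
theorem sgn_mul_sum (hp2 : par 2 = 1) (w : List Bool) :
    ((sgn ((par 1 + 1) * ((w.map idx).map par).sum) : ℤ) : K)
      = wordSign (-(sgn (par 1) : K)) w := by
  induction w with
  | nil => simp [sgn]
  | cons b w ih =>
    rw [List.map_cons, List.map_cons, List.sum_cons, mul_add, sgn_add, Int.cast_mul, ih,
      wordSign_cons]
    congr 1
    rcases sgn_cases (par 1) with ⟨h, h'⟩ | ⟨h, h'⟩ <;> cases b <;>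
      simp [idx, h, hp2, sgn, CharTwo.add_self_eq_zero]

theorem rOp_bits (hp2 : par 2 = 1) {p q : Fin N} {n₁ n₂ n₃ : List Bool} (hp : (p : ℕ) = n₁.length)
    (hq : (q : ℕ) = n₁.length + 1 + n₂.length) (c : K) (ψ : (Fin N → Fin 3) → S) (x y : Bool) :
    rOp par p q c ψ (bits N (n₁ ++ x :: (n₂ ++ y :: n₃)))
      = ψ (bits N (n₁ ++ x :: (n₂ ++ y :: n₃)))
        + (sgn (par 1) * c * if x = y then (if x then -(sgn (par 1) : K) else 1)
            else wordSign (-(sgn (par 1) : K)) n₂) •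
          ψ (bits N (n₁ ++ y :: (n₂ ++ x :: n₃))) := by
  simp only [bits, List.map_append, List.map_cons]
  rw [rOp_letters par (by simpa using hp) (by simpa using hq)]
  congr 2
  rw [mul_comm _ c, mul_assoc]
  congr 1
  rw [sgn_add, Int.cast_mul]
  have h1 : sgn (par 1) * sgn (par 1) = 1 := sgn_mul_self _
  have h1' : (sgn (par 1) : K) * sgn (par 1) = 1 := by rw [← Int.cast_mul, h1, Int.cast_one]
  have hθ : par 1 * par 1 = par 1 := by generalize par 1 = x; revert x; decide
  rcases x with _ | _ <;> rcases y with _ | _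
  · simp [idx, hθ, CharTwo.add_self_eq_zero]; simp [sgn]
  · simp only [idx, Bool.false_eq_true, if_false, if_true, hp2, mul_one,
      sgn_mul_sum par hp2]
  · simp only [idx, Bool.false_eq_true, if_false, if_true, reduceCtorEq, hp2, one_mul,
      sgn_mul_sum par hp2, add_comm 1 (par 1)]
  · simp [idx, hp2, CharTwo.add_self_eq_zero, h1']; simp [sgn]

end Sites


/-! ### Blocks of R-matrices as monodromy matrices -/

section Blocks

variable {N : ℕ} {W S K : Type*} [AddCommGroup S] [Field K] [Module K S]

theorem monodromy_congr (g : W → W → K) (η : K) (D B : W → Module.End K S) (us : List W)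
    (b : Bool) (v : W) {q q' : List Bool → S} {ns : List Bool}
    (h : ∀ ns' : List Bool, ns'.length = ns.length → q ns' = q' ns') :
    monodromy g η D B us b v q ns = monodromy g η D B us b v q' ns := by
  induction us generalizing b q q' ns with
  | nil => cases b <;> simp [monodromy, h ns rfl]
  | cons u us ih =>
    rcases ns with _ | ⟨x, ns⟩
    · cases b <;> rfl
    have hs (y b : Bool) : monodromy g η D B us b v (slice K y q) ns
        = monodromy g η D B us b v (slice K y q') ns :=
      ih b fun ns' hn => h (y :: ns') (by simp [hn])
    cases b <;> cases x <;> simp [monodromy, copD_apply, copB_apply, hs]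

theorem wordSign_mul (η η' : K) (w : List Bool) :
    wordSign η w * wordSign η' w = wordSign (η * η') w := by
  induction w with
  | nil => simp
  | cons b w ih => cases b <;> simp [← ih, mul_mul_mul_comm]

variable (par : Fin 3 → ZMod 2)

/-- One block of R-matrices, with the letter at `q` contracted with `D` and `B`, acts on the sites
`ps` as a row of the monodromy matrix. An exchange crosses the letters lying between its two sites,
and the conjugation by `wordSign` absorbs these signs; the additional `η` for the entry `true`
accounts for the letter at `q` itself. The prefix `n₁` collects the sites already treated. -/
theorem foldl_rOp (hp2 : par 2 = 1) {η : K} (hη : η = -(sgn (par 1) : K)) (g : W → W → K)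
    (D B : W → Module.End K S) (c : (List Bool → S) →ₗ[K] S) (v : W) (q : Fin N)
    (ms₁ : List Bool) (n₁ : List Bool) (ps : List (Fin N × W)) (ψ : (Fin N → Fin 3) → S)
    (ns : List Bool) (hps : Consecutive n₁.length ps)
    (hq : (q : ℕ) = n₁.length + ps.length + ms₁.length) (hns : ns.length = ps.length) :
    wordSign (wordSign η ms₁) ns •
      (D v (c fun ms => ps.foldl (fun ψ p => rOp par p.1 q (g v p.2) ψ) ψ
          (bits N (n₁ ++ (ns ++ (ms₁ ++ false :: ms)))))
        + B v (c fun ms => ps.foldl (fun ψ p => rOp par p.1 q (g v p.2) ψ) ψ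
          (bits N (n₁ ++ (ns ++ (ms₁ ++ true :: ms))))))
      = monodromy (fun z w => (sgn (par 1) : K) * g z w) η D B (ps.map Prod.snd) false v
          (fun ns => wordSign (wordSign η ms₁) ns •
            c fun ms => ψ (bits N (n₁ ++ (ns ++ (ms₁ ++ false :: ms))))) ns
        + monodromy (fun z w => (sgn (par 1) : K) * g z w) η D B (ps.map Prod.snd) true v
          (fun ns => wordSign (wordSign η ms₁ * η) ns •
            c fun ms => ψ (bits N (n₁ ++ (ns ++ (ms₁ ++ true :: ms))))) ns := by
  have hηη : η * η = 1 := by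
    rw [hη, neg_mul_neg, ← Int.cast_mul, sgn_mul_self, Int.cast_one]
  have hκ := wordSign_mul_self hηη ms₁
  have hτ := wordSign_mul_self hηη
  induction ps generalizing n₁ ψ ns with
  | nil =>
    obtain rfl : ns = [] := by simpa using hns
    simp [monodromy]
  | cons p ps ih =>
    obtain ⟨x, ns, rfl⟩ : ∃ x ns', ns = x :: ns' := by
      cases ns with
      | nil => simp at hns
      | cons x ns => exact ⟨x, ns, rfl⟩
    obtain ⟨hp, hps⟩ := consecutive_cons.1 hps
    simp only [List.length_cons] at hq
    have hns : ns.length = ps.length := by simpa using hns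
    have hI := ih (n₁ ++ [x]) (rOp par p.1 q (g v p.2) ψ) ns (by simpa using hps)
      (by simp; omega) hns
    set F : Bool → List Bool → S := fun j ns =>
      c fun ms => ψ (bits N (n₁ ++ (ns ++ (ms₁ ++ j :: ms)))) with hF
    -- In a left fold the R-matrix at `p` acts on `ψ` before the others. The induction hypothesis
    -- therefore applies to its result, with the letter at `p` frozen to `x`.
    have hR (j : Bool) (ns' : List Bool) (hn : ns'.length = ns.length) :
        (c fun ms => rOp par p.1 q (g v p.2) ψ
          (bits N (n₁ ++ [x] ++ (ns' ++ (ms₁ ++ j :: ms)))))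
        = F j (x :: ns') + (sgn (par 1) * g v p.2 * if x = j then (if x then η else 1)
            else wordSign η ns' * wordSign η ms₁) • F x (j :: ns') := by
      have hw (ms : List Bool) : n₁ ++ [x] ++ (ns' ++ (ms₁ ++ j :: ms))
          = n₁ ++ x :: ((ns' ++ ms₁) ++ j :: ms) := by simp
      have hw' (ms : List Bool) : n₁ ++ (j :: ns' ++ (ms₁ ++ x :: ms))
          = n₁ ++ j :: ((ns' ++ ms₁) ++ x :: ms) := by simp
      have hw'' (ms : List Bool) : n₁ ++ (x :: ns' ++ (ms₁ ++ j :: ms))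
          = n₁ ++ x :: ((ns' ++ ms₁) ++ j :: ms) := by simp
      simp only [hF, hw, hw', hw'', rOp_bits par hp2 hp
        (show (q : ℕ) = n₁.length + 1 + (ns' ++ ms₁).length by simp; omega), ← hη,
        wordSign_append]
      rw [← map_smul, ← map_add]
      rfl
    have hassoc (j : Bool) (ms : List Bool) : n₁ ++ (x :: ns ++ (ms₁ ++ j :: ms))
        = n₁ ++ [x] ++ (ns ++ (ms₁ ++ j :: ms)) := by simp
    simp only [List.foldl_cons, hassoc]
    rw [wordSign_cons, mul_smul, hI]
    clear hI ih
    have h1 := monodromy_congr (fun z w => (sgn (par 1) : K) * g z w) η D B (ps.map Prod.snd)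
      false v (fun ns' hn => congrArg (wordSign (wordSign η ms₁) ns' • ·) (hR false ns' hn))
    have h2 := monodromy_congr (fun z w => (sgn (par 1) : K) * g z w) η D B (ps.map Prod.snd)
      true v (fun ns' hn => congrArg (wordSign (wordSign η ms₁ * η) ns' • ·) (hR true ns' hn))
    beta_reduce at h1 h2
    rw [h1, h2]
    clear h1 h2 hR
    set Gf : List Bool → S := fun ns => wordSign (wordSign η ms₁) ns • F false ns with hGf
    set Gt : List Bool → S := fun ns => wordSign (wordSign η ms₁ * η) ns • F true ns with hGt
    set κ := wordSign η ms₁ with hκ'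
    set e : K := ((sgn (par 1) : ℤ) : K) with he
    set mf := monodromy (fun z w => e * g z w) η D B (ps.map Prod.snd) false v with hmf
    set mt := monodromy (fun z w => e * g z w) η D B (ps.map Prod.snd) true v with hmt
    rw [List.map_cons]
    simp only [monodromy, copD_apply, copB_apply, ← hmf, ← hmt]
    rcases x with _ | _
    · have e1 : (fun ns' => wordSign κ ns' • (F false (false :: ns') + (e * g v p.2 *
          if false = false then (if false = true then η else 1) else wordSign η ns' * κ) •
            F false (false :: ns'))) = (1 + e * g v p.2) • slice K false Gf := by
        funext ns'
        simp only [hGf, Pi.smul_apply, slice_apply, wordSign_cons]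
        simp
        module
      have e2 : (fun ns' => wordSign (κ * η) ns' • (F true (false :: ns') + (e * g v p.2 *
          if false = true then (if false = true then η else 1) else wordSign η ns' * κ) •
            F false (true :: ns')))
          = slice K false Gt + (e * g v p.2) • slice K true Gf := by
        funext ns'
        simp only [hGf, hGt, Pi.add_apply, Pi.smul_apply, slice_apply, wordSign_cons]
        simp only [← wordSign_mul, Bool.false_eq_true, if_false, if_true]
        match_scalars
        · ring
        · linear_combination (e * g v p.2 * κ * wordSign κ ns') * hτ ns'
      rw [e1, e2]
      simp
      module
    · have e1 : (fun ns' => wordSign κ ns' • (F false (true :: ns') + (e * g v p.2 *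
          if true = false then (if true = true then η else 1) else wordSign η ns' * κ) •
            F true (false :: ns')))
          = κ • slice K true Gf + (κ * (e * g v p.2)) • slice K false Gt := by
        funext ns'
        simp only [hGf, hGt, Pi.add_apply, Pi.smul_apply, slice_apply, wordSign_cons]
        simp only [← wordSign_mul, Bool.true_eq_false, Bool.false_eq_true, if_false, if_true]
        match_scalars
        · linear_combination (-wordSign κ ns') * hκ
        · ring
      have e2 : (fun ns' => wordSign (κ * η) ns' • (F true (true :: ns') + (e * g v p.2 *
          if true = true then (if true = true then η else 1) else wordSign η ns' * κ) •
            F true (true :: ns')))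
          = (κ * (η + e * g v p.2)) • slice K true Gt := by
        funext ns'
        simp only [hGt, Pi.smul_apply, slice_apply, wordSign_cons, if_true]
        match_scalars
        linear_combination (wordSign (κ * η) ns') * (-(1 + e * g v p.2 * η) * hκ - κ ^ 2 * hηη)
      rw [e1, e2]
      simp only [map_add, map_smul, glue_true, Pi.add_apply, Pi.smul_apply, if_true]
      match_scalars
      · linear_combination hκ
      · linear_combination (e * g v p.2) * hκ
      · linear_combination (η + e * g v p.2) * hκ

theorem rOp_support {s p q : Fin N} (hp : s ≠ p) (hq : s ≠ q) (i : Fin 3) (c : K)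
    {ψ : (Fin N → Fin 3) → S} (hψ : ∀ k, k s ≠ i → ψ k = 0) (k : Fin N → Fin 3) (hk : k s ≠ i) :
    rOp par p q c ψ k = 0 := by
  rw [rOp, hψ k hk, hψ (exchange p q k) (by simpa [exchange, hp, hq] using hk), smul_zero,
    add_zero]

/-- The action of the product of the blocks of `R`-matrices. -/
def rBlocks (g : W → W → K) (ps qs : List (Fin N × W)) (ψ : (Fin N → Fin 3) → S) :
    (Fin N → Fin 3) → S :=
  qs.foldr (fun q ψ => ps.foldl (fun ψ p => rOp par p.1 q.1 (g q.2 p.2) ψ) ψ) ψ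

theorem rBlocks_support (g : W → W → K) (ps qs : List (Fin N × W)) (s : Fin N) (i : Fin 3)
    (hps : ∀ p ∈ ps, s ≠ p.1) (hqs : ∀ q ∈ qs, s ≠ q.1)
    {ψ : (Fin N → Fin 3) → S} (hψ : ∀ k, k s ≠ i → ψ k = 0) (k : Fin N → Fin 3) (hk : k s ≠ i) :
    rBlocks par g ps qs ψ k = 0 := by
  induction qs generalizing k with
  | nil => exact hψ k hk
  | cons q qs ih =>
    have ih := ih fun q hq => hqs q (by simp [hq])
    have key : ∀ (ps : List (Fin N × W)) (ψ' : (Fin N → Fin 3) → S), (∀ p ∈ ps, s ≠ p.1) →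
        (∀ k, k s ≠ i → ψ' k = 0) → ∀ k, k s ≠ i →
          ps.foldl (fun ψ p => rOp par p.1 q.1 (g q.2 p.2) ψ) ψ' k = 0 := by
      intro ps
      induction ps with
      | nil => intro ψ' _ h; exact h
      | cons p ps ihp =>
        intro ψ' hs h
        exact ihp _ (fun p hp => hs p (by simp [hp]))
          (rOp_support par (hs p (by simp)) (hqs q (by simp)) i _ h)
    exact key ps _ hps ih k hk

/-- R-matrices only permute the letters of a word, so a letter absent from the support of `ψ` is
never created. -/
theorem rBlocks_vanish (g : W → W → K) (ps qs : List (Fin N × W)) (i : Fin 3)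
    {ψ : (Fin N → Fin 3) → S} (hψ : ∀ k s, k s = i → ψ k = 0) (k : Fin N → Fin 3) (s : Fin N)
    (hk : k s = i) : rBlocks par g ps qs ψ k = 0 := by
  induction qs generalizing k s with
  | nil => exact hψ k s hk
  | cons q qs ih =>
    have key : ∀ (ps : List (Fin N × W)) (ψ' : (Fin N → Fin 3) → S),
        (∀ k s, k s = i → ψ' k = 0) → ∀ k s, k s = i →
          ps.foldl (fun ψ p => rOp par p.1 q.1 (g q.2 p.2) ψ) ψ' k = 0 := by
      intro ps
      induction ps with
      | nil => intro ψ' h; exact h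
      | cons p ps ihp =>
        intro ψ' h
        refine ihp _ fun k s hk => ?_
        have : ∃ s', exchange p.1 q.1 k s' = i := by
          by_cases h1 : s = p.1
          · by_cases h2 : q.1 = p.1
            · exact ⟨p.1, by rw [exchange, Function.update_self, h2, ← h1, hk]⟩
            · subst h1
              exact ⟨q.1, by simp [exchange, h2, hk]⟩
          · by_cases h2 : s = q.1
            · exact ⟨p.1, by simp [exchange, ← h2, hk]⟩
            · exact ⟨s, by simp [exchange, h1, h2, hk]⟩
        obtain ⟨s', hs'⟩ := this
        change rOp par p.1 q.1 (g q.2 p.2) ψ' k = 0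
        rw [rOp, h k s hk, h _ s' hs', smul_zero, add_zero]
    exact key ps _ ih k s hk

/-- The blocks of later sites do not touch the site of `q`, where `ψ` demands the letter 2; hence
only the off-diagonal entry in `foldl_rOp` contributes. The `t` sites already treated all carry the
letter `true`, which explains the twist by `η ^ t`. -/
theorem contract_rBlocks (hp2 : par 2 = 1) {η : K} (hη : η = -(sgn (par 1) : K)) (g : W → W → K)
    (D B : W → Module.End K S) (ω : S) (ps qs : List (Fin N × W)) (t : ℕ)
    (hps : Consecutive 0 ps) (hqs : Consecutive (ps.length + t) qs) (ψ : (Fin N → Fin 3) → S)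
    (hψ : ∀ q ∈ qs, ∀ k, k q.1 ≠ 2 → ψ k = 0)
    (hψω : ∀ ns : List Bool, ns.length = ps.length →
      ψ (bits N (ns ++ List.replicate (t + qs.length) true)) = vac ω (ps.map Prod.snd) ns)
    (ns : List Bool) (hns : ns.length = ps.length) :
    wordSign (η ^ t) ns • contract K D B (qs.map Prod.snd) (fun ms =>
        rBlocks par g ps qs ψ (bits N (ns ++ (List.replicate t true ++ ms))))
      = chain (monodromy (fun z w => (sgn (par 1) : K) * g z w) η D B (ps.map Prod.snd) true)
          (qs.map Prod.snd) (vac ω (ps.map Prod.snd)) ns := by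
  -- Among words of the right length the vacuum is supported on the one without `true`, whose sign
  -- is 1. Other lengths must be excluded, because `vac` does not vanish there.
  have hvac : ∀ (us : List W) (a : K) (ns : List Bool), wordSign a ns • vac ω us ns = vac ω us ns ∨
      ns.length ≠ us.length := by
    intro us a
    induction us with
    | nil => intro ns; cases ns <;> simp [vac]
    | cons u us ih =>
      intro ns
      rcases ns with _ | ⟨_ | _, ns⟩
      · simp
      · simpa [vac] using ih ns
      · simp [vac]
  induction qs generalizing t ns with
  | nil =>
    have := hψω ns hns
    simp only [List.map_nil, contract, LinearMap.proj_apply, chain_nil, rBlocks, List.foldr_nil,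
      List.append_nil]
    simp only [List.length_nil, add_zero] at this
    rw [this]
    exact (hvac _ _ ns).resolve_right (by simpa using hns)
  | cons q qs ih =>
    obtain ⟨hq, hqs⟩ := consecutive_cons.1 hqs
    have ih := fun ns hns => ih (t + 1) hqs (fun q hq => hψ q (by simp [hq]))
      (by intro ns hns; rw [← hψω ns hns, List.length_cons]; congr 4; omega) ns hns
    have hκ : wordSign η (List.replicate t true) = η ^ t := by simp [wordSign]
    have key := foldl_rOp par hp2 hη g D B (contract K D B (qs.map Prod.snd)) q.2 q.1
      (List.replicate t true) [] ps (rBlocks par g ps qs ψ) ns (by simpa using hps)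
      (by simp [hq]) hns
    rw [hκ] at key
    rw [List.map_cons, chain_cons, contract]
    refine Eq.trans key ?_
    have h0 (ns : List Bool) (hn : ns.length = ps.length) (ms : List Bool) :
        rBlocks par g ps qs ψ
          (bits N ([] ++ (ns ++ (List.replicate t true ++ false :: ms)))) = 0 := by
      refine rBlocks_support par g ps qs q.1 2 ?_ ?_ (hψ q (by simp)) _ ?_
      · intro p hp e
        have := (hps.le hp).2
        rw [← e, hq] at this
        omega
      · intro q' hq' e
        have := (hqs.le hq').1
        rw [← e, hq] at this
        omega
      · rw [bits, List.nil_append, ← List.append_assoc, List.map_append, List.map_cons,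
          letters_apply (by simp [hq, hn])]
        decide
    have e1 := monodromy_congr (fun z w => (sgn (par 1) : K) * g z w) η D B (ps.map Prod.snd)
      false q.2 (q := fun ns => wordSign (η ^ t) ns • contract K D B (qs.map Prod.snd) fun ms =>
        rBlocks par g ps qs ψ (bits N ([] ++ (ns ++ (List.replicate t true ++ false :: ms)))))
      (q' := 0) (ns := ns) (by
        intro ns' hn
        have : (fun ms => rBlocks par g ps qs ψ
          (bits N ([] ++ (ns' ++ (List.replicate t true ++ false :: ms))))) = 0 := by
          funext ms; exact h0 ns' (hn.trans hns) ms
        rw [this, map_zero, smul_zero]; rfl)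
    rw [e1, map_zero, Pi.zero_apply, zero_add]
    refine monodromy_congr _ _ _ _ _ _ _ fun ns' hn => ?_
    rw [← ih ns' (hn.trans hns), pow_succ]
    simp only [List.replicate_succ', List.append_assoc, List.nil_append, List.cons_append]

end Blocks


/-! ### The super-trace as a nested vector -/

section Trace

variable {N : ℕ} {W A S K : Type*} [Ring A] [AddCommGroup S] [Module A S]
  [Field K] [Algebra K A] [Module K S] [IsScalarTower K A S]
variable (par : Fin 3 → ZMod 2) (γ : A → A)

theorem consecutive_append {t : ℕ} {ps qs : List (Fin N × W)} (h : Consecutive t ps)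
    (h' : Consecutive (t + ps.length) qs) : Consecutive t (ps ++ qs) := by
  simp only [Consecutive, List.map_append, List.length_append] at *
  rw [h, h', ← List.range'_append_1]

theorem column_foldr_place (ω : S) (m : Fin N → Fin 3) (T : W → Fin 3 → Fin 3 → A)
    (h0 : γ 0 = 0) (hT : ∀ w i j, γ (T w i j) = sgn (par i + par j) • T w i j)
    (ps : List (Fin N × W)) (Y : Aux N A) :
    column par ω m ((ps.map fun p => Aux.place p.1 (T p.2)).foldr (Aux.mul par γ) Y)
      = ps.foldr (fun p ψ => siteOp par (∑ q, par (m q)) p.1 (T p.2) ψ) (column par ω m Y) := by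
  induction ps with
  | nil => rfl
  | cons p ps ih =>
    rw [List.map_cons, List.foldr_cons, column_place_even par γ ω m p.1 _ h0 (hT p.2), ih]
    rfl

theorem column_foldr_R (ω : S) (m : Fin N → Fin 3) (g : W → W → K)
    (hγ : ∀ x : K, γ (algebraMap K A x) = algebraMap K A x) (ps qs : List (Fin N × W))
    (h : ∀ p ∈ ps, ∀ q ∈ qs, p.1 < q.1) (Y : Aux N A) :
    column par ω m ((qs.flatMap fun q => ps.reverse.map fun p =>
        Aux.R par γ q.1 p.1 (algebraMap K A (g q.2 p.2))).foldr (Aux.mul par γ) Y)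
      = rBlocks par g ps qs (column par ω m Y) := by
  induction qs with
  | nil => rfl
  | cons q qs ih =>
    replace ih := ih fun p hp q hq => h p hp q (by simp [hq])
    rw [List.flatMap_cons, List.foldr_append, rBlocks, List.foldr_cons]
    change _ = ps.foldl (fun ψ p => rOp par p.1 q.1 (g q.2 p.2) ψ)
      (rBlocks par g ps qs (column par ω m Y))
    rw [← ih]
    generalize List.foldr _ Y _ = Z
    replace h := fun p hp => h p hp q (by simp)
    clear ih
    rw [List.map_reverse, List.foldr_reverse, List.foldl_map]
    induction ps generalizing Z with
    | nil => rfl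
    | cons p ps ih =>
      rw [List.foldl_cons, List.foldl_cons, ih _ fun p hp => h p (by simp [hp]),
        column_R par γ ω m (h p (by simp)) _ hγ]

/-- The product of elementary matrices has the single entry `(l₀, m₀)`, and `hs` removes the sign of
every factor. In the induction the sites before `t` have already been changed from `l₀` to `m₀`, as
`hk` records. -/
theorem column_prod_E (ω : S) (l₀ m₀ m : Fin N → Fin 3) (h0 : γ 0 = 0) (h1 : γ 1 = 1)
    (hs : ∀ z, (par (l₀ z) + par (m₀ z)) * ∑ r ∈ Finset.Iio z, par (m₀ r) = 0) (t : ℕ)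
    (zs : List (Fin N × W)) (hzs : Consecutive t zs) (hN : t + zs.length = N)
    (k : Fin N → Fin 3) (hk : ∀ r : Fin N, (r : ℕ) < t → k r = m₀ r) :
    column par ω m (Aux.prod par γ (zs.map fun z => Aux.E z.1 (l₀ z.1) (m₀ z.1))) k
      = if (∀ r : Fin N, t ≤ r → k r = l₀ r) ∧ m = m₀ then
          sgn (∑ p, ∑ q ∈ Finset.Ioi p, par (m₀ p) * par (m₀ q)) • ω else 0 := by
  induction zs generalizing t k with
  | nil =>
    have hk : k = m₀ := funext fun r => hk r (by have := r.2; simp at hN; omega)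
    subst hk
    have hv : ∀ r : Fin N, t ≤ r → k r = l₀ r := fun r hr => by
      have := r.2; simp at hN; omega
    simp only [List.map_nil, Aux.prod, List.foldr_nil, column, Aux.one]
    by_cases hm : m = k
    · subst hm
      simpa using fun r hr h => absurd (hv r hr) h
    · have hm' : k ≠ m := Ne.symm hm
      simp [hm, hm']
  | cons z zs ih =>
    obtain ⟨hz, hzs⟩ := consecutive_cons.1 hzs
    rw [List.length_cons] at hN
    rw [List.map_cons, Aux.prod, List.foldr_cons, column_E par γ ω m z.1 _ _ h0 h1]
    have hsum : ∑ r ∈ Finset.Iio z.1, par (k r) = ∑ r ∈ Finset.Iio z.1, par (m₀ r) :=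
      Finset.sum_congr rfl fun r hr => by
        rw [hk r (by rw [Finset.mem_Iio, Fin.lt_def, hz] at hr; exact hr)]
    rw [hsum, hs z.1]
    have := ih (t + 1) hzs (by omega) (Function.update k z.1 (m₀ z.1)) (by
      intro r hr
      by_cases h : r = z.1
      · subst h; simp
      · rw [Function.update_of_ne h]
        exact hk r (by have : (r : ℕ) ≠ z.1 := fun e => h (Fin.ext e)
                       omega))
    rw [Aux.prod] at this
    rw [this]
    by_cases hkz : k z.1 = l₀ z.1
    · rw [if_pos hkz, show sgn 0 = 1 from rfl, one_smul]
      congr 1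
      refine propext (and_congr_left fun _ => ⟨fun h r hr => ?_, fun h r hr => ?_⟩)
      · by_cases e : r = z.1
        · rw [e, hkz]
        · have : (r : ℕ) ≠ z.1 := fun e' => e (Fin.ext e')
          rw [← h r (by omega), Function.update_of_ne e]
      · have : r ≠ z.1 := fun e => by rw [e] at hr; omega
        rw [Function.update_of_ne this, h r (by omega)]
    · rw [if_neg hkz, if_neg fun h => hkz (h.1 z.1 hz.ge)]

theorem foldr_siteOp_zero (μ : ZMod 2) (T : W → Fin 3 → Fin 3 → A) (ps : List (Fin N × W)) :
    ps.foldr (fun p ψ => siteOp par μ p.1 (T p.2) ψ) (0 : (Fin N → Fin 3) → S) = 0 := by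
  induction ps with
  | nil => rfl
  | cons p ps ih => rw [List.foldr_cons, ih]; funext k; simp [siteOp]

theorem rBlocks_zero (g : W → W → K) (ps qs : List (Fin N × W)) :
    rBlocks par g ps qs (0 : (Fin N → Fin 3) → S) = 0 := by
  funext k
  induction qs generalizing k with
  | nil => rfl
  | cons q qs ih =>
    replace ih := funext ih
    rw [rBlocks, List.foldr_cons]
    change ps.foldl (fun ψ p => rOp par p.1 q.1 (g q.2 p.2) ψ) (rBlocks par g ps qs 0) k = 0
    rw [ih]
    clear ih
    induction ps with
    | nil => rfl
    | cons p ps ihp =>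
      have : rOp par p.1 q.1 (g q.2 p.2) (0 : (Fin N → Fin 3) → S) = 0 := by
        funext k; simp [rOp]
      rw [List.foldl_cons, this, ihp]

theorem contract_congr (a b : W → Module.End K S) (us : List W) (q q' : List Bool → S)
    (h : ∀ ns : List Bool, ns.length = us.length → q ns = q' ns) :
    contract K a b us q = contract K a b us q' := by
  induction us generalizing q q' with
  | nil => exact h [] rfl
  | cons u us ih =>
    have (x : Bool) := ih (slice K x q) (slice K x q') fun ns hns => h (x :: ns) (by simp [hns])
    simp only [contract, LinearMap.add_apply, LinearMap.comp_apply, this]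

theorem letters_injective {w w' : List (Fin 3)} (h : w.length = N) (h' : w'.length = N)
    (e : letters N w = letters N w') : w = w' := by
  refine List.ext_getElem (h.trans h'.symm) fun i hi hi' => ?_
  have := congrFun e ⟨i, h ▸ hi⟩
  simpa [letters, hi, hi'] using this

theorem vac_eq_ite (ω : S) (us : List W) (ns : List Bool) (h : ns.length = us.length) :
    vac ω us ns = if ns = List.replicate us.length false then ω else 0 := by
  induction us generalizing ns with
  | nil => simp only [List.length_nil, List.length_eq_zero_iff] at h; simp [vac, h]
  | cons u us ih =>
    rcases ns with _ | ⟨_ | _, ns⟩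
    · simp at h
    · simpa [vac, List.replicate_succ] using ih ns (by simpa using h)
    · simp [vac, List.replicate_succ]

theorem letters_replicate {a b : ℕ} (x y : Fin 3) (i : Fin (a + b)) :
    letters (a + b) (List.replicate a x ++ List.replicate b y) i
      = if (i : ℕ) < a then x else y := by
  have := i.2
  simp only [letters]
  split_ifs with h
  · rw [List.getD_append _ _ _ _ (by simpa using h)]; simp [h]
  · rw [List.getD_append_right _ _ _ _ (by simpa using h)]
    have : (i : ℕ) - a < b := by omega
    simp [this]

variable {par γ} in
/-- The super-trace of the Bethe vectors as a nested vector. -/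
theorem superTrace_smul (hp0 : par 0 = 0) (hp2 : par 2 = 1)
    (hγ : ∀ x : K, γ (algebraMap K A x) = algebraMap K A x) (T : W → Fin 3 → Fin 3 → A)
    (hT : ∀ w i j, γ (T w i j) = sgn (par i + par j) • T w i j) (g : W → W → K) (us vs : List W)
    (ω : S) :
    superTrace par γ (fun v u => algebraMap K A (g v u)) T us vs • ω
      = sgn (vs.length * par 1) • nested (signedT S K par T 0 1) (signedT S K par T 0 2)
          (signedT S K par T 1 1) (signedT S K par T 1 2)
          (fun z w => (sgn (par 1) : K) * g z w) (-(sgn (par 1) : K)) ω us vs := by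
  have h0 : γ 0 = 0 := by simpa using hγ 0
  have h1 : γ 1 = 1 := by simpa using hγ 1
  set a := us.length with ha
  set b := vs.length with hb
  set ps : List (Fin (a + b) × W) := (List.finRange a).map fun p => (Fin.castAdd b p, us.get p)
    with hps
  set qs : List (Fin (a + b) × W) := (List.finRange b).map fun q => (Fin.natAdd a q, vs.get q)
    with hqs
  have hpl : ps.length = a := by simp [hps]
  have hql : qs.length = b := by simp [hqs]
  have hpu : ps.map Prod.snd = us := by
    rw [hps, List.map_map]; exact List.map_get_finRange us
  have hqv : qs.map Prod.snd = vs := by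
    rw [hqs, List.map_map]; exact List.map_get_finRange vs
  have hpc : Consecutive 0 ps := by
    rw [Consecutive, hpl, hps, List.map_map, ← List.range_eq_range']
    exact List.map_coe_finRange_eq_range
  have hqc : Consecutive a qs := by
    rw [Consecutive, hql, hqs, List.map_map, List.range'_eq_map_range,
      ← List.map_coe_finRange_eq_range, List.map_map]
    rfl
  set m₀ : Fin (a + b) → Fin 3 := letters (a + b) (List.replicate a 0 ++ List.replicate b 1)
    with hm₀
  set l₀ : Fin (a + b) → Fin 3 := letters (a + b) (List.replicate a 1 ++ List.replicate b 2)
    with hl₀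
  have hm₀i := fun i => letters_replicate (a := a) (b := b) 0 1 i
  have hl₀i := fun i => letters_replicate (a := a) (b := b) 1 2 i
  rw [← hm₀] at hm₀i
  rw [← hl₀] at hl₀i
  -- Spaces carrying E_21 have an even column index. A space carrying E_32 meets further column
  -- indices 2 on its left, and ([3] + [2])[2] vanishes because [3] = 1.
  have hs : ∀ z, (par (l₀ z) + par (m₀ z)) * ∑ r ∈ Finset.Iio z, par (m₀ r) = 0 := by
    intro z
    rw [Finset.mul_sum]
    refine Finset.sum_eq_zero fun r hr => ?_
    rw [Finset.mem_Iio, Fin.lt_def] at hr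
    rw [hm₀i r, hl₀i z, hm₀i z]
    by_cases h : (r : ℕ) < a
    · rw [if_pos h, hp0, mul_zero]
    · rw [if_neg h, if_neg (by omega), if_neg (by omega), hp2]
      generalize par 1 = x
      revert x; decide
  have hμ : ∑ q, par (m₀ q) = b * par 1 := by
    have := sum_letters (N := a + b) par [] (List.replicate a 0 ++ List.replicate b 1) []
      Finset.univ (by intro r; have := r.2; simp) (by simp)
    simp only [List.nil_append, List.append_nil] at this
    rw [← hm₀] at this
    rw [this]
    simp [hp0]
  -- The sign by which `column_prod_E` multiplies the initial vector. It squares to 1, so starting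
  -- from `s • ω` removes it.
  set s := sgn (∑ p, ∑ q ∈ Finset.Ioi p, par (m₀ p) * par (m₀ q)) with hs'
  have hss : s * s = 1 := sgn_mul_self _
  set Z : Aux (a + b) A := Aux.prod par γ ((ps ++ qs).map fun z => Aux.E z.1 (l₀ z.1) (m₀ z.1))
    with hZ
  have hZc (m : Fin (a + b) → Fin 3) : column par (s • ω) m Z
      = fun k => if k = l₀ ∧ m = m₀ then ω else 0 := by
    funext k
    rw [hZ, column_prod_E par γ (s • ω) l₀ m₀ m h0 h1 hs 0 (ps ++ qs)
      (consecutive_append hpc (by rw [hpl, zero_add]; exact hqc)) (by simp [hpl, hql]) k (by simp),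
      ← hs', smul_smul, hss, one_smul]
    congr 1
    simp [funext_iff]
  set X : Aux (a + b) A := (ps.map fun p => Aux.place p.1 (T p.2)).foldr (Aux.mul par γ)
    ((qs.map fun p => Aux.place p.1 (T p.2)).foldr (Aux.mul par γ)
      ((qs.flatMap fun q => ps.reverse.map fun p =>
        Aux.R par γ q.1 p.1 (algebraMap K A (g q.2 p.2))).foldr (Aux.mul par γ) Z)) with hX
  have hpq : ∀ p ∈ ps, ∀ q ∈ qs, p.1 < q.1 := by
    intro p hp q hq
    have h1 := (hpc.le hp).2
    have h2 := (hqc.le hq).1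
    rw [Fin.lt_def]; omega
  have hXc (m : Fin (a + b) → Fin 3) : column par (s • ω) m X
      = ps.foldr (fun p ψ => siteOp par (∑ q, par (m q)) p.1 (T p.2) ψ)
          (qs.foldr (fun p ψ => siteOp par (∑ q, par (m q)) p.1 (T p.2) ψ)
            (rBlocks par g ps qs (column par (s • ω) m Z))) := by
    rw [hX, column_foldr_place par γ _ _ T h0 hT, column_foldr_place par γ _ _ T h0 hT,
      column_foldr_R par γ _ _ g hγ ps qs hpq]
  have hstr : superTrace par γ (fun v u => algebraMap K A (g v u)) T us vs = Aux.str par X := by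
    have e1 : (List.finRange us.length).map
        (fun p => (Aux.place (Fin.castAdd vs.length p) (T (us.get p)) : Aux (a + b) A))
        = ps.map fun p => Aux.place p.1 (T p.2) := by rw [hps, List.map_map]; rfl
    have e2 : (List.finRange vs.length).map
        (fun q => (Aux.place (Fin.natAdd us.length q) (T (vs.get q)) : Aux (a + b) A))
        = qs.map fun p => Aux.place p.1 (T p.2) := by rw [hqs, List.map_map]; rfl
    have e3 : ((List.finRange vs.length).flatMap fun q => (List.finRange us.length).reverse.map
        fun p => (Aux.R par γ (Fin.natAdd us.length q) (Fin.castAdd vs.length p)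
          (algebraMap K A (g (vs.get q) (us.get p))) : Aux (a + b) A))
        = qs.flatMap fun q => ps.reverse.map fun p =>
          Aux.R par γ q.1 p.1 (algebraMap K A (g q.2 p.2)) := by
      rw [hqs, List.flatMap_map, hps, ← List.map_reverse]
      simp only [List.map_map]
      rfl
    have e4 : (List.finRange us.length).map
        (fun p => (Aux.E (Fin.castAdd vs.length p) 1 0 : Aux (a + b) A))
        = ps.map fun z => Aux.E z.1 (l₀ z.1) (m₀ z.1) := by
      rw [hps, List.map_map]
      refine List.map_congr_left fun p _ => ?_
      have := p.2
      simp [hl₀i, hm₀i]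
      rfl
    have e5 : (List.finRange vs.length).map
        (fun q => (Aux.E (Fin.natAdd us.length q) 2 1 : Aux (a + b) A))
        = qs.map fun z => Aux.E z.1 (l₀ z.1) (m₀ z.1) := by
      rw [hqs, List.map_map]
      refine List.map_congr_left fun p _ => ?_
      simp [hl₀i, hm₀i]
      rfl
    rw [superTrace, e1, e2, e3, e4, e5, Aux.prod, hX, hZ, Aux.prod]
    simp only [List.foldr_append, List.map_append]
    rfl
  have hXm (m : Fin (a + b) → Fin 3) : X m m • ω
      = s • sgn (∑ p, ∑ q ∈ Finset.Ioi p, par (m p) * par (m q)) • column par (s • ω) m X m := by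
    have h3 (x : ZMod 2) (y : S) : sgn x • sgn x • y = y := by
      rw [smul_smul, sgn_mul_self, one_smul]
    rw [column, h3, smul_comm (X m m) s, h3]
  rw [hstr, Aux.str, Finset.sum_smul, Finset.sum_eq_single m₀]
  rotate_left
  · intro m _ hm
    have h2 : column par (s • ω) m X = 0 := by
      rw [hXc, hZc]
      have : (fun k => if k = l₀ ∧ m = m₀ then ω else 0) = (0 : (Fin (a + b) → Fin 3) → S) := by
        funext k; exact if_neg fun h => hm h.2
      rw [this, rBlocks_zero, foldr_siteOp_zero, foldr_siteOp_zero]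
    rw [smul_assoc, hXm, h2, Pi.zero_apply, smul_zero, smul_zero, smul_zero]
  · simp
  rw [smul_assoc, hXm, ← hs', smul_smul s s, hss, one_smul, hXc, hμ, hZc]
  congr 1
  simp only [and_true]
  set ψ : (Fin (a + b) → Fin 3) → S := fun k => if k = l₀ then ω else 0 with hψ
  have hψ0 : ∀ k s, k s = 0 → ψ k = 0 := by
    intro k s hk
    refine if_neg fun h => ?_
    rw [h, hl₀i] at hk
    split_ifs at hk <;> exact absurd hk (by decide)
  have hψ2 : ∀ q ∈ qs, ∀ k, k q.1 ≠ 2 → ψ k = 0 := by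
    intro q hq k hk
    refine if_neg fun h => hk ?_
    have := (hqc.le hq).1
    rw [h, hl₀i, if_neg (by omega)]
  -- Only the diagonal entry at `m₀` contributes to the trace, so the matrices at ū enter through
  -- row 0 and those at v̄ through row 1.
  have c1 := foldr_siteOp (K := K) par T (b * par 1) 0 (List.replicate b 1) (by
      intro c j _; simp [hp0, CharTwo.add_self_eq_zero])
    (qs.foldr (fun p ψ => siteOp par (b * par 1) p.1 (T p.2) ψ) (rBlocks par g ps qs ψ))
    [] ps (by simpa using hpc) (by simp [hpl]) (by
      intro p hp k hk
      refine foldr_siteOp_support par _ T qs (fun q hq => (hpq p hp q hq).ne) ?_ k hk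
      exact fun k hk => rBlocks_vanish par g ps qs 0 hψ0 k _ hk)
  have c2 (ns : List Bool) (hns : ns.length = a) := foldr_siteOp (K := K) par T (b * par 1) 1 [] (by
      intro c j hj
      have : j = 1 ∨ j = 2 := by revert j; decide
      rcases this with rfl | rfl
      · simp [CharTwo.add_self_eq_zero]
      · rw [hp2]
        generalize par 1 = x; generalize (b : ZMod 2) = y
        simp only [List.map_nil, List.sum_nil]
        revert c x y; decide)
    (rBlocks par g ps qs ψ) (ns.map idx) qs (by simpa [hns] using hqc) (by simp [hns, hql])
    (fun p hp k hk => rBlocks_vanish par g ps qs 0 hψ0 k _ hk)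
  have c3 (ns : List Bool) (hns : ns.length = a) := contract_rBlocks par hp2 rfl g
    (signedT S K par T 1 1) (signedT S K par T 1 2) ω ps qs 0 hpc (by simpa [hpl] using hqc) ψ hψ2
    (by
      intro ns hns
      rw [hpl] at hns
      rw [hpu, vac_eq_ite ω us ns hns, zero_add, hql, hψ]
      refine if_congr ⟨fun h => ?_, fun h => ?_⟩ rfl rfl
      · have := letters_injective (by simp [hns]) (by simp) h
        rw [List.map_append] at this
        have := (List.append_inj this (by simp [hns])).1
        have hi : Function.Injective idx := by decide
        exact hi.list_map (this.trans (by rw [List.map_replicate]; rfl))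
      · rw [h, hl₀, bits]
        simp [idx, ha]) ns (by rw [hpl, hns])
  rw [nested]
  simp only [List.nil_append, hpl, hql, hpu, hqv] at c1 c2 c3
  rw [hm₀, c1]
  refine contract_congr _ _ _ _ _ fun ns hns => ?_
  have c2 := c2 ns hns
  rw [List.append_nil] at c2
  rw [c2, ← c3 ns hns]
  have hw : wordSign ((-(sgn (par 1)) : K) ^ 0) ns = 1 := by simp [wordSign]
  rw [hw, one_smul]
  refine contract_congr _ _ _ _ _ fun ms _ => ?_
  simp [bits]

end Trace


/-! ### Exchange relations and recursions from the RTT relation -/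

section RTT

variable {W A S K : Type*} [Ring A] [AddCommGroup S] [Module A S]
  [Field K] [Algebra K A] [Module K S] [IsScalarTower K A S]

/-- The `RTT` relation, for distinct parameters. -/
def RTTRel (par : Fin 3 → ZMod 2) (g : W → W → K) (T : W → Fin 3 → Fin 3 → A) : Prop :=
  ∀ z w : W, z ≠ w → ∀ i j k l : Fin 3,
    T z i j * T w k l - sgn ((par i + par j) * (par k + par l)) • (T w k l * T z i j)
      = sgn (par l * (par i + par j) + par i * par j) •
        (g z w • (T z i l * T w k j - T w i l * T z k j))

variable {par : Fin 3 → ZMod 2} {g : W → W → K} {T : W → Fin 3 → Fin 3 → A}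

variable (par g) in
/-- The `RTT` relation for operators, for distinct parameters. -/
def RTTOp (t : Fin 3 → Fin 3 → W → Module.End K S) : Prop :=
  ∀ z w : W, z ≠ w → ∀ (i j k l : Fin 3) (x : S),
    t i j z (t k l w x)
        - (sgn ((par i + par j) * (par k + par l)) : K) • t k l w (t i j z x)
      = (sgn (par l * (par i + par j) + par i * par j) : K) •
        g z w • (t i l z (t k j w x) - t i l w (t k j z x))

theorem RTTRel.op (hR : RTTRel par g T) :
    RTTOp par g fun i j w => Algebra.lsmul K K S (T w i j) := by
  intro z w hzw i j k l x
  have := congrArg (· • x) (hR z w hzw i j k l)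
  simp only [sub_smul, smul_assoc, mul_smul] at this
  simpa only [Int.cast_smul_eq_zsmul, Algebra.lsmul_coe] using this

variable {t : Fin 3 → Fin 3 → W → Module.End K S}

variable (par t) in
/-- The operators `±t_kj(w)`, with the sign `(-1)^([j]([k]+[j]))`. -/
def signedOp (k j : Fin 3) (w : W) : Module.End K S :=
  ((sgn ((par k + par j) * par j) : ℤ) : K) • t k j w

/-- The relations within the row T_22, T_23, needed for the nesting over ū. -/
theorem RTTOp.exch [CharZero K] (hg : IsKernel g) (hp2 : par 2 = 1)
    (hR : RTTOp par g t) :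
    Exch (fun z w => (sgn (par 1) : K) * g z w) (-(sgn (par 1) : K))
      (signedOp par t 1 1) (signedOp par t 1 2) fun _ => True where
  db {z w} _ _ hzw x := by
    have h := hR z w hzw 1 1 1 2 x
    rcases sgn_cases (par 1) with ⟨a, -⟩ | ⟨a, -⟩ <;>
    simp [signedOp, a, hp2, sgn, CharTwo.add_self_eq_zero] at h ⊢ <;>
    first
    | linear_combination (norm := module) h
    | linear_combination (norm := module) -h
  bb {z w} _ _ hzw x := by
    have h := hR z w hzw 1 2 1 2 x
    have h' := hR w z hzw.symm 1 2 1 2 x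
    rw [hg.antisymm z w] at h'
    rcases sgn_cases (par 1) with ⟨a, -⟩ | ⟨a, -⟩ <;>
    simp [signedOp, a, hp2, sgn, CharTwo.add_self_eq_zero] at h h' ⊢ <;>
    first
    | linear_combination (norm := module) h
    | linear_combination (norm := module) -h'
  dd {z w} _ _ hzw x := by
    have h := hR z w hzw 1 1 1 1 x
    have h' := hR w z hzw.symm 1 1 1 1 x
    rw [hg.antisymm z w] at h'
    rcases sgn_cases (par 1) with ⟨a, -⟩ | ⟨a, -⟩ <;>
    simp [signedOp, a, sgn, CharTwo.add_self_eq_zero] at h h' ⊢ <;>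
    -- The relations at (z,w) and at (w,z) express the commutator as opposite multiples of itself.
    -- Their combination kills it without any assumption that 1 ± g is nonzero.
    linear_combination (norm := module) (1 / 2 : K) • h - (1 / 2 : K) • h'

/-- The relations within the column T_12, T_22, needed for the nesting over v̄. Relative to
`RTTOp.exch` both the kernel and `η` change sign: of the two sets of parameters exactly one is
fermionic. -/
theorem RTTOp.exch' [CharZero K] (hg : IsKernel g) (hp0 : par 0 = 0) 
    (hR : RTTOp par g t) :
    Exch (fun z w => -(sgn (par 1) : K) * g z w) (sgn (par 1) : K)
      (signedOp par t 1 1) (signedOp par t 0 1) fun _ => True where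
  db {z w} _ _ hzw x := by
    have h := hR w z hzw.symm 0 1 1 1 x
    rw [hg.antisymm z w] at h
    rcases sgn_cases (par 1) with ⟨a, -⟩ | ⟨a, -⟩ <;>
    simp [signedOp, a, hp0, sgn, CharTwo.add_self_eq_zero] at h ⊢ <;>
    first
    | linear_combination (norm := module) h
    | linear_combination (norm := module) -h
  bb {z w} _ _ hzw x := by
    have h := hR z w hzw 0 1 0 1 x
    rcases sgn_cases (par 1) with ⟨a, -⟩ | ⟨a, -⟩ <;>
    simp [signedOp, a, hp0, sgn, CharTwo.add_self_eq_zero] at h ⊢ <;>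
    linear_combination (norm := module) h
  dd {z w} _ _ hzw x := by
    have h := hR z w hzw 1 1 1 1 x
    have h' := hR w z hzw.symm 1 1 1 1 x
    rw [hg.antisymm z w] at h'
    rcases sgn_cases (par 1) with ⟨a, -⟩ | ⟨a, -⟩ <;>
    simp [signedOp, a, sgn, CharTwo.add_self_eq_zero] at h h' ⊢ <;>
    linear_combination (norm := module) (1 / 2 : K) • h - (1 / 2 : K) • h'

theorem RTTOp.rowCol (hp0 : par 0 = 0) (hp2 : par 2 = 1) (hR : RTTOp par g t) {u v : W}
    (huv : u ≠ v) :
    RowCol (fun z w => -(sgn (par 1) : K) * g z w) (sgn (par 1) : K)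
      (fun k j => signedOp par t (if k then 1 else 0) (if j then 2 else 1)) u v := by
  intro k i x j q
  have h := hR u v huv (if k then 1 else 0) (if x then 2 else 1) (if i then 1 else 0)
    (if j then 2 else 1) q
  rcases sgn_cases (par 1) with ⟨a, -⟩ | ⟨a, -⟩ <;> cases k <;> cases i <;> cases x <;> cases j <;>
  simp [signedOp, a, hp0, hp2, sgn, CharTwo.add_self_eq_zero] at h ⊢ <;>
  first
  | linear_combination (norm := module) h
  | linear_combination (norm := module) -h

variable (par g t) in
/-- The vector `F(ū, v̄)` in terms of the operators `t_kj`. -/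
def offShell (ω : S) (us vs : List W) : S :=
  nested (signedOp par t 0 1) (signedOp par t 0 2) (signedOp par t 1 1) (signedOp par t 1 2)
    (fun z w => (sgn (par 1) : K) * g z w) (-(sgn (par 1) : K)) ω us vs

theorem RTTOp.offShell_cons_left [CharZero K] (hg : IsKernel g) (hp2 : par 2 = 1)
    (hR : RTTOp par g t) {ω : S} {Λ : W → K} (hΛ : ∀ z, t 1 1 z ω = Λ z • ω) {u : W}
    {us vs : List W} (hnd : (u :: us ++ vs).Nodup) :
    offShell par g t ω (u :: us) vs = signedOp par t 0 1 u (offShell par g t ω us vs)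
      + signedOp par t 0 2 u (splitSum vs fun p w s =>
        (Λ w * (us.map fun x => 1 + (sgn (par 1) : K) * g w x).prod * ((sgn (par 1) : K) * g w u)
          * (p.map fun i => -(sgn (par 1) : K) + (sgn (par 1) : K) * g i w).prod
          * (s.map fun i => 1 + (sgn (par 1) : K) * g i w).prod)
          • offShell par g t ω us (p ++ s)) := by
  obtain ⟨h1, h2, h3⟩ := List.nodup_append'.1 hnd
  refine nested_cons (hg.smul _) ?_ (hR.exch hg hp2) (Λ := Λ) (fun z _ => ?_) u us vs
    (fun v hv => ⟨trivial, fun h => h3 (List.mem_cons_of_mem _ h) hv⟩) h2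
    fun h => h3 List.mem_cons_self h
  · rw [neg_mul_neg]; exact_mod_cast sgn_mul_self _
  · simpa [signedOp, CharTwo.add_self_eq_zero, sgn] using hΛ z

theorem RTTOp.offShell_swap (hg : IsKernel g) (hp0 : par 0 = 0) (hp2 : par 2 = 1)
    (hR : RTTOp par g t) {ω : S} {us vs : List W} (hnd : (us ++ vs).Nodup) :
    offShell par g t ω us vs
      = nested (signedOp par t 1 2) (signedOp par t 0 2) (signedOp par t 1 1) (signedOp par t 0 1)
        (fun z w => -(sgn (par 1) : K) * g z w) (sgn (par 1) : K) ω vs us := by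
  obtain ⟨h1, h2, h3⟩ := List.nodup_append'.1 hnd
  have := nested_swap ω us vs fun u hu v hv =>
    hR.rowCol hp0 hp2 fun e => h3 hu (e ▸ hv)
  simp only [Bool.false_eq_true, if_false, if_true] at this
  rw [← this, offShell]
  congr 1
  funext z w
  rw [hg.antisymm z w]; ring

/-- In the swapped nesting `v` is the first site; it is split off there, and every resulting term is
swapped back. -/
theorem RTTOp.offShell_cons_right [CharZero K] (hg : IsKernel g) (hp0 : par 0 = 0)
    (hp2 : par 2 = 1)
    (hR : RTTOp par g t) {ω : S} {Λ : W → K} (hΛ : ∀ z, t 1 1 z ω = Λ z • ω) {v : W}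
    {us vs : List W} (hnd : (us ++ v :: vs).Nodup) :
    offShell par g t ω us (v :: vs) = signedOp par t 1 2 v (offShell par g t ω us vs)
      + signedOp par t 0 2 v (splitSum us fun p w s =>
        (Λ w * (vs.map fun x => 1 + -(sgn (par 1) : K) * g w x).prod
          * (-(sgn (par 1) : K) * g w v)
          * (p.map fun i => (sgn (par 1) : K) + -(sgn (par 1) : K) * g i w).prod
          * (s.map fun i => 1 + -(sgn (par 1) : K) * g i w).prod)
          • offShell par g t ω (p ++ s) vs) := by
  obtain ⟨h1, h2, h3⟩ := List.nodup_append'.1 hnd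
  have hnd' : (us ++ vs).Nodup := hnd.sublist (by simp)
  rw [hR.offShell_swap hg hp0 hp2 hnd, hR.offShell_swap hg hp0 hp2 hnd', nested_cons
    (η := (sgn (par 1) : K)) (P := fun _ => True) (Λ := Λ) (hg.smul _) ?_ (hR.exch' hg hp0)
    (fun z _ => ?_) v vs us (fun u hu => ⟨trivial, fun h => h3 hu (List.mem_cons_of_mem _ h)⟩) h1
    fun h => h3 h List.mem_cons_self]
  · congr 2
    refine splitSum_congr _ fun p w s e => ?_
    rw [hR.offShell_swap hg hp0 hp2 (hnd'.sublist (by simp [e]))]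
  · exact_mod_cast sgn_mul_self _
  · simpa [signedOp, CharTwo.add_self_eq_zero, sgn] using hΛ z

end RTT


/-! ### Coefficients of products of Hahn series -/

section Convolution

open HahnSeries

variable {Γ R V : Type*} [AddCommGroup Γ] [LinearOrder Γ]
  [Semiring R] [AddCommMonoid V] [Module R V]

theorem mem_vaddAntidiagonal_of_smul_ne_zero (x : HahnSeries Γ R) (y : HahnSeries Γ V) {a i : Γ}
    (h : (x.support.vaddAntidiagonal y.support a).Finite) (hi : x.coeff i • y.coeff (a - i) ≠ 0) :
    (i, a - i) ∈ Finset.VAddAntidiagonal a h := by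
  rw [Finset.mem_vaddAntidiagonal]
  refine ⟨fun h => hi ?_, fun h => hi ?_, add_sub_cancel i a⟩
  · rw [h, zero_smul]
  · rw [h, smul_zero]

variable [IsOrderedAddMonoid Γ]

theorem hasFiniteSupport_smul (x : HahnSeries Γ R) (y : HahnSeries Γ V) (a : Γ) :
    Function.HasFiniteSupport fun i => x.coeff i • y.coeff (a - i) :=
  ((Finset.VAddAntidiagonal a (Set.VAddAntidiagonal.finite_of_isPWO x.isPWO_support
    y.isPWO_support a)).image Prod.fst).finite_toSet.subset fun _ hi =>
      Finset.mem_coe.2 (Finset.mem_image_of_mem Prod.fst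
        (mem_vaddAntidiagonal_of_smul_ne_zero x y _ hi))

/-- Summation over all exponents makes the formula independent of the supports, which change when
linear maps are applied to coefficients. -/
theorem coeff_smul_eq_finsum (x : HahnSeries Γ R) (y : HahnSeries Γ V) (a : Γ) :
    ((HahnModule.of R).symm (x • HahnModule.of R y)).coeff a
      = ∑ᶠ i, x.coeff i • y.coeff (a - i) := by
  have h := Set.VAddAntidiagonal.finite_of_isPWO x.isPWO_support y.isPWO_support a
  have e : ∀ ij ∈ Finset.VAddAntidiagonal a h, ij.2 = a - ij.1 := fun ij hij =>
    eq_sub_of_add_eq' ((Finset.mem_vaddAntidiagonal _ _).1 hij).2.2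
  rw [HahnModule.coeff_smul, finsum_eq_sum_of_support_subset
    (s := (Finset.VAddAntidiagonal a h).image Prod.fst) _ fun _ hi =>
      Finset.mem_coe.2 (Finset.mem_image_of_mem Prod.fst
        (mem_vaddAntidiagonal_of_smul_ne_zero x y _ hi)), Finset.sum_image]
  · exact Finset.sum_congr rfl fun ij hij => by rw [← e ij hij]; rfl
  · intro p hp q hq hpq
    exact Prod.ext hpq (by rw [e p hp, e q hq, hpq])

theorem mul_coeff_eq_finsum (x y : HahnSeries Γ R) (a : Γ) :
    (x * y).coeff a = ∑ᶠ i, x.coeff i * y.coeff (a - i) := by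
  rw [← HahnSeries.of_symm_smul_of_eq_mul, coeff_smul_eq_finsum]
  rfl

end Convolution

/-! ### Scalar series and their action -/

section Scalars

variable {W : Type*} [LinearOrder W] [Finite W]

/-- Scalar series as series with coefficients in an algebra. -/
noncomputable def scalarHom (W : Type*) [LinearOrder W] [Finite W] (B : Type*) [Ring B] [Algebra ℂ B] :
    Ser W ℂ →+* Ser W B where
  toFun k := k.map (algebraMap ℂ B)
  map_one' := by
    ext a
    rw [HahnSeries.map_coeff, HahnSeries.coeff_one, HahnSeries.coeff_one]
    split_ifs <;> simp
  map_zero' := by ext a; simp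
  map_mul' x y := HahnSeries.map_mul (algebraMap ℂ B).toNonUnitalRingHom
  map_add' x y := by ext a; simp

variable {B : Type*} [Ring B] [Algebra ℂ B]

theorem coeff_scalarHom (k : Ser W ℂ) (a : Lex (W → ℤ)) :
    (scalarHom W B k).coeff a = algebraMap ℂ B (k.coeff a) := rfl

theorem scalarHom_comm (k : Ser W ℂ) (x : Ser W B) :
    scalarHom W B k * x = x * scalarHom W B k := by
  ext a
  rw [mul_coeff_eq_finsum, mul_coeff_eq_finsum]
  refine finsum_eq_of_bijective (fun i => a - i) (Equiv.subLeft a).bijective fun i => ?_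
  rw [sub_sub_cancel, coeff_scalarHom, Algebra.commutes]

variable {V : Type*} [AddCommGroup V] [Module ℂ V] [Module B V] [IsScalarTower ℂ B V]

theorem coeff_scale (k : Ser W ℂ) (x : Ser W V) (a : Lex (W → ℤ)) :
    (scale k x).coeff a = ∑ᶠ i, k.coeff i • x.coeff (a - i) := coeff_smul_eq_finsum _ _ _

theorem scalarHom_smul (k : Ser W ℂ) (x : Ser W V) :
    (HahnModule.of B).symm (scalarHom W B k • HahnModule.of B x) = scale k x := by
  ext a
  rw [coeff_smul_eq_finsum, coeff_scale]
  simp only [coeff_scalarHom, algebraMap_smul]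

/-- The scalar multiplication of vector-valued series by scalar series. -/
@[reducible] noncomputable def scaleModule (W V : Type*) [LinearOrder W] [Finite W] [AddCommGroup V]
    [Module ℂ V] : Module (Ser W ℂ) (Ser W V) where
  smul := scale
  one_smul x := by change scale 1 x = x; simp [scale]
  mul_smul k l x := by
    change scale (k * l) x = scale k (scale l x)
    exact congrArg (HahnModule.of ℂ).symm (mul_smul k l (HahnModule.of ℂ x))
  smul_zero k := by
    change scale k 0 = 0
    exact congrArg _ (smul_zero k)
  smul_add k x y := by
    change scale k (x + y) = scale k x + scale k y
    exact congrArg (HahnModule.of ℂ).symm (smul_add k (HahnModule.of ℂ x) (HahnModule.of ℂ y))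
  add_smul k l x := by
    change scale (k + l) x = scale k x + scale l x
    exact congrArg (HahnModule.of ℂ).symm (add_smul k l (HahnModule.of ℂ x))
  zero_smul x := by
    change scale 0 x = 0
    exact congrArg (HahnModule.of ℂ).symm (zero_smul (Ser W ℂ) (HahnModule.of ℂ x))

end Scalars

/-! ### Products of series in two different parameters -/

section Params

variable {W : Type*} [LinearOrder W]

theorem expo_add_injective {z w : W} (hzw : z ≠ w) {r s r' s' : ℕ}
    (h : expo z r + expo w s = expo z r' + expo w s') : r = r' ∧ s = s' := by
  have h1 := congrFun (congrArg ofLex h) z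
  have h2 := congrFun (congrArg ofLex h) w
  change (Pi.single z (r : ℤ) : W → ℤ) z + (Pi.single w (s : ℤ) : W → ℤ) z
    = (Pi.single z (r' : ℤ) : W → ℤ) z + (Pi.single w (s' : ℤ) : W → ℤ) z at h1
  change (Pi.single z (r : ℤ) : W → ℤ) w + (Pi.single w (s : ℤ) : W → ℤ) w
    = (Pi.single z (r' : ℤ) : W → ℤ) w + (Pi.single w (s' : ℤ) : W → ℤ) w at h2
  simp [hzw, hzw.symm] at h1 h2
  exact ⟨h1, h2⟩

variable [Finite W] {R : Type*} [Ring R]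

theorem atInv_coeff (w : W) (F : PowerSeries R) (n : ℕ) :
    (atInv w F).coeff (expo w n) = PowerSeries.coeff n F := by
  refine (HahnSeries.embDomain_coeff (f := ⟨⟨expo w, (expo_strictMono w).injective⟩,
    (expo_strictMono w).le_iff_le⟩)).trans ?_
  exact HahnSeries.coeff_toPowerSeries_symm

theorem atInv_coeff_of_notMem (w : W) (F : PowerSeries R) {a : Lex (W → ℤ)}
    (ha : ∀ n, expo w n ≠ a) : (atInv w F).coeff a = 0 := by
  refine HahnSeries.embDomain_of_notMem_range (f := ⟨⟨expo w, (expo_strictMono w).injective⟩,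
    (expo_strictMono w).le_iff_le⟩) ?_
  rintro ⟨n, hn⟩
  exact ha n hn

theorem atInv_mul_coeff {z w : W} (hzw : z ≠ w) (F G : PowerSeries R) (r s : ℕ) :
    (atInv z F * atInv w G).coeff (expo z r + expo w s)
      = PowerSeries.coeff r F * PowerSeries.coeff s G := by
  rw [mul_coeff_eq_finsum, finsum_eq_single _ (expo z r), add_sub_cancel_left, atInv_coeff,
    atInv_coeff]
  intro i hi
  by_cases h : ∃ n, expo z n = i
  · obtain ⟨n, rfl⟩ := h
    rw [atInv_coeff_of_notMem w G, mul_zero]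
    intro m hm
    exact hi (congrArg _ (expo_add_injective hzw (eq_sub_iff_add_eq'.1 hm)).1)
  · push Not at h
    rw [atInv_coeff_of_notMem z F h, zero_mul]

theorem atInv_mul_coeff_of_ne {z w : W} (F G : PowerSeries R) {a : Lex (W → ℤ)}
    (ha : ∀ r s, expo z r + expo w s ≠ a) : (atInv z F * atInv w G).coeff a = 0 := by
  rw [mul_coeff_eq_finsum]
  refine finsum_eq_zero_of_forall_eq_zero fun i => ?_
  by_cases h : ∃ n, expo z n = i
  · obtain ⟨n, rfl⟩ := h
    rw [atInv_coeff_of_notMem w G, mul_zero]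
    exact fun m hm => ha n m (eq_sub_iff_add_eq'.1 hm)
  · push Not at h
    rw [atInv_coeff_of_notMem z F h, zero_mul]

end Params


/-! ### The kernel g and multiplication by a parameter -/

section Kernel

variable {W : Type*} [LinearOrder W] [Finite W]

theorem param_sub_ne_zero {z w : W} (h : z ≠ w) : param z - param w ≠ 0 := by
  intro e
  have e' := congrArg (fun x => x.coeff (toLex (Pi.single z (-1)))) (sub_eq_zero.1 e)
  have hne : (toLex (Pi.single z (-1)) : Lex (W → ℤ)) ≠ toLex (Pi.single w (-1)) := fun h' => by
    have := congrFun (congrArg ofLex h') z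
    simp [h] at this
  simp [param, HahnSeries.coeff_single_of_ne hne] at e'

theorem div_sub_comm_neg {F : Type*} [Field F] (a b c : F) : c / (b - a) = -(c / (a - b)) := by
  rw [← neg_sub, div_neg]

theorem isKernel_g (c : ℂ) : IsKernel (g c : W → W → Ser W ℂ) where
  antisymm z w := by exact div_sub_comm_neg (F := Ser W ℂ) _ _ _
  three_term {z w u} h1 h2 h3 := by
    have h1 := param_sub_ne_zero h1
    have h2 := param_sub_ne_zero h2
    have h3 := param_sub_ne_zero h3
    simp only [g]
    field_simp
    ring

theorem atInv_X {R : Type*} [Ring R] (w : W) :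
    atInv w (PowerSeries.X : PowerSeries R) = HahnSeries.single (expo w 1) 1 := by
  ext a
  by_cases h : ∃ n, expo w n = a
  · obtain ⟨n, rfl⟩ := h
    rw [atInv_coeff, PowerSeries.coeff_X, HahnSeries.coeff_single]
    simp only [(expo_strictMono w).injective.eq_iff]
  · push Not at h
    rw [atInv_coeff_of_notMem w _ h, HahnSeries.coeff_single_of_ne (h 1).symm]

theorem atInv_C {R : Type*} [Ring R] (w : W) (r : R) :
    atInv w (PowerSeries.C r) = HahnSeries.C r := by
  ext a
  by_cases h : ∃ n, expo w n = a
  · obtain ⟨n, rfl⟩ := h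
    rw [atInv_coeff, PowerSeries.coeff_C, HahnSeries.C_apply, HahnSeries.coeff_single]
    simp only [map_eq_zero_iff _ (expo_strictMono w).injective]
  · push Not at h
    rw [atInv_coeff_of_notMem w _ h, HahnSeries.C_apply,
      HahnSeries.coeff_single_of_ne fun e => h 0 (by simp [e])]

/-- Multiplication by `w` shifts the modes by one, except that the constant term leaves the power
series. This converts the index shifts in the defining relations into factors `z` and `w`. -/
theorem param_mul_atInv {B : Type*} [Ring B] [Algebra ℂ B] (w : W) (F : PowerSeries B) :
    scalarHom W B (param w) * atInv w F
      = atInv w (PowerSeries.mk fun n => PowerSeries.coeff (n + 1) F)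
        + scalarHom W B (param w) * HahnSeries.C (PowerSeries.coeff 0 F) := by
  conv_lhs => rw [PowerSeries.eq_X_mul_shift_add_const F]
  rw [map_add, map_mul, mul_add, ← mul_assoc, atInv_X, atInv_C,
    PowerSeries.coeff_zero_eq_constantCoeff]
  congr 1
  have : scalarHom W B (param w) = HahnSeries.single (toLex (Pi.single w (-1))) 1 := by
    ext a
    rw [coeff_scalarHom, param]
    by_cases h : a = toLex (Pi.single w (-1))
    · simp [h]
    · simp [HahnSeries.coeff_single_of_ne h]
  rw [this, HahnSeries.single_mul_single]
  have h0 : toLex (Pi.single w (-1)) + expo w 1 = 0 := by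
    change toLex (Pi.single w (-1 : ℤ) + Pi.single w ((1 : ℕ) : ℤ) : W → ℤ) = toLex 0
    rw [← Pi.single_add]; simp
  rw [h0, one_mul]
  exact one_mul _

end Kernel

/-! ### The RTT relation for the generating series -/

section YangianSeries

variable {W : Type*} [LinearOrder W] [Finite W] (par : Fin 3 → ZMod 2)

noncomputable instance yangianSeriesAlgebra : Algebra (Ser W ℂ) (Ser W (Yangian par)) :=
  RingHom.toAlgebra' (scalarHom W (Yangian par)) scalarHom_comm

theorem algebraMap_eq_scalar (k : Ser W ℂ) :
    algebraMap (Ser W ℂ) (Ser W (Yangian par)) k = scalar par k := rfl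

theorem mode_zero (i j : Fin 3) : mode par i j 0 = if i = j then 1 else 0 := by
  by_cases h : i = j <;> simp [mode, freeMode, h]

theorem modes_rtt (c : ℂ) {z w : W} (hzw : z ≠ w) (i j k l : Fin 3) :
    (atInv z (PowerSeries.mk fun r => c ^ (r + 1) • mode par i j (r + 1)) * T par c w k l
        - sgn ((par i + par j) * (par k + par l)) • (T par c w k l *
          atInv z (PowerSeries.mk fun r => c ^ (r + 1) • mode par i j (r + 1))))
      - (T par c z i j * atInv w (PowerSeries.mk fun r => c ^ (r + 1) • mode par k l (r + 1))
        - sgn ((par i + par j) * (par k + par l)) •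
          (atInv w (PowerSeries.mk fun r => c ^ (r + 1) • mode par k l (r + 1)) * T par c z i j))
      = sgn (par l * (par i + par j) + par i * par j) •
        (c • (T par c z i l * T par c w k j - T par c w i l * T par c z k j)) := by
  ext a
  simp only [T, HahnSeries.coeff_sub, HahnSeries.coeff_smul]
  by_cases h : ∃ r s, expo z r + expo w s = a
  · obtain ⟨r, s, rfl⟩ := h
    have e (F G : PowerSeries (Yangian par)) :
        (atInv w G * atInv z F).coeff (expo z r + expo w s)
          = PowerSeries.coeff s G * PowerSeries.coeff r F := by
      rw [add_comm, atInv_mul_coeff hzw.symm]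
    simp only [e, atInv_mul_coeff hzw, PowerSeries.coeff_mk, smul_mul_smul_comm]
    have h := congrArg (fun x => (c ^ (r + s + 1)) • x) (mode_rel par i j k l r s)
    linear_combination (norm := module) h
  · push Not at h
    have h' : ∀ s r, expo w s + expo z r ≠ a := fun s r => by rw [add_comm]; exact h r s
    simp only [atInv_mul_coeff_of_ne _ _ h, atInv_mul_coeff_of_ne _ _ h', smul_zero, sub_zero]

/-- In `modes_rtt` the shifted series are z T(z) and w T(w) up to constant terms. The constants
supercommute with everything and drop out, which leaves (z - w) times the graded commutator; z - w
is invertible. -/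
theorem rttRel_T (c : ℂ) : RTTRel par (g c : W → W → Ser W ℂ) (T par c) := by
  intro z w hzw i j k l
  have hzw' := param_sub_ne_zero hzw
  have h1 := param_mul_atInv z (PowerSeries.mk fun r => c ^ r • mode par i j r)
  have h2 := param_mul_atInv w (PowerSeries.mk fun r => c ^ r • mode par k l r)
  simp only [PowerSeries.coeff_mk, pow_zero, one_smul] at h1 h2
  change _ * T par c z i j = _ at h1
  change _ * T par c w k l = _ at h2
  have h := modes_rtt par c hzw i j k l
  rw [← sub_eq_iff_eq_add] at h1 h2
  rw [← h1, ← h2] at h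
  clear h1 h2
  have hs (k : Ser W ℂ) (x : Ser W (Yangian par)) : scalarHom W (Yangian par) k * x = k • x := rfl
  -- The constant term is 0 for `i ≠ j`, and for `i = j` it is 1 and the sign is trivial.
  have hδ (i j k l : Fin 3) (w : W) :
      HahnSeries.C (mode par i j 0) * T par c w k l
        = sgn ((par i + par j) * (par k + par l)) •
          (T par c w k l * HahnSeries.C (mode par i j 0)) := by
    rw [mode_zero]
    by_cases e : i = j
    · simp [e, CharTwo.add_self_eq_zero, sgn]
    · simp [e]
  have hc (x : Ser W (Yangian par)) : c • x = (HahnSeries.C c : Ser W ℂ) • x := by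
    rw [← hs]
    have : scalarHom W (Yangian par) (HahnSeries.C c) = HahnSeries.C (algebraMap ℂ _ c) :=
      HahnSeries.map_C c (algebraMap ℂ (Yangian par))
    rw [this, HahnSeries.C_mul_eq_smul]
    ext a
    simp
  have h3 := hδ i j k l w
  have h4 := hδ k l i j z
  rw [mul_comm (par k + par l)] at h4
  have hss := sgn_mul_self ((par i + par j) * (par k + par l))
  rw [hc] at h
  simp only [hs, mul_sub, sub_mul, smul_mul_assoc, mul_smul_comm, h3, h4] at h
  have h5 : (param z - param w) • (T par c z i j * T par c w k l
      - sgn ((par i + par j) * (par k + par l)) • (T par c w k l * T par c z i j))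
      = sgn (par l * (par i + par j) + par i * par j) • (HahnSeries.C c : Ser W ℂ) •
        (T par c z i l * T par c w k j - T par c w i l * T par c z k j) := by
    rcases sgn_cases ((par i + par j) * (par k + par l)) with ⟨-, e⟩ | ⟨-, e⟩ <;>
    rw [e] at h ⊢ <;>
    linear_combination (norm := module) h
  rw [← inv_smul_smul₀ hzw' (_ - _ : Ser W (Yangian par)), h5, smul_comm _ (sgn _)]
  refine congrArg _ ((smul_smul (param z - param w)⁻¹ (HahnSeries.C c)
    (_ : Ser W (Yangian par))).trans ?_)
  rw [g, div_eq_inv_mul]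

end YangianSeries


/-! ### Sums over one removed parameter -/

section SplitSum

variable {W M : Type*} [AddCommGroup M]

theorem sum_eraseIdx_eq_splitSum (l : List W) (Q : W → List W → M) :
    ∑ j : Fin l.length, Q (l.get j) (l.eraseIdx j) = splitSum l fun p w s => Q w (p ++ s) := by
  induction l generalizing Q with
  | nil => simp [splitSum]
  | cons x l ih =>
    have := ih fun w s => Q w (x :: s)
    simp only [splitSum, List.cons_append, ← this]
    exact Fin.sum_univ_succ _

theorem splitSum_append_singleton (l : List W) (x : W) (F : List W → W → List W → M) :
    splitSum (l ++ [x]) F = splitSum l (fun p w s => F p w (s ++ [x])) + F l x [] := by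
  induction l generalizing F with
  | nil => simp [splitSum]
  | cons y l ih => rw [List.cons_append, splitSum, ih, splitSum, add_assoc]

theorem splitSum_reverse (l : List W) (F : List W → W → List W → M) :
    splitSum l.reverse F = splitSum l fun p w s => F s.reverse w p.reverse := by
  induction l generalizing F with
  | nil => rfl
  | cons x l ih =>
    rw [List.reverse_cons, splitSum_append_singleton, ih, splitSum, add_comm]
    simp

/-- Dual vectors are built from reversed sets, whereas the sums of the theorem run over the sets in
their given order. -/
theorem sum_eraseIdx_eq_splitSum_reverse (l : List W) (Q : W → List W → M) :
    ∑ j : Fin l.length, Q (l.get j) (l.eraseIdx j)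
      = splitSum l.reverse fun p w s => Q w (p ++ s).reverse := by
  rw [sum_eraseIdx_eq_splitSum, splitSum_reverse]
  simp

theorem neg_splitSum (l : List W) (F : List W → W → List W → M) :
    -splitSum l F = splitSum l fun p w s => -F p w s :=
  map_splitSum (negAddMonoidHom : M →+ M) l F

theorem smul_splitSum {R : Type*} [Monoid R] [DistribMulAction R M] (k : R) (l : List W)
    (F : List W → W → List W → M) : k • splitSum l F = splitSum l fun p w s => k • F p w s :=
  map_splitSum (DistribSMul.toAddMonoidHom M k) l F

end SplitSum

theorem sgn_natCast (n : ℕ) : sgn n = (-1) ^ n := by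
  induction n with
  | zero => rfl
  | succ n ih => rw [Nat.cast_succ, sgn_add, ih, pow_succ]; rfl

/-! ### Transposition of nested vectors -/

section Transposition

variable {W S N K : Type*} [Field K] [AddCommGroup S] [Module K S] [AddCommGroup N] [Module K N]

/-- A map `τ` to a space with operators `r_ij` (a right representation) that exchanges `t_ij` and
`± r_ji` on vectors of a given parity. -/
structure Transposition (par : Fin 3 → ZMod 2) (t : Fin 3 → Fin 3 → W → Module.End K S) (ω : S)
    (E : ZMod 2 → Submodule K S) (τ : S →ₗ[K] N) (r : Fin 3 → Fin 3 → W → Module.End K N) :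
    Prop where
  vac : ω ∈ E 0
  mem {d : ZMod 2} {s : S} (hs : s ∈ E d) (i j : Fin 3) (w : W) : t i j w s ∈ E (par i + par j + d)
  map {d : ZMod 2} {s : S} (hs : s ∈ E d) (i j : Fin 3) (w : W) :
    τ (t i j w s)
      = ((sgn ((par i + par j) * d) * sgn (par i * par j + par i) : ℤ) : K) • r j i w (τ s)

theorem splitSum_mem {E : Submodule K S} (vs : List W) (F : List W → W → List W → S)
    (h : ∀ p w s, vs = p ++ w :: s → F p w s ∈ E) : splitSum vs F ∈ E := by
  induction vs generalizing F with
  | nil => exact zero_mem _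
  | cons v vs ih =>
    exact add_mem (h [] v vs rfl) (ih _ fun p w s e => h (v :: p) w s (by rw [e]; rfl))

variable {par : Fin 3 → ZMod 2} {g : W → W → K} {t : Fin 3 → Fin 3 → W → Module.End K S} {ω : S}
  {E : ZMod 2 → Submodule K S} {τ : S →ₗ[K] N} {r : Fin 3 → Fin 3 → W → Module.End K N}

theorem Transposition.signedOp_mem (hT : Transposition par t ω E τ r) {d e : ZMod 2} {s : S}
    (hs : s ∈ E d) (i j : Fin 3) (w : W) (he : par i + par j + d = e) :
    signedOp par t i j w s ∈ E e :=
  he ▸ (E _).smul_mem _ (hT.mem hs i j w)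

variable [CharZero K] {Λ : W → K}

/-- Every u contributes the parity of T_12 and every v that of T_23. A factor T_13 uses up one u and
one v and has the sum of both parities, so all terms of the recursion agree. -/
theorem Transposition.offShell_mem (hT : Transposition par t ω E τ r) (hg : IsKernel g)
    (hp0 : par 0 = 0) (hp2 : par 2 = 1) (hR : RTTOp par g t) (hΛ : ∀ z, t 1 1 z ω = Λ z • ω)
    (us vs : List W) (hnd : (us ++ vs).Nodup) :
    offShell par g t ω us vs ∈ E (us.length * par 1 + vs.length * (par 1 + 1)) := by
  induction us generalizing vs with
  | nil =>
    rw [offShell, nested_nil]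
    clear hnd
    induction vs with
    | nil => simpa [chain] using hT.vac
    | cons v vs ih =>
      refine hT.signedOp_mem ih _ _ _ ?_
      rw [hp2]; push_cast [List.length_cons]; ring
  | cons u us ih =>
    rw [hR.offShell_cons_left hg hp2 hΛ hnd]
    have hnd' : (us ++ vs).Nodup := hnd.of_cons
    refine add_mem (hT.signedOp_mem (ih vs hnd') _ _ _ ?_)
      (hT.signedOp_mem (splitSum_mem (E := E (us.length * par 1 + (vs.length - 1) * (par 1 + 1)))
        _ _ fun p w s e => Submodule.smul_mem _ _ ?_) _ _ _ ?_)
    · rw [hp0]; push_cast [List.length_cons]; ring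
    · convert ih (p ++ s) (hnd'.sublist (by simp [e])) using 4
      simp [e]
      ring
    · rw [hp0, hp2]; push_cast [List.length_cons]
      have : par 1 + par 1 = 0 := CharTwo.add_self_eq_zero _
      linear_combination (-1 : ZMod 2) * this

/-- The image of the left recursion under `τ`; the parity of the smaller vector fixes the signs. The
minus sign of the sum comes from `signedOp` at T_13, an odd entry with odd column. -/
theorem Transposition.dual_cons_left (hT : Transposition par t ω E τ r) (hg : IsKernel g)
    (hp0 : par 0 = 0) (hp2 : par 2 = 1) (hR : RTTOp par g t) (hΛ : ∀ z, t 1 1 z ω = Λ z • ω)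
    {u : W} {us vs : List W} (hnd : (u :: us ++ vs).Nodup) :
    τ (offShell par g t ω (u :: us) vs)
      = (sgn ((us.length + 1) * par 1) : K) • r 1 0 u (τ (offShell par g t ω us vs))
      - splitSum vs fun p w s =>
        ((sgn (us.length * par 1 + (p ++ s).length * (par 1 + 1)) : K) *
        (Λ w * (us.map fun x => 1 + (sgn (par 1) : K) * g w x).prod * ((sgn (par 1) : K) * g w u)
          * (p.map fun i => -(sgn (par 1) : K) + (sgn (par 1) : K) * g i w).prod
          * (s.map fun i => 1 + (sgn (par 1) : K) * g i w).prod))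
          • r 2 0 u (τ (offShell par g t ω us (p ++ s))) := by
  have hnd' : (us ++ vs).Nodup := hnd.of_cons
  rw [hR.offShell_cons_left hg hp2 hΛ hnd, map_add, sub_eq_add_neg]
  congr 1
  · rw [signedOp, LinearMap.smul_apply, map_smul,
      hT.map (hT.offShell_mem hg hp0 hp2 hR hΛ us vs hnd'), smul_smul]
    congr 1
    rw [hp0, ← Int.cast_mul]
    congr 1
    -- The number of parameters v̄ disappears from the sign because [2]([2] + 1) = 0.
    generalize par 1 = x
    generalize (us.length : ZMod 2) = y
    generalize (vs.length : ZMod 2) = z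
    revert x y z; decide
  · rw [map_splitSum, map_splitSum, neg_splitSum]
    refine splitSum_congr _ fun p w s e => ?_
    rw [map_smul, map_smul, signedOp, LinearMap.smul_apply, map_smul,
      hT.map (hT.offShell_mem hg hp0 hp2 hR hΛ us (p ++ s) (hnd'.sublist (by simp [e])))]
    simp only [hp0, hp2, smul_smul, ← neg_smul]
    congr 1
    generalize Λ w * _ * _ * _ * _ = C
    generalize (us.length * par 1 + (p ++ s).length * (par 1 + 1) : ZMod 2) = x
    rcases sgn_cases x with ⟨rfl, -⟩ | ⟨rfl, -⟩ <;> simp [sgn]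

theorem Transposition.dual_cons_right (hT : Transposition par t ω E τ r) (hg : IsKernel g)
    (hp0 : par 0 = 0) (hp2 : par 2 = 1) (hR : RTTOp par g t) (hΛ : ∀ z, t 1 1 z ω = Λ z • ω)
    {v : W} {us vs : List W} (hnd : (us ++ v :: vs).Nodup) :
    τ (offShell par g t ω us (v :: vs))
      = (sgn ((vs.length + 1) * (par 1 + 1)) : K) • r 2 1 v (τ (offShell par g t ω us vs))
      - splitSum us fun p w s =>
        ((sgn ((p ++ s).length * par 1 + vs.length * (par 1 + 1)) : K) *
        (Λ w * (vs.map fun x => 1 + -(sgn (par 1) : K) * g w x).prod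
          * (-(sgn (par 1) : K) * g w v)
          * (p.map fun i => (sgn (par 1) : K) + -(sgn (par 1) : K) * g i w).prod
          * (s.map fun i => 1 + -(sgn (par 1) : K) * g i w).prod))
          • r 2 0 v (τ (offShell par g t ω (p ++ s) vs)) := by
  have hnd' : (us ++ vs).Nodup := hnd.sublist (by simp)
  rw [hR.offShell_cons_right hg hp0 hp2 hΛ hnd, map_add, sub_eq_add_neg]
  congr 1
  · rw [signedOp, LinearMap.smul_apply, map_smul,
      hT.map (hT.offShell_mem hg hp0 hp2 hR hΛ us vs hnd'), smul_smul]
    congr 1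
    rw [hp2, ← Int.cast_mul]
    congr 1
    generalize par 1 = x
    generalize (us.length : ZMod 2) = y
    generalize (vs.length : ZMod 2) = z
    revert x y z; decide
  · rw [map_splitSum, map_splitSum, neg_splitSum]
    refine splitSum_congr _ fun p w s e => ?_
    rw [map_smul, map_smul, signedOp, LinearMap.smul_apply, map_smul,
      hT.map (hT.offShell_mem hg hp0 hp2 hR hΛ (p ++ s) vs (hnd'.sublist (by simp [e])))]
    simp only [hp0, hp2, smul_smul, ← neg_smul]
    congr 1
    generalize Λ w * _ * _ * _ * _ = C
    generalize ((p ++ s).length * par 1 + vs.length * (par 1 + 1) : ZMod 2) = x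
    rcases sgn_cases x with ⟨rfl, -⟩ | ⟨rfl, -⟩ <;> simp [sgn]

end Transposition


/-! ### Normalization and the four abstract recursions -/

section Normalization

variable {W S N K : Type*} [Field K]

/-- The product `∏_{k < j} h(w_j, w_k)`. -/
def pairProd (h : W → W → K) : List W → K
  | [] => 1
  | v :: vs => (vs.map fun v' => h v' v).prod * pairProd h vs

theorem pairProd_append_cons (h : W → W → K) (p : List W) (w : W) (s : List W) :
    pairProd h (p ++ w :: s)
      = (p.map fun i => h w i).prod * (s.map fun i => h i w).prod * pairProd h (p ++ s) := by
  induction p with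
  | nil => simp [pairProd]
  | cons v p ih =>
    simp only [List.cons_append, pairProd, ih, List.map_append, List.map_cons, List.prod_append,
      List.prod_cons]
    ring

/-- The function `h = f / g` for the kernel `g`. -/
structure IsRatio (g h : W → W → K) : Prop where
  mul {a b : W} : a ≠ b → g a b * h a b = 1 + g a b
  ne_zero {a b : W} : a ≠ b → h a b ≠ 0

variable {g h : W → W → K}

theorem IsRatio.prod_ne_zero (hh : IsRatio g h) {w : W} {l : List W} (hw : w ∉ l) :
    (l.map fun i => h i w).prod ≠ 0 := by
  rw [Ne, List.prod_eq_zero_iff, List.mem_map]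
  rintro ⟨i, hi, e⟩
  exact hh.ne_zero (fun e' => hw (by rwa [← e'])) e

theorem IsRatio.pairProd_ne_zero (hh : IsRatio g h) {l : List W} (hl : l.Nodup) :
    pairProd h l ≠ 0 := by
  induction l with
  | nil => exact one_ne_zero
  | cons w l ih =>
    obtain ⟨hw, hl⟩ := List.nodup_cons.1 hl
    exact mul_ne_zero (hh.prod_ne_zero hw) (ih hl)

/-- Since 1 + g(i,w) = g(i,w) h(i,w) and, by antisymmetry, -1 + g(i,w) = g(i,w) h(w,i), the
h-factors are precisely those by which the two pair products differ. -/
theorem IsRatio.prod_div_pairProd (hg : IsKernel g) (hh : IsRatio g h) {p s : List W} {w : W}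
    (hnd : (p ++ w :: s).Nodup) :
    (p.map fun i => -1 + g i w).prod * (s.map fun i => 1 + g i w).prod / pairProd h (p ++ w :: s)
      = ((p ++ s).map fun i => g i w).prod / pairProd h (p ++ s) := by
  obtain ⟨h1, h2, h3⟩ := List.nodup_append'.1 hnd
  obtain ⟨h4, h5⟩ := List.nodup_cons.1 h2
  have e1 : p.map (fun i => -1 + g i w) = p.map fun i => g i w * h w i :=
    List.map_congr_left fun i hi => by
      have : i ≠ w := fun e => h3 hi (e ▸ List.mem_cons_self)
      have := hh.mul this.symm
      rw [hg.antisymm] at this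
      linear_combination this
  have e2 : s.map (fun i => 1 + g i w) = s.map fun i => g i w * h i w :=
    List.map_congr_left fun i hi => (hh.mul (by rintro rfl; exact h4 hi)).symm
  rw [div_eq_div_iff (hh.pairProd_ne_zero hnd)
    (hh.pairProd_ne_zero (hnd.sublist (by simp))), pairProd_append_cons, e1, e2,
    List.prod_map_mul, List.prod_map_mul, List.map_append, List.prod_append]
  ring

variable [AddCommGroup S] [Module K S] [AddCommGroup N] [Module K N] [CharZero K]
  {par : Fin 3 → ZMod 2} {t : Fin 3 → Fin 3 → W → Module.End K S} {ω : S}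
  {E : ZMod 2 → Submodule K S} {τ : S →ₗ[K] N} {r : Fin 3 → Fin 3 → W → Module.End K N}
  {Λ : W → K} {X : List W → List W → N}

/-- The sum runs over the fermionic set v̄, so its factors combine with the normalization through
`IsRatio.prod_div_pairProd`. -/
theorem Transposition.recursion_left_of_even (hT : Transposition par t ω E τ r) (hg : IsKernel g)
    (hh : IsRatio g h) (hp0 : par 0 = 0) (hp1 : par 1 = 0) (hp2 : par 2 = 1) (hR : RTTOp par g t)
    (hΛ : ∀ z, t 1 1 z ω = Λ z • ω)
    (hX : ∀ us vs, X us vs = ((-1) ^ vs.length / pairProd h vs.reverse) •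
      τ (offShell par g t ω us.reverse vs.reverse))
    {us vs : List W} {x : W} (hnd : (us ++ [x] ++ vs).Nodup) :
    X (us ++ [x]) vs = r 1 0 x (X us vs) + (-1 : ℤ) ^ (vs.length - 1) • ∑ j : Fin vs.length,
      (Λ (vs.get j) * g (vs.get j) x * (us.map fun u => 1 + g (vs.get j) u).prod
        * ((vs.eraseIdx j).map fun v => g v (vs.get j)).prod)
        • r 2 0 x (X us (vs.eraseIdx j)) := by
  have hnd' : (x :: us.reverse ++ vs.reverse).Nodup := by
    refine (List.Perm.nodup_iff ?_).1 hnd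
    rw [← List.reverse_concat]
    exact ((List.reverse_perm _).append (List.reverse_perm _)).symm.trans (by simp)
  rw [sum_eraseIdx_eq_splitSum_reverse vs fun w l => (Λ w * g w x *
      (us.map fun u => 1 + g w u).prod * (l.map fun v => g v w).prod) • r 2 0 x (X us l),
    smul_splitSum, hX, List.reverse_append, List.reverse_singleton, List.singleton_append,
    hT.dual_cons_left hg hp0 hp2 hR hΛ hnd', smul_sub, smul_splitSum, sub_eq_add_neg, neg_splitSum]
  congr 1
  · rw [hX, map_smul, hp1, smul_smul]; simp [sgn]
  · refine splitSum_congr _ fun p w s e => ?_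
    have hvs : vs.length = (p ++ s).length + 1 := by
      rw [← List.length_reverse, e]; simp; omega
    have key := hh.prod_div_pairProd hg (p := p) (s := s) (w := w)
      (e ▸ (List.nodup_append'.1 hnd').2.1)
    have hsgn : ((sgn ((p ++ s).length : ZMod 2) : ℤ) : K) = (-1) ^ (p ++ s).length := by
      rw [sgn_natCast]; push_cast; rfl
    rw [hX, List.reverse_reverse, map_smul, ← Int.cast_smul_eq_zsmul K, smul_smul, smul_smul,
      smul_smul, ← neg_smul, hvs, e, hp1]
    congr 1
    simp only [mul_zero, zero_add, mul_one, hsgn, show sgn 0 = 1 from rfl, Int.cast_one, one_mul,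
      Nat.add_sub_cancel, List.length_reverse, List.map_reverse, List.prod_reverse]
    push_cast
    linear_combination ((-1) ^ (p ++ s).length * (-1) ^ (p ++ s).length * Λ w * g w x *
      (us.map fun u => 1 + g w u).prod) * key

/-- The sum runs over the bosonic set ū, where all factors already have the form 1 + g. The
normalization changes only by the factors of H that contain `y`. -/
theorem Transposition.recursion_right_of_even (hT : Transposition par t ω E τ r) (hg : IsKernel g)
    (hp0 : par 0 = 0) (hp1 : par 1 = 0) (hp2 : par 2 = 1) (hR : RTTOp par g t)
    (hΛ : ∀ z, t 1 1 z ω = Λ z • ω)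
    (hX : ∀ us vs, X us vs = ((-1) ^ vs.length / pairProd h vs.reverse) •
      τ (offShell par g t ω us.reverse vs.reverse))
    {us vs : List W} {y : W} (hnd : (us ++ (vs ++ [y])).Nodup) :
    X us (vs ++ [y]) = (-1 : ℤ) ^ vs.length • (vs.map fun v => h v y).prod⁻¹ •
        r 2 1 y (X us vs)
      + (-1 : ℤ) ^ vs.length • (vs.map fun v => h v y).prod⁻¹ • ∑ j : Fin us.length,
        (Λ (us.get j) * g y (us.get j) * (vs.map fun v => 1 + g v (us.get j)).prod
          * ((us.eraseIdx j).map fun u => 1 + g (us.get j) u).prod)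
          • r 2 0 y (X (us.eraseIdx j) vs) := by
  have hnd' : (us.reverse ++ y :: vs.reverse).Nodup := by
    refine (List.Perm.nodup_iff ?_).1 hnd
    rw [← List.reverse_concat]
    exact ((List.reverse_perm _).append (List.reverse_perm _)).symm.trans (by simp)
  have hH : pairProd h (y :: vs.reverse)
      = (vs.map fun v => h v y).prod * pairProd h vs.reverse := by
    rw [pairProd, List.map_reverse, List.prod_reverse]
  rw [sum_eraseIdx_eq_splitSum_reverse us fun w l => (Λ w * g y w *
      (vs.map fun v => 1 + g v w).prod * (l.map fun u => 1 + g w u).prod) • r 2 0 y (X l vs),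
    smul_splitSum, smul_splitSum, hX, List.reverse_append, List.reverse_singleton,
    List.singleton_append,
    hT.dual_cons_right hg hp0 hp2 hR hΛ hnd', smul_sub, smul_splitSum, sub_eq_add_neg,
    neg_splitSum, hH]
  have hsgn : ((sgn (vs.length : ZMod 2) : ℤ) : K) = (-1) ^ vs.length := by
    rw [sgn_natCast]; push_cast; rfl
  have hsgn' : ((sgn (vs.length + 1 : ZMod 2) : ℤ) : K) = -(-1) ^ vs.length := by
    rw [sgn_add]; push_cast; rw [hsgn, show sgn 1 = -1 from rfl]; simp
  congr 1
  · rw [hX, map_smul, hp1, ← Int.cast_smul_eq_zsmul K, smul_smul, smul_smul, smul_smul]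
    congr 1
    simp only [zero_add, mul_one, List.length_reverse, hsgn', List.length_append,
      List.length_singleton]
    push_cast
    rw [pow_succ, div_eq_mul_inv, div_eq_mul_inv, mul_inv]
    ring
  · refine splitSum_congr _ fun p w s e => ?_
    rw [hX, List.reverse_reverse, map_smul, ← Int.cast_smul_eq_zsmul K, smul_smul, smul_smul,
      smul_smul, smul_smul, ← neg_smul, hp1]
    congr 1
    have e1 (l : List W) : (l.map fun i => 1 + -1 * g i w) = l.map fun i => 1 + g w i :=
      List.map_congr_left fun i _ => by rw [hg.antisymm w i]; ring
    have e2 : (vs.map fun i => 1 + -1 * g w i) = vs.map fun i => 1 + g i w :=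
      List.map_congr_left fun i _ => by rw [hg.antisymm i w]; ring
    simp only [mul_zero, zero_add, mul_one, hsgn, show sgn 0 = 1 from rfl, Int.cast_one,
      List.length_reverse, List.map_reverse, List.prod_reverse, List.length_append,
      List.length_singleton, List.map_append, List.prod_append, e1, e2, hg.antisymm y w]
    push_cast
    rw [pow_succ, div_eq_mul_inv, div_eq_mul_inv, mul_inv]
    ring

/-- Now ū is fermionic and the roles of the two sets are interchanged. In `hX` the sign joins (-1)^a
from the normalization and (-1)^b from the super-trace. -/
theorem Transposition.recursion_left_of_odd (hT : Transposition par t ω E τ r) (hg : IsKernel g)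
    (hp0 : par 0 = 0) (hp1 : par 1 = 1) (hp2 : par 2 = 1) (hR : RTTOp par g t)
    (hΛ : ∀ z, t 1 1 z ω = Λ z • ω)
    (hX : ∀ us vs, X us vs = ((-1) ^ (us.length + vs.length) / pairProd h us.reverse) •
      τ (offShell par g t ω us.reverse vs.reverse))
    {us vs : List W} {x : W} (hnd : (us ++ [x] ++ vs).Nodup) :
    X (us ++ [x]) vs = (-1 : ℤ) ^ us.length • (us.map fun u => h u x).prod⁻¹ •
        r 1 0 x (X us vs)
      - (-1 : ℤ) ^ us.length • (us.map fun u => h u x).prod⁻¹ • ∑ j : Fin vs.length,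
        (Λ (vs.get j) * g x (vs.get j) * (us.map fun u => 1 + g u (vs.get j)).prod
          * ((vs.eraseIdx j).map fun v => 1 + g (vs.get j) v).prod)
          • r 2 0 x (X us (vs.eraseIdx j)) := by
  have hnd' : (x :: us.reverse ++ vs.reverse).Nodup := by
    refine (List.Perm.nodup_iff ?_).1 hnd
    rw [← List.reverse_concat]
    exact ((List.reverse_perm _).append (List.reverse_perm _)).symm.trans (by simp)
  have hH : pairProd h (x :: us.reverse)
      = (us.map fun u => h u x).prod * pairProd h us.reverse := by
    rw [pairProd, List.map_reverse, List.prod_reverse]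
  rw [sum_eraseIdx_eq_splitSum_reverse vs fun w l => (Λ w * g x w *
      (us.map fun u => 1 + g u w).prod * (l.map fun v => 1 + g w v).prod) • r 2 0 x (X us l),
    smul_splitSum, smul_splitSum, hX, List.reverse_append, List.reverse_singleton,
    List.singleton_append,
    hT.dual_cons_left hg hp0 hp2 hR hΛ hnd', smul_sub, smul_splitSum, hH]
  have hsgn : ((sgn (us.length : ZMod 2) : ℤ) : K) = (-1) ^ us.length := by
    rw [sgn_natCast]; push_cast; rfl
  have hsgn' : ((sgn (us.length + 1 : ZMod 2) : ℤ) : K) = -(-1) ^ us.length := by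
    rw [sgn_add]; push_cast; rw [hsgn, show sgn 1 = -1 from rfl]; simp
  congr 1
  · rw [hX, map_smul, hp1, ← Int.cast_smul_eq_zsmul K, smul_smul, smul_smul, smul_smul]
    congr 1
    simp only [mul_one, List.length_reverse, hsgn', List.length_append,
      List.length_singleton]
    push_cast
    rw [pow_add, pow_succ, pow_add, div_eq_mul_inv, div_eq_mul_inv, mul_inv]
    ring
  · refine splitSum_congr _ fun p w s e => ?_
    have hvs : vs.length = (p ++ s).length + 1 := by
      rw [← List.length_reverse, e]; simp; omega
    rw [hX, List.reverse_reverse, map_smul, ← Int.cast_smul_eq_zsmul K, smul_smul, smul_smul,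
      smul_smul, smul_smul, hp1, hvs]
    congr 1
    have e1 (l : List W) : (l.map fun i => 1 + -1 * g i w) = l.map fun i => 1 + g w i :=
      List.map_congr_left fun i _ => by rw [hg.antisymm w i]; ring
    have e2 : (us.map fun i => 1 + -1 * g w i) = us.map fun i => 1 + g i w :=
      List.map_congr_left fun i _ => by rw [hg.antisymm i w]; ring
    simp only [mul_zero, add_zero, mul_one, hsgn, show sgn 1 = -1 from rfl, Int.cast_neg,
      Int.cast_one, CharTwo.add_self_eq_zero, neg_neg,
      List.length_reverse, List.map_reverse, List.prod_reverse, List.length_append,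
      List.length_singleton, List.map_append, List.prod_append, e1, e2, hg.antisymm x w]
    push_cast
    simp only [pow_add, div_eq_mul_inv, mul_inv]
    ring

/-- The sum over the fermionic set ū is treated as the sum over v̄ in
`Transposition.recursion_left_of_even`. -/
theorem Transposition.recursion_right_of_odd (hT : Transposition par t ω E τ r) (hg : IsKernel g)
    (hh : IsRatio g h) (hp0 : par 0 = 0) (hp1 : par 1 = 1) (hp2 : par 2 = 1) (hR : RTTOp par g t)
    (hΛ : ∀ z, t 1 1 z ω = Λ z • ω)
    (hX : ∀ us vs, X us vs = ((-1) ^ (us.length + vs.length) / pairProd h us.reverse) •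
      τ (offShell par g t ω us.reverse vs.reverse))
    {us vs : List W} {y : W} (hnd : (us ++ (vs ++ [y])).Nodup) :
    X us (vs ++ [y]) = -r 2 1 y (X us vs) - (-1 : ℤ) ^ (us.length - 1) • ∑ j : Fin us.length,
      (Λ (us.get j) * g (us.get j) y * (vs.map fun v => 1 + g (us.get j) v).prod
        * ((us.eraseIdx j).map fun u => g u (us.get j)).prod)
        • r 2 0 y (X (us.eraseIdx j) vs) := by
  have hnd' : (us.reverse ++ y :: vs.reverse).Nodup := by
    refine (List.Perm.nodup_iff ?_).1 hnd
    rw [← List.reverse_concat]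
    exact ((List.reverse_perm _).append (List.reverse_perm _)).symm.trans (by simp)
  rw [sum_eraseIdx_eq_splitSum_reverse us fun w l => (Λ w * g w y *
      (vs.map fun v => 1 + g w v).prod * (l.map fun u => g u w).prod) • r 2 0 y (X l vs),
    smul_splitSum, hX, List.reverse_append, List.reverse_singleton, List.singleton_append,
    hT.dual_cons_right hg hp0 hp2 hR hΛ hnd', smul_sub, smul_splitSum]
  congr 1
  · rw [hX, map_smul, hp1, smul_smul, ← neg_smul]
    congr 1
    simp only [CharTwo.add_self_eq_zero, mul_zero, show sgn 0 = 1 from rfl, Int.cast_one, mul_one,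
      List.length_append, List.length_singleton]
    ring
  · refine splitSum_congr _ fun p w s e => ?_
    have hus : us.length = (p ++ s).length + 1 := by
      rw [← List.length_reverse, e]; simp; omega
    have key := hh.prod_div_pairProd hg (p := p) (s := s) (w := w)
      (e ▸ (List.nodup_append'.1 hnd').1)
    have hsgn : ((sgn ((p ++ s).length : ZMod 2) : ℤ) : K) = (-1) ^ (p ++ s).length := by
      rw [sgn_natCast]; push_cast; rfl
    rw [hX, List.reverse_reverse, map_smul, ← Int.cast_smul_eq_zsmul K, smul_smul, smul_smul,
      smul_smul, hus, e, hp1]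
    congr 1
    simp only [CharTwo.add_self_eq_zero, mul_zero, add_zero, mul_one, hsgn,
      show sgn 1 = -1 from rfl, Int.cast_neg, Int.cast_one, one_mul, neg_neg,
      Nat.add_sub_cancel, List.length_reverse, List.map_reverse, List.prod_reverse]
    have hl : (vs ++ [y]).length = vs.length + 1 := by simp
    rw [hl]
    push_cast
    linear_combination ((-1) ^ (p ++ s).length * (-1) ^ (p ++ s).length * (-1) ^ vs.length * Λ w *
      g w y * (vs.map fun v => 1 + g w v).prod) * key

end Normalization


/-! ### The function h over Hahn series -/

section Ratio

variable {W : Type*} [LinearOrder W] [Finite W]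

instance series_charZero : CharZero (Ser W ℂ) :=
  charZero_of_injective_ringHom (HahnSeries.C_injective (Γ := Lex (W → ℤ)) (R := ℂ))

theorem isRatio_h {c : ℂ} (hc : c ≠ 0) : IsRatio (g c : W → W → Ser W ℂ) (h c) where
  mul {a b} hab := by
    have h1 := param_sub_ne_zero hab
    have h2 : (HahnSeries.C c : Ser W ℂ) ≠ 0 := HahnSeries.C_ne_zero hc
    simp only [g, h]
    field_simp
  ne_zero {a b} hab := by
    refine div_ne_zero (fun e => ?_) (HahnSeries.C_ne_zero hc)
    have e' := congrArg (fun x => x.coeff (toLex (Pi.single a (-1)))) e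
    have h1 : (toLex (Pi.single a (-1)) : Lex (W → ℤ)) ≠ toLex (Pi.single b (-1)) := fun h' => by
      have := congrFun (congrArg ofLex h') a
      simp [hab] at this
    have h2 : (toLex (Pi.single a (-1)) : Lex (W → ℤ)) ≠ 0 := fun h' => by
      have := congrFun (congrArg ofLex h') a
      simp at this
    simp [param, HahnSeries.coeff_single_of_ne h1, HahnSeries.C_apply,
      HahnSeries.coeff_single_of_ne h2] at e'

theorem H_eq_pairProd (c : ℂ) (l : List W) : H c l = pairProd (h c) l := by
  induction l with
  | nil => rfl
  | cons v l ih => rw [H, ih, pairProd]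

end Ratio

/-! ### Parity and transposition of the coefficients of T -/

section Yangian

variable {W : Type*} [LinearOrder W] [Finite W] {par : Fin 3 → ZMod 2}

/-- The mode number `n` is common to all entries, so that a coefficient can be compared with its
transpose. -/
theorem T_coeff (c : ℂ) (w : W) (a : Lex (W → ℤ)) :
    (∃ n, ∀ i j, (T par c w i j).coeff a = c ^ n • mode par i j n)
      ∨ ∀ i j, (T par c w i j).coeff a = 0 := by
  by_cases h : ∃ n, expo w n = a
  · obtain ⟨n, rfl⟩ := h
    exact Or.inl ⟨n, fun _ _ => by rw [T, atInv_coeff, PowerSeries.coeff_mk]⟩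
  · push Not at h
    exact Or.inr fun _ _ => atInv_coeff_of_notMem w _ h

theorem gr_T_coeff (c : ℂ) (w : W) (i j : Fin 3) (a : Lex (W → ℤ)) :
    gr par ((T par c w i j).coeff a) = sgn (par i + par j) • (T par c w i j).coeff a := by
  rcases T_coeff c w a with ⟨n, h⟩ | h
  · rw [h, map_smul, gr_mode, smul_comm]
  · simp [h]

theorem psi_T_coeff (c : ℂ) (w : W) (i j : Fin 3) (a : Lex (W → ℤ)) :
    psi par ((T par c w i j).coeff a)
      = sgn (par i * par j + par i) • (T par c w j i).coeff a := by
  rcases T_coeff c w a with ⟨n, h⟩ | h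
  · rw [h, h, map_smul, psi_mode, smul_comm]
  · simp [h]

end Yangian

theorem coeff_rightAct {W : Type*} [LinearOrder W] [Finite W] {par : Fin 3 → ZMod 2} {Vd : Type*}
    [AddCommGroup Vd] [Module (Yangian par)ᵐᵒᵖ Vd] (x : Ser W Vd) (y : Ser W (Yangian par))
    (a : Lex (W → ℤ)) :
    (rightAct par x y).coeff a
      = ∑ᶠ i, MulOpposite.op (y.coeff i) • x.coeff (a - i) := coeff_smul_eq_finsum _ _ _

/-! ### Series with values in a representation -/

section Representation

variable {W : Type*} [LinearOrder W] [Finite W] {par : Fin 3 → ZMod 2} {V Vd : Type*}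
  [AddCommGroup V] [Module ℂ V] [Module (Yangian par) V] [IsScalarTower ℂ (Yangian par) V]
  [AddCommGroup Vd] [Module ℂ Vd] [Module (Yangian par)ᵐᵒᵖ Vd]
  [IsScalarTower ℂ (Yangian par)ᵐᵒᵖ Vd]

noncomputable instance vectorSeriesModule :
    Module (Ser W ℂ) (HahnModule (Lex (W → ℤ)) (Yangian par) V) :=
  Module.compHom _ (scalarHom W (Yangian par))

instance vectorSeries_isScalarTower : IsScalarTower (Ser W ℂ) (Ser W (Yangian par))
    (HahnModule (Lex (W → ℤ)) (Yangian par) V) :=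
  ⟨fun k => mul_smul (scalarHom W (Yangian par) k)⟩

attribute [local instance] scaleModule

namespace SingularRep

variable (W) in
/-- The singular vector as a constant series. -/
noncomputable def singular (M : SingularRep par V Vd) :
    HahnModule (Lex (W → ℤ)) (Yangian par) V :=
  HahnModule.of (Yangian par) (HahnSeries.single 0 M.Ω)

theorem smul_singular (M : SingularRep par V Vd) (B : Ser W (Yangian par)) :
    (HahnModule.of (Yangian par)).symm (B • M.singular W) = M.apply B := by
  ext a
  rw [singular, coeff_smul_eq_finsum, finsum_eq_single _ a]
  · rw [sub_self, HahnSeries.coeff_single_same]; rfl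
  · intro b hb
    rw [HahnSeries.coeff_single_of_ne (sub_ne_zero.2 hb.symm), smul_zero]

theorem T_smul_singular (M : SingularRep par V Vd) (c : ℂ) (w : W) (i : Fin 3) :
    T par c w i i • M.singular W = M.lam c i w • M.singular W := by
  apply (HahnModule.of (Yangian par)).symm.injective
  change _ = (HahnModule.of (Yangian par)).symm
    (scalarHom W (Yangian par) (M.lam c i w) • M.singular W)
  rw [smul_singular, smul_singular]
  ext a
  simp only [apply, HahnSeries.map_coeff, coeff_scalarHom, LinearMap.toSpanSingleton_apply,
    algebraMap_smul]
  by_cases h : ∃ n, expo w n = a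
  · obtain ⟨n, rfl⟩ := h
    rw [T, lam, atInv_coeff, atInv_coeff, PowerSeries.coeff_mk]
    cases n with
    | zero => simp [mode_zero]
    | succ n =>
      have := M.diag i n
      rw [gen] at this
      rw [smul_assoc, this, smul_smul]
      simp [PowerSeries.coeff_succ_X_mul, PowerSeries.coeff_one]
  · push Not at h
    rw [T, lam, atInv_coeff_of_notMem w _ h, atInv_coeff_of_notMem w _ h]
    simp

/-- The vectors `y Ω` for homogeneous elements `y` of parity `d`. -/
def homogeneous (M : SingularRep par V Vd) (d : ZMod 2) : Submodule ℂ V where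
  carrier := {v | ∃ y, gr par y = sgn d • y ∧ y • M.Ω = v}
  zero_mem' := ⟨0, by simp, zero_smul _ _⟩
  add_mem' := by
    rintro _ _ ⟨y, hy, rfl⟩ ⟨z, hz, rfl⟩
    exact ⟨y + z, by rw [map_add, hy, hz, smul_add], add_smul _ _ _⟩
  smul_mem' := by
    rintro k _ ⟨y, hy, rfl⟩
    exact ⟨k • y, by rw [map_smul, hy, smul_comm], smul_assoc _ _ _⟩

theorem smul_mem_homogeneous (M : SingularRep par V Vd) {d e : ZMod 2} {x : Yangian par} {v : V}
    (hx : gr par x = sgn e • x) (hv : v ∈ M.homogeneous d) : x • v ∈ M.homogeneous (e + d) := by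
  obtain ⟨y, hy, rfl⟩ := hv
  refine ⟨x * y, ?_, mul_smul _ _ _⟩
  rw [map_mul, hx, hy, smul_mul_smul_comm, sgn_add]

/-- The map is prescribed only on vectors `y • M.Ω`. A homogeneous representative `y` suffices to
apply `psi_mul`, so no grading of `V` is required. -/
theorem transp_smul_of_homogeneous (M : SingularRep par V Vd) {d e : ZMod 2} {x : Yangian par}
    {v : V} (hx : gr par x = sgn e • x) (hv : v ∈ M.homogeneous d) :
    M.transp (x • v) = sgn (e * d) • MulOpposite.op (psi par x) • M.transp v := by
  obtain ⟨y, hy, rfl⟩ := hv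
  rw [← mul_smul, M.transp_smul, M.transp_smul, psi_mul par e d x y hx hy, MulOpposite.op_smul,
    smul_assoc, MulOpposite.op_mul, mul_smul]

variable (W) in
/-- The series with coefficients in `M.homogeneous d`. -/
def homogeneousSeries (M : SingularRep par V Vd) (d : ZMod 2) :
    Submodule (Ser W ℂ) (HahnModule (Lex (W → ℤ)) (Yangian par) V) where
  carrier := {s | ∀ a, ((HahnModule.of (Yangian par)).symm s).coeff a ∈ M.homogeneous d}
  zero_mem' _ := zero_mem _
  add_mem' hs ht a := add_mem (hs a) (ht a)
  smul_mem' k s hs a := by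
    change ((HahnModule.of (Yangian par)).symm (scalarHom W (Yangian par) k •
      HahnModule.of (Yangian par) ((HahnModule.of (Yangian par)).symm s))).coeff a ∈ _
    rw [scalarHom_smul, coeff_scale]
    exact finsum_induction (· ∈ M.homogeneous d) (zero_mem _) (fun _ _ => add_mem)
      fun i => Submodule.smul_mem _ _ (hs _)

variable (W) in
/-- The transposition of vector-valued series. -/
noncomputable def transpSeries (M : SingularRep par V Vd) :
    HahnModule (Lex (W → ℤ)) (Yangian par) V →ₗ[Ser W ℂ] Ser W Vd where
  toFun s := ((HahnModule.of (Yangian par)).symm s).map M.transp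
  map_add' s t := by ext a; exact map_add M.transp _ _
  map_smul' k s := by
    change ((HahnModule.of (Yangian par)).symm (scalarHom W (Yangian par) k •
      HahnModule.of (Yangian par) ((HahnModule.of (Yangian par)).symm s))).map M.transp
        = scale k _
    rw [scalarHom_smul]
    ext a
    rw [HahnSeries.map_coeff, coeff_scale, coeff_scale, map_finsum _ (hasFiniteSupport_smul _ _ _)]
    simp only [map_smul, HahnSeries.map_coeff]

end SingularRep

variable (Vd) in
/-- The right action of a series with coefficients in the super-Yangian as a linear map. -/
noncomputable def rightOp (y : Ser W (Yangian par)) : Module.End (Ser W ℂ) (Ser W Vd) where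
  toFun x := rightAct par x y
  map_add' x x' := congrArg (HahnModule.of (Yangian par)ᵐᵒᵖ).symm (smul_add _ _ _)
  map_smul' k x := by
    change rightAct par (scale k x) y = scale k (rightAct par x y)
    rw [← scalarHom_smul (B := (Yangian par)ᵐᵒᵖ), ← scalarHom_smul (B := (Yangian par)ᵐᵒᵖ), rightAct,
      rightAct, Equiv.apply_symm_apply, Equiv.apply_symm_apply]
    have hs (p q : Ser W (Yangian par)ᵐᵒᵖ) (z : HahnModule (Lex (W → ℤ)) (Yangian par)ᵐᵒᵖ Vd)
        (hpq : p * q = q * p) : p • q • z = q • p • z :=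
      (mul_smul p q z).symm.trans ((congrArg (· • z) hpq).trans (mul_smul q p z))
    exact congrArg _ (hs _ _ _ (scalarHom_comm k _).symm)

/-- Every property is checked on coefficients; the convolution sums have finite support, so linear
maps may be applied termwise. -/
theorem SingularRep.transposition (M : SingularRep par V Vd) (c : ℂ) :
    Transposition par
      (fun i j w => Algebra.lsmul (Ser W ℂ) (Ser W ℂ) (HahnModule (Lex (W → ℤ)) (Yangian par) V)
        (T par c w i j))
      (M.singular W) (M.homogeneousSeries W) (M.transpSeries W)
      (fun i j w => rightOp Vd (T par c w i j)) where
  vac a := by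
    by_cases h : a = 0
    · exact ⟨1, by simp [sgn], by simp [h, singular]⟩
    · exact ⟨0, by simp, by simp [HahnSeries.coeff_single_of_ne h, singular]⟩
  mem {d s} hs i j w a := by
    change ((HahnModule.of (Yangian par)).symm (T par c w i j •
      HahnModule.of (Yangian par) ((HahnModule.of (Yangian par)).symm s))).coeff a ∈ _
    rw [coeff_smul_eq_finsum]
    exact finsum_induction (· ∈ M.homogeneous _) (zero_mem _) (fun _ _ => add_mem)
      fun b => M.smul_mem_homogeneous (gr_T_coeff c w i j b) (hs _)
  map {d s} hs i j w := by
    rw [Int.cast_smul_eq_zsmul]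
    ext a
    change M.transp (((HahnModule.of (Yangian par)).symm (T par c w i j •
      HahnModule.of (Yangian par) ((HahnModule.of (Yangian par)).symm s))).coeff a) = _
    rw [coeff_smul_eq_finsum, map_finsum _ (hasFiniteSupport_smul _ _ _), HahnSeries.coeff_smul]
    change _ = _ • (rightAct par (M.transpSeries W s) (T par c w j i)).coeff a
    rw [coeff_rightAct]
    refine Eq.trans ?_ (smul_finsum' _ (hasFiniteSupport_smul
      ((T par c w j i).map (MulOpposite.opAddEquiv : Yangian par ≃+ (Yangian par)ᵐᵒᵖ))
      (M.transpSeries W s) a)).symm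
    refine finsum_congr fun b => ?_
    rw [M.transp_smul_of_homogeneous (gr_T_coeff c w i j b) (hs _), psi_T_coeff,
      MulOpposite.op_smul, smul_assoc, smul_smul]
    rfl

theorem SingularRep.transp_apply_scalar_mul (M : SingularRep par V Vd) (c : ℂ) (hp0 : par 0 = 0)
    (hp2 : par 2 = 1) (k : Ser W ℂ) (us vs : List W) :
    (M.apply (scalar par k * yangianTrace par c us vs)).map M.transp
      = scale (k * ((sgn (vs.length * par 1) : ℤ) : Ser W ℂ)) (M.transpSeries W (offShell par (g c)
        (fun i j w => Algebra.lsmul (Ser W ℂ) (Ser W ℂ)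
          (HahnModule (Lex (W → ℤ)) (Yangian par) V) (T par c w i j))
        (M.singular W) us vs)) := by
  have h := superTrace_smul (γ := fun x => x.map (gr par)) hp0 hp2 (fun x => by
      rw [algebraMap_eq_scalar]
      ext a
      exact (gr par).commutes (x.coeff a)) (T par c) (fun w i j => by
      ext a
      exact gr_T_coeff c w i j a) (g c) us vs (M.singular W)
  change yangianTrace par c us vs • _ = _ at h
  rw [← smul_singular]
  change M.transpSeries W _ = _
  have h' : (scalar par k * yangianTrace par c us vs) • M.singular W
      = k • yangianTrace par c us vs • M.singular W := mul_smul _ _ _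
  rw [h', h, ← Int.cast_smul_eq_zsmul (Ser W ℂ)]
  rw [map_smul, map_smul]
  exact (mul_smul _ _ _).symm

end Representation


/-! ### Dual Bethe vectors as transposed nested vectors -/

section DualVectors

variable {W : Type*} [LinearOrder W] [Finite W] {V Vd : Type*}
  [AddCommGroup V] [Module ℂ V] [AddCommGroup Vd] [Module ℂ Vd]

attribute [local instance] scaleModule

theorem psi21_eq [Module Y21 V] [IsScalarTower ℂ Y21 V] [Module Y21ᵐᵒᵖ Vd]
    [IsScalarTower ℂ Y21ᵐᵒᵖ Vd] (M : SingularRep par21 V Vd) (c : ℂ) (us vs : List W) :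
    Psi21 M c us vs = ((-1) ^ vs.length / pairProd (h c) vs.reverse) •
      M.transpSeries W (offShell par21 (g c) (fun i j w => Algebra.lsmul (Ser W ℂ) (Ser W ℂ)
        (HahnModule (Lex (W → ℤ)) Y21 V) (T par21 c w i j)) (M.singular W)
        us.reverse vs.reverse) := by
  rw [Psi21, Phi21, bethe21, M.transp_apply_scalar_mul c rfl rfl, H_eq_pairProd,
    List.length_reverse]
  have : (vs.length : ZMod 2) * par21 1 = 0 := mul_zero _
  rw [this, show sgn 0 = 1 from rfl, Int.cast_one, mul_one]
  rfl

theorem psi12_eq [Module Y12 V] [IsScalarTower ℂ Y12 V] [Module Y12ᵐᵒᵖ Vd]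
    [IsScalarTower ℂ Y12ᵐᵒᵖ Vd] (M : SingularRep par12 V Vd) (c : ℂ) (us vs : List W) :
    Psi12 M c us vs = ((-1) ^ (us.length + vs.length) / pairProd (h c) us.reverse) •
      M.transpSeries W (offShell par12 (g c) (fun i j w => Algebra.lsmul (Ser W ℂ) (Ser W ℂ)
        (HahnModule (Lex (W → ℤ)) Y12 V) (T par12 c w i j)) (M.singular W)
        us.reverse vs.reverse) := by
  rw [Psi12, Phi12, bethe12, M.transp_apply_scalar_mul c rfl rfl, H_eq_pairProd,
    List.length_reverse, List.length_reverse]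
  -- Index 2 is odd for Y(1|2), so the super-trace contributes (-1)^b, which is trivial for Y(2|1).
  have : (vs.length : ZMod 2) * par12 1 = vs.length := mul_one _
  rw [this, sgn_natCast, Int.cast_pow, Int.cast_neg, Int.cast_one, div_mul_eq_mul_div, ← pow_add]
  rfl

end DualVectors

end SuperBethe

theorem mainTheorem8 {W : Type*} [LinearOrder W] [Finite W] (c : ℂ) (hc : c ≠ 0)
    {V Vd V' Vd' : Type*}
    [AddCommGroup V] [Module ℂ V] [Module SuperBethe.Y21 V] [IsScalarTower ℂ SuperBethe.Y21 V]
    [AddCommGroup Vd] [Module ℂ Vd] [Module SuperBethe.Y21ᵐᵒᵖ Vd]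
    [IsScalarTower ℂ SuperBethe.Y21ᵐᵒᵖ Vd]
    [AddCommGroup V'] [Module ℂ V'] [Module SuperBethe.Y12 V'] [IsScalarTower ℂ SuperBethe.Y12 V']
    [AddCommGroup Vd'] [Module ℂ Vd'] [Module SuperBethe.Y12ᵐᵒᵖ Vd']
    [IsScalarTower ℂ SuperBethe.Y12ᵐᵒᵖ Vd']
    (M : SuperBethe.SingularRep SuperBethe.par21 V Vd)
    (M' : SuperBethe.SingularRep SuperBethe.par12 V' Vd') :
    -- `Y(2|1)`, splitting off `T₂₁(u_a)`: `ū = {us, x}`, `v̄ = vs`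
    (∀ (us vs : List W) (x : W), (us ++ [x] ++ vs).Nodup →
      SuperBethe.Psi21 M c (us ++ [x]) vs =
        SuperBethe.rightAct SuperBethe.par21 (SuperBethe.Psi21 M c us vs)
            (SuperBethe.T SuperBethe.par21 c x 1 0)
        + (-1 : ℤ) ^ (vs.length - 1) • ∑ j : Fin vs.length,
            SuperBethe.scale
              (M.lam c 1 (vs.get j) * SuperBethe.g c (vs.get j) x
                * SuperBethe.prodOver us (fun u => SuperBethe.f c (vs.get j) u)
                * SuperBethe.prodOver (vs.eraseIdx j) (fun v => SuperBethe.g c v (vs.get j)))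
              (SuperBethe.rightAct SuperBethe.par21 (SuperBethe.Psi21 M c us (vs.eraseIdx j))
                (SuperBethe.T SuperBethe.par21 c x 2 0))) ∧
    -- `Y(2|1)`, splitting off `T₃₂(v_b)`: `ū = us`, `v̄ = {vs, y}`
    (∀ (us vs : List W) (y : W), (us ++ (vs ++ [y])).Nodup →
      SuperBethe.Psi21 M c us (vs ++ [y]) =
        (-1 : ℤ) ^ vs.length •
          SuperBethe.scale (SuperBethe.prodOver vs fun v => SuperBethe.h c v y)⁻¹
            (SuperBethe.rightAct SuperBethe.par21 (SuperBethe.Psi21 M c us vs)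
              (SuperBethe.T SuperBethe.par21 c y 2 1))
        + (-1 : ℤ) ^ vs.length •
          SuperBethe.scale (SuperBethe.prodOver vs fun v => SuperBethe.h c v y)⁻¹
            (∑ j : Fin us.length,
              SuperBethe.scale
                (M.lam c 1 (us.get j) * SuperBethe.g c y (us.get j)
                  * SuperBethe.prodOver vs (fun v => SuperBethe.f c v (us.get j))
                  * SuperBethe.prodOver (us.eraseIdx j) (fun u => SuperBethe.f c (us.get j) u))
                (SuperBethe.rightAct SuperBethe.par21 (SuperBethe.Psi21 M c (us.eraseIdx j) vs)
                  (SuperBethe.T SuperBethe.par21 c y 2 0)))) ∧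
    -- `Y(1|2)`, splitting off `T̃₂₁(u_a)`: `ū = {us, x}`, `v̄ = vs`
    (∀ (us vs : List W) (x : W), (us ++ [x] ++ vs).Nodup →
      SuperBethe.Psi12 M' c (us ++ [x]) vs =
        (-1 : ℤ) ^ us.length •
          SuperBethe.scale (SuperBethe.prodOver us fun u => SuperBethe.h c u x)⁻¹
            (SuperBethe.rightAct SuperBethe.par12 (SuperBethe.Psi12 M' c us vs)
              (SuperBethe.T SuperBethe.par12 c x 1 0))
        - (-1 : ℤ) ^ us.length •
          SuperBethe.scale (SuperBethe.prodOver us fun u => SuperBethe.h c u x)⁻¹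
            (∑ j : Fin vs.length,
              SuperBethe.scale
                (M'.lam c 1 (vs.get j) * SuperBethe.g c x (vs.get j)
                  * SuperBethe.prodOver us (fun u => SuperBethe.f c u (vs.get j))
                  * SuperBethe.prodOver (vs.eraseIdx j) (fun v => SuperBethe.f c (vs.get j) v))
                (SuperBethe.rightAct SuperBethe.par12 (SuperBethe.Psi12 M' c us (vs.eraseIdx j))
                  (SuperBethe.T SuperBethe.par12 c x 2 0)))) ∧
    -- `Y(1|2)`, splitting off `T̃₃₂(v_b)`: `ū = us`, `v̄ = {vs, y}`
    (∀ (us vs : List W) (y : W), (us ++ (vs ++ [y])).Nodup →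
      SuperBethe.Psi12 M' c us (vs ++ [y]) =
        - SuperBethe.rightAct SuperBethe.par12 (SuperBethe.Psi12 M' c us vs)
            (SuperBethe.T SuperBethe.par12 c y 2 1)
        - (-1 : ℤ) ^ (us.length - 1) • ∑ j : Fin us.length,
            SuperBethe.scale
              (M'.lam c 1 (us.get j) * SuperBethe.g c (us.get j) y
                * SuperBethe.prodOver vs (fun v => SuperBethe.f c (us.get j) v)
                * SuperBethe.prodOver (us.eraseIdx j) (fun u => SuperBethe.g c u (us.get j)))
              (SuperBethe.rightAct SuperBethe.par12 (SuperBethe.Psi12 M' c (us.eraseIdx j) vs)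
                (SuperBethe.T SuperBethe.par12 c y 2 0))) := by
  have hk := SuperBethe.isKernel_g (W := W) c
  have hh := SuperBethe.isRatio_h (W := W) hc
  -- For this module structure multiplication by a scalar series is `scale` by definition, so the
  -- abstract recursions match the statement.
  let _ := SuperBethe.scaleModule W Vd
  let _ := SuperBethe.scaleModule W Vd'
  have hR := (SuperBethe.rttRel_T (W := W) SuperBethe.par21 c).op
    (S := HahnModule (Lex (W → ℤ)) SuperBethe.Y21 V)
  have hR' := (SuperBethe.rttRel_T (W := W) SuperBethe.par12 c).op
    (S := HahnModule (Lex (W → ℤ)) SuperBethe.Y12 V')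
  have hΛ := fun z : W => M.T_smul_singular c z 1
  have hΛ' := fun z : W => M'.T_smul_singular c z 1
  have hX := SuperBethe.psi21_eq (W := W) M c
  have hX' := SuperBethe.psi12_eq (W := W) M' c
  exact ⟨fun us vs x hnd =>
      (M.transposition c).recursion_left_of_even hk hh rfl rfl rfl hR hΛ hX hnd,
    fun us vs y hnd => (M.transposition c).recursion_right_of_even hk rfl rfl rfl hR hΛ hX hnd,
    fun us vs x hnd => (M'.transposition c).recursion_left_of_odd hk rfl rfl rfl hR' hΛ' hX' hnd,
    fun us vs y hnd =>
      (M'.transposition c).recursion_right_of_odd hk hh rfl rfl rfl hR' hΛ' hX' hnd⟩
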